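/- Let $\mathcal H_A,\mathcal H_B$ be separable complex Hilbert spaces, $\{|i\rangle\}$ a fixed orthonormal basis of $\mathcal H_A$, and let bars denote complex conjugation of vectors and operators in this basis. Write $\mathfrak T(\mathcal H)$ for the trace-class operators and $\mathfrak S(\mathcal H)$ for the density operators (states) on $\mathcal H$. A channel is a linear map $\Phi:\mathfrak T(\mathcal H_A)\to\mathfrak T(\mathcal H_B)$ that maps states to states and for which $\sum_{i,j}\langle\psi_i|\Phi(|i\rangle\langle j|)|\psi_j\rangle\ge 0$ for every finite collection $\{\psi_i\}\subset\mathcal H_B$. Its Choi–Jamiołkowski (CJ) form is the sesquilinear form $\Omega_\Phi$ on the algebraic tensor product of $\mathcal H_B$ and $\mathcal H_A$ with $$\Omega_\Phi(\psi_B\otimes\psi_A;\psi_B'\otimes\psi_A')=\langle\psi_B|\Phi(|\bar\psi_A\rangle\langle\bar\psi_A'|)|\psi_B'\rangle .$$ $\Phi$ is entanglement-breaking if for every state $\omega$ on $\mathcal H_A\otimes\mathcal H_A$ the state $(\Phi\otimes\mathrm{Id}_A)(\omega)$ is separable, i.e. belongs to the weak-operator closure of the convex hull of the product states. Let $\mathfrak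 C_{BA}$ be the set of bounded positive operators $\Omega$ on $\mathcal H_B\otimes\mathcal H_A$ with $\mathrm{Tr}_B\Omega=I_A$ (i.e. $\sum_k\langle e_k\otimes\psi|\Omega|e_k\otimes\psi'\rangle=\langle\psi|\psi'\rangle$ for every orthonormal basis $\{e_k\}$ of $\mathcal H_B$ and all $\psi,\psi'\in\mathcal H_A$) that lie in the weak-operator closure of the convex set of operators $\sum_\alpha\rho_\alpha\otimes M_\alpha$, where $\rho_\alpha\in\mathfrak S(\mathcal H_B)$ and $\{M_\alpha\}$ is a finite resolution of the identity in $\mathcal H_A$ (finitely many positive operators with sum $I_A$). For a weakly Borel function $x\mapsto\rho_B(x)\in\mathfrak S(\mathcal H_B)$ on a complete separable metric space $\mathcal X$ and a probability operator-valued Borel measure (POVM) $M_A$ on $\mathcal X$ in $\mathcal H_A$, the integral $\int_{\mathcal X}\rho_B(x)\otimes\bar M_A(dx)$ is the limit in the weak operator topology of $\sum_\alpha\rho_\alpha^{(n)}\otimes\bar M_A(E_\alpha^{(n)})$ for any sequence of $\mathfrak S(\mathcal H_B)$-valued simple functions $\rho_n=\sum_\alpha\rho_\alpha^{(n)}1_{E_\alpha^{(n)}}$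 with $\|\rho_B(x)-\rho_n(x)\|_1\to0$ for all $x$ outside a Borel set $N$ with $M_A(N)=0$. Then: 1. If a channel $\Phi$ is entanglement-breaking, its CJ form is given by a bounded operator $\Omega_\Phi\in\mathfrak C_{BA}$. 2. If a channel $\Phi$ has a representation $\Phi(\rho)=\int_{\mathcal X}\rho_B(x)\,\mu_\rho(dx)$ for all states $\rho$, with $\mu_\rho(E)=\mathrm{Tr}\,\rho M_A(E)$, where $\mathcal X$ is a complete separable metric space, $\rho_B$ a Borel $\mathfrak S(\mathcal H_B)$-valued function and $M_A$ a POVM on $\mathcal X$ in $\mathcal H_A$, then its CJ form is given by a bounded operator $\Omega_\Phi\in\mathfrak C_{BA}$, the integral $\int_{\mathcal X}\rho_B(x)\otimes\bar M_A(dx)$ exists (approximating sequences $\rho_n$ exist, and the limit exists and is the same for all of them), and $$\Omega_\Phi=\int_{\mathcal X}\rho_B(x)\otimes\bar M_A(dx).$$ 3. Conversely, for every $\Omega\in\mathfrak C_{BA}$ there is an entanglement-breaking channel $\Phi$ whose CJ form is given by $\Omega$. -/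

import Mathlib

open scoped TensorProduct InnerProductSpace ComplexOrder Topology
open Filter MeasureTheory

noncomputable section

namespace CJ

section Hilbert

variable {H K : Type*} [NormedAddCommGroup H] [InnerProductSpace ℂ H]
  [NormedAddCommGroup K] [InnerProductSpace ℂ K]

/-! ### Trace-class operators and states -/

/-- `T = ∑ₙ |xₙ⟩⟨yₙ|` with `∑ₙ ‖xₙ‖ ‖yₙ‖ < ∞`. -/
def IsNuclearRep (T : H →L[ℂ] H) (x y : ℕ → H) : Prop :=
  Summable (fun n => ‖x n‖ * ‖y n‖) ∧ ∀ z, HasSum (fun n => ⟪y n, z⟫_ℂ • x n) (T z)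

/-- On a Hilbert space the trace-class operators are the nuclear ones, i.e. those of the form
`∑ₙ |xₙ⟩⟨yₙ|` with `∑ₙ ‖xₙ‖ ‖yₙ‖ < ∞`. -/
def IsTraceClass (T : H →L[ℂ] H) : Prop := ∃ x y : ℕ → H, IsNuclearRep T x y

/-- The trace norm, in its form as the nuclear norm: the infimum of `∑ₙ ‖xₙ‖ ‖yₙ‖` over all
representations `T = ∑ₙ |xₙ⟩⟨yₙ|`. -/
def traceNorm (T : H →L[ℂ] H) : ℝ :=
  sInf {c : ℝ | ∃ x y : ℕ → H, IsNuclearRep T x y ∧ c = ∑' n, ‖x n‖ * ‖y n‖}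

theorem isTraceClass_rankOne (x y : H) : IsTraceClass (InnerProductSpace.rankOne ℂ x y) := by
  refine ⟨Pi.single 0 x, Pi.single 0 y, ?_, fun z => ?_⟩
  · refine summable_of_ne_finset_zero (s := {0}) fun n hn => ?_
    have : n ≠ 0 := by simpa using hn
    simp [Pi.single_eq_of_ne this]
  · have := hasSum_single (f := fun n => ⟪(Pi.single 0 y : ℕ → H) n, z⟫_ℂ •
      (Pi.single 0 x : ℕ → H) n) 0 (fun n hn => by simp [Pi.single_eq_of_ne hn])
    simpa using this

theorem IsTraceClass.add {S T : H →L[ℂ] H} (hS : IsTraceClass S) (hT : IsTraceClass T) :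
    IsTraceClass (S + T) := by
  obtain ⟨x, y, h1, h2⟩ := hS
  obtain ⟨x', y', h1', h2'⟩ := hT
  let e : ℕ ≃ ℕ ⊕ ℕ := Equiv.natSumNatEquivNat.symm
  refine ⟨fun n => Sum.elim x x' (e n), fun n => Sum.elim y y' (e n), ?_, fun z => ?_⟩
  · refine (e.summable_iff (f := fun s => ‖Sum.elim x x' s‖ * ‖Sum.elim y y' s‖)).2 ?_
    exact Summable.sum _ h1 h1'
  · refine (e.hasSum_iff (f := fun s => ⟪Sum.elim y y' s, z⟫_ℂ • Sum.elim x x' s)).2 ?_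
    exact HasSum.sum (h2 z) (h2' z)

variable [CompleteSpace H] [CompleteSpace K]

/-- Trace-class operators form an ideal: `A T B` is trace class for bounded `A`, `B`. -/
theorem IsTraceClass.conj {T : K →L[ℂ] K} (hT : IsTraceClass T) (A : K →L[ℂ] H)
    (B : H →L[ℂ] K) : IsTraceClass (A ∘L T ∘L B) := by
  obtain ⟨x, y, h1, h2⟩ := hT
  refine ⟨fun n => A (x n), fun n => ContinuousLinearMap.adjoint B (y n), ?_, fun z => ?_⟩
  · refine Summable.of_nonneg_of_le (fun n => by positivity) (fun n => ?_)
      (h1.mul_left (‖A‖ * ‖ContinuousLinearMap.adjoint B‖))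
    calc ‖A (x n)‖ * ‖ContinuousLinearMap.adjoint B (y n)‖
        ≤ (‖A‖ * ‖x n‖) * (‖ContinuousLinearMap.adjoint B‖ * ‖y n‖) := by
          gcongr <;> exact ContinuousLinearMap.le_opNorm _ _
      _ = _ := by ring
  · have := (h2 (B z)).mapL A
    simpa [ContinuousLinearMap.adjoint_inner_left] using this

variable (H) in
/-- The space `𝔗(H)` of trace-class operators. -/
def TraceClass : Submodule ℂ (H →L[ℂ] H) where
  carrier := {T | IsTraceClass T}
  add_mem' := IsTraceClass.add
  zero_mem' := by simpa using isTraceClass_rankOne (0 : H) 0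
  smul_mem' c T hT := by
    simpa using hT.conj (c • ContinuousLinearMap.id ℂ H) (ContinuousLinearMap.id ℂ H)

/-- `|x⟩⟨y|` as an element of `𝔗(H)`. -/
def ketbra (x y : H) : TraceClass H := ⟨InnerProductSpace.rankOne ℂ x y, isTraceClass_rankOne x y⟩

theorem ketbra_add_left (x x' y : H) : ketbra (x + x') y = ketbra x y + ketbra x' y :=
  Subtype.ext (by simp [ketbra])

theorem ketbra_add_right (x y y' : H) : ketbra x (y + y') = ketbra x y + ketbra x y' :=
  Subtype.ext (by simp [ketbra])

theorem ketbra_smul_left (c : ℂ) (x y : H) : ketbra (c • x) y = c • ketbra x y :=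
  Subtype.ext (by simp [ketbra])

theorem ketbra_smul_right (c : ℂ) (x y : H) :
    ketbra x (c • y) = (starRingEnd ℂ) c • ketbra x y :=
  Subtype.ext (by simp [ketbra])

variable (H) in
/-- An orthonormal basis of `H`, as a set of vectors. -/
def someBasisSet : Set H := (exists_hilbertBasis ℂ H).choose

variable (H) in
/-- An orthonormal basis of `H`. -/
def someBasis : HilbertBasis (someBasisSet H) ℂ H := (exists_hilbertBasis ℂ H).choose_spec.choose

/-- `Tr T = ∑ᵢ ⟨eᵢ|T|eᵢ⟩`; for trace-class `T` the choice of the basis does not matter. -/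
def trace (T : H →L[ℂ] H) : ℂ := ∑' i, ⟪someBasis H i, T (someBasis H i)⟫_ℂ

/-- Density operators (states), the set `𝔖(H)`. -/
structure IsState (T : H →L[ℂ] H) : Prop where
  isTraceClass : IsTraceClass T
  isPositive : T.IsPositive
  trace_eq_one : trace T = 1

end Hilbert

/-! ### The Hilbert space tensor product -/

section Tensor

variable {E F : Type*} [NormedAddCommGroup E] [InnerProductSpace ℂ E]
  [NormedAddCommGroup F] [InnerProductSpace ℂ F]

theorem exists_orthonormal_rep (x : E ⊗[ℂ] F) :
    ∃ (n : ℕ) (f : Fin n → F) (e : Fin n → E), Orthonormal ℂ f ∧ x = ∑ i, e i ⊗ₜ[ℂ] f i := by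
  suffices h : ∃ V : Submodule ℂ F, FiniteDimensional ℂ V ∧
      ∀ (n : ℕ) (f : Fin n → F) (W : OrthonormalBasis (Fin n) ℂ V), (∀ i, f i = W i) →
        ∃ e : Fin n → E, x = ∑ i, e i ⊗ₜ[ℂ] f i by
    obtain ⟨V, hV, h⟩ := h
    let W := stdOrthonormalBasis ℂ V
    obtain ⟨e, he⟩ := h _ (fun i => (W i : F)) W (fun i => rfl)
    exact ⟨_, _, e, W.orthonormal.comp_linearIsometry V.subtypeₗᵢ, he⟩
  classical
  obtain ⟨s, hs⟩ := TensorProduct.exists_finset x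
  refine ⟨Submodule.span ℂ ((s.image Prod.snd : Finset F) : Set F), inferInstance,
    fun n f W hW => ?_⟩
  refine ⟨fun i => ∑ p ∈ s, ⟪f i, p.2⟫_ℂ • p.1, ?_⟩
  have key : ∀ p ∈ s, p.2 = ∑ i, ⟪f i, p.2⟫_ℂ • f i := by
    intro p hp
    have hmem : p.2 ∈ Submodule.span ℂ ((s.image Prod.snd : Finset F) : Set F) :=
      Submodule.subset_span (by simpa using ⟨p.1, hp⟩)
    have := congrArg Subtype.val (W.sum_repr' ⟨p.2, hmem⟩)
    simp only [Submodule.coe_inner, AddSubmonoidClass.coe_finsetSum, Submodule.coe_smul,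
      ← hW] at this
    exact this.symm
  rw [hs]
  calc ∑ p ∈ s, p.1 ⊗ₜ[ℂ] p.2 = ∑ p ∈ s, ∑ i, (⟪f i, p.2⟫_ℂ • p.1) ⊗ₜ[ℂ] f i := by
        refine Finset.sum_congr rfl fun p hp => ?_
        conv_lhs => rw [key p hp]
        simp [TensorProduct.tmul_sum, TensorProduct.smul_tmul]
    _ = _ := by
        rw [Finset.sum_comm]
        simp [TensorProduct.sum_tmul]

theorem norm_sq_sum_tmul {n : ℕ} {f : Fin n → F} (hf : Orthonormal ℂ f) (e : Fin n → E) :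
    ‖∑ i, e i ⊗ₜ[ℂ] f i‖ ^ 2 = ∑ i, ‖e i‖ ^ 2 := by
  have h : ⟪∑ i, e i ⊗ₜ[ℂ] f i, ∑ i, e i ⊗ₜ[ℂ] f i⟫_ℂ = ∑ i, ⟪e i, e i⟫_ℂ := by
    simp only [sum_inner, inner_sum, TensorProduct.inner_tmul]
    refine Finset.sum_congr rfl fun i _ => ?_
    rw [Finset.sum_eq_single i]
    · simp [inner_self_eq_norm_sq_to_K, hf.1 i]
    · intro j _ hj
      simp [hf.2 hj]
    · simp
  have h' := (inner_self_eq_norm_sq_to_K (𝕜 := ℂ) (∑ i, e i ⊗ₜ[ℂ] f i)).symm.trans h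
  simp only [inner_self_eq_norm_sq_to_K] at h'
  exact Complex.ofReal_injective (by simpa using h')

theorem norm_rTensor_le (S : E →L[ℂ] E) (x : E ⊗[ℂ] F) :
    ‖TensorProduct.map S.toLinearMap LinearMap.id x‖ ≤ ‖S‖ * ‖x‖ := by
  obtain ⟨n, f, e, hf, rfl⟩ := exists_orthonormal_rep x
  refine le_of_sq_le_sq ?_ (by positivity)
  simp only [map_sum, TensorProduct.map_tmul, LinearMap.id_apply, mul_pow]
  rw [norm_sq_sum_tmul hf, norm_sq_sum_tmul hf, Finset.mul_sum]
  refine Finset.sum_le_sum fun i _ => ?_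
  rw [← mul_pow]
  gcongr
  exact S.le_opNorm _

theorem norm_map_le (S : E →L[ℂ] E) (T : F →L[ℂ] F) (x : E ⊗[ℂ] F) :
    ‖TensorProduct.map S.toLinearMap T.toLinearMap x‖ ≤ ‖S‖ * ‖T‖ * ‖x‖ := by
  have h : TensorProduct.map S.toLinearMap T.toLinearMap x =
      TensorProduct.map S.toLinearMap LinearMap.id
        (TensorProduct.comm ℂ F E (TensorProduct.map T.toLinearMap LinearMap.id
          (TensorProduct.comm ℂ E F x))) := by
    induction x with
    | zero => simp
    | tmul a b => simp
    | add a b ha hb => simp only [map_add, ha, hb]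
  rw [h, mul_assoc]
  refine (norm_rTensor_le S _).trans ?_
  gcongr
  rw [TensorProduct.norm_comm]
  refine (norm_rTensor_le T _).trans ?_
  rw [TensorProduct.norm_comm]

variable (E F) in
/-- The Hilbert space `E ⊗ F`: completion of the algebraic tensor product. -/
abbrev HTensor : Type _ := UniformSpace.Completion (E ⊗[ℂ] F)

/-- The product vector `x ⊗ y` in the Hilbert space tensor product. -/
def pv (x : E) (y : F) : HTensor E F := ((x ⊗ₜ[ℂ] y : E ⊗[ℂ] F) : HTensor E F)

/-- The bounded operator `S ⊗ T` on the Hilbert space `E ⊗ F`. -/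
def tensorOp (S : E →L[ℂ] E) (T : F →L[ℂ] F) : HTensor E F →L[ℂ] HTensor E F :=
  (UniformSpace.Completion.toComplL ∘L
    LinearMap.mkContinuous (TensorProduct.map S.toLinearMap T.toLinearMap) (‖S‖ * ‖T‖)
      (norm_map_le S T)).extend UniformSpace.Completion.toComplL

theorem tensorOp_pv (S : E →L[ℂ] E) (T : F →L[ℂ] F) (x : E) (y : F) :
    tensorOp S T (pv x y) = pv (S x) (T y) := by
  have h := ContinuousLinearMap.extend_eq (e := (UniformSpace.Completion.toComplL (𝕜 := ℂ)
    (E := E ⊗[ℂ] F))) (UniformSpace.Completion.toComplL ∘L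
    LinearMap.mkContinuous (TensorProduct.map S.toLinearMap T.toLinearMap) (‖S‖ * ‖T‖)
      (norm_map_le S T)) UniformSpace.Completion.denseRange_coe
      (UniformSpace.Completion.isUniformInducing_coe _) (x ⊗ₜ y)
  exact h

/-- The bounded operator `x ↦ x ⊗ y` from `E` to `E ⊗ F`. -/
def tensorRight (y : F) : E →L[ℂ] HTensor E F :=
  UniformSpace.Completion.toComplL ∘L (TensorProduct.mkL ℂ E F).flip y

theorem tensorRight_apply (x : E) (y : F) : tensorRight y x = pv x y := rfl

end Tensor

/-! ### Complex conjugation in a basis -/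

section Conj

variable {H : Type*} [NormedAddCommGroup H] [InnerProductSpace ℂ H] {ι : Type*}

/-- `ψ ↦ ψ̄ = ∑ᵢ conj ⟨i|ψ⟩ |i⟩`, the complex conjugation in the basis `b`. -/
def conjVec (b : HilbertBasis ι ℂ H) : H →L⋆[ℂ] H :=
  LinearMap.mkContinuous
    { toFun := fun ψ => b.repr.symm (star (b.repr ψ))
      map_add' := fun x y => by simp
      map_smul' := fun c x => by
        rw [map_smul, star_smul, map_smul]; rfl } 1 (fun x => by simp)

theorem hasSum_conjVec (b : HilbertBasis ι ℂ H) (ψ : H) :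
    HasSum (fun i => (starRingEnd ℂ) ⟪b i, ψ⟫_ℂ • b i) (conjVec b ψ) := by
  have h := b.hasSum_repr_symm (star (b.repr ψ))
  simp only [lp.star_apply, b.repr_apply_apply] at h
  exact h

/-- `M̄`, the entrywise complex conjugate of the operator `M` in the basis `b`. -/
def conjOp (b : HilbertBasis ι ℂ H) (M : H →L[ℂ] H) : H →L[ℂ] H :=
  (conjVec b).comp (M.comp (conjVec b))

end Conj

/-! ### Channels, separable states, entanglement breaking -/

section Channels

variable {HB HA : Type*}
  [NormedAddCommGroup HB] [InnerProductSpace ℂ HB] [CompleteSpace HB]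
  [NormedAddCommGroup HA] [InnerProductSpace ℂ HA] [CompleteSpace HA] {ι : Type*}

/-- A linear map `Φ : 𝔗(H_A) → 𝔗(H_B)` is a channel if it maps states to states and the block
matrix `[Φ(|i⟩⟨j|)]`, in the basis `b` of `H_A`, is positive semidefinite. -/
structure IsChannel (b : HilbertBasis ι ℂ HA) (Φ : TraceClass HA →ₗ[ℂ] TraceClass HB) : Prop where
  map_state : ∀ ρ : TraceClass HA, IsState (ρ : HA →L[ℂ] HA) → IsState (Φ ρ : HB →L[ℂ] HB)
  block_nonneg : ∀ (s : Finset ι) (ψ : ι → HB),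
    0 ≤ ∑ i ∈ s, ∑ j ∈ s, ⟪ψ i, (Φ (ketbra (b i) (b j)) : HB →L[ℂ] HB) (ψ j)⟫_ℂ

/-- The Choi-Jamiolkowski form of `Φ` in the basis `b`: the sesquilinear form (antilinear in the
first argument) on the algebraic tensor product of `H_B` and `H_A` with
`Ω_Φ(ψ_B ⊗ ψ_A; ψ_B' ⊗ ψ_A') = ⟨ψ_B| Φ(|ψ̄_A⟩⟨ψ̄_A'|) |ψ_B'⟩`. -/
def cjForm (b : HilbertBasis ι ℂ HA) (Φ : TraceClass HA →ₗ[ℂ] TraceClass HB) :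
    (HB ⊗[ℂ] HA) →ₗ⋆[ℂ] (HB ⊗[ℂ] HA) →ₗ[ℂ] ℂ :=
  TensorProduct.lift <| LinearMap.mk₂'ₛₗ (starRingEnd ℂ) (starRingEnd ℂ)
    (fun ψB ψA => TensorProduct.lift <| LinearMap.mk₂' ℂ ℂ
      (fun ψB' ψA' =>
        ⟪ψB, (Φ (ketbra (conjVec b ψA) (conjVec b ψA')) : HB →L[ℂ] HB) ψB'⟫_ℂ)
      (by intros; simp)
      (by intros; simp)
      (by intros; simp [ketbra_add_right])
      (by intros; simp [ketbra_smul_right]))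
    (by intros; ext; simp)
    (by intros; ext; simp [mul_comm])
    (by intros; ext; simp [ketbra_add_left])
    (by intros; ext; simp [ketbra_smul_left])

theorem cjForm_tmul (b : HilbertBasis ι ℂ HA) (Φ : TraceClass HA →ₗ[ℂ] TraceClass HB)
    (ψB ψB' : HB) (ψA ψA' : HA) :
    cjForm b Φ (ψB ⊗ₜ ψA) (ψB' ⊗ₜ ψA') =
      ⟪ψB, (Φ (ketbra (conjVec b ψA) (conjVec b ψA')) : HB →L[ℂ] HB) ψB'⟫_ℂ := rfl

/-- The form `Ω_Φ` is given by the bounded operator `Ω`. -/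
def IsCJOperator (b : HilbertBasis ι ℂ HA) (Φ : TraceClass HA →ₗ[ℂ] TraceClass HB)
    (Ω : HTensor HB HA →L[ℂ] HTensor HB HA) : Prop :=
  ∀ x y : HB ⊗[ℂ] HA, cjForm b Φ x y = ⟪(x : HTensor HB HA), Ω (y : HTensor HB HA)⟫_ℂ

/-- The partial matrix element `⟨a|ω|a'⟩ = Tr₂ (I ⊗ |a'⟩⟨a|) ω`, a trace-class operator in the
first factor: `⟨x| ⟨a|ω|a'⟩ |y⟩ = ⟨x ⊗ a|ω|y ⊗ a'⟩`. -/
def slice (ω : TraceClass (HTensor HA HA)) (a a' : HA) : TraceClass HA :=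
  ⟨ContinuousLinearMap.adjoint (tensorRight a) ∘L (ω : HTensor HA HA →L[ℂ] HTensor HA HA) ∘L
    tensorRight a', IsTraceClass.conj ω.2 _ _⟩

/-- `R = (Φ ⊗ Id_A)(ω)`, expressed through the matrix elements on product vectors, which determine
the bounded operator `R`. For `ω = S ⊗ T` the right-hand side is `⟨ψ_B|Φ(S)|ψ_B'⟩⟨ψ_A|T|ψ_A'⟩`. -/
def IsAmplification (Φ : TraceClass HA →ₗ[ℂ] TraceClass HB) (ω : TraceClass (HTensor HA HA))
    (R : HTensor HB HA →L[ℂ] HTensor HB HA) : Prop :=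
  ∀ (ψB ψB' : HB) (ψA ψA' : HA),
    ⟪pv ψB ψA, R (pv ψB' ψA')⟫_ℂ = ⟪ψB, (Φ (slice ω ψA ψA') : HB →L[ℂ] HB) ψB'⟫_ℂ

variable (HB HA) in
/-- The product states on `H_B ⊗ H_A`. -/
def productStates : Set (HTensor HB HA →L[ℂ] HTensor HB HA) :=
  {R | ∃ (S : HB →L[ℂ] HB) (T : HA →L[ℂ] HA), IsState S ∧ IsState T ∧ R = tensorOp S T}

/-- A state is separable if it lies in the closure, in the weak operator topology, of the convex
hull of the product states. -/
def IsSeparableState (R : HTensor HB HA →L[ℂ] HTensor HB HA) : Prop :=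
  IsState R ∧ ContinuousLinearMapWOT.ofCLM R ∈
    closure (ContinuousLinearMapWOT.ofCLM '' convexHull ℝ (productStates HB HA))

/-- `Φ` is entanglement-breaking if `(Φ ⊗ Id_A)(ω)` is a separable state for every state `ω` on
`H_A ⊗ H_A`. -/
def IsEntanglementBreaking (Φ : TraceClass HA →ₗ[ℂ] TraceClass HB) : Prop :=
  ∀ ω : TraceClass (HTensor HA HA), IsState (ω : HTensor HA HA →L[ℂ] HTensor HA HA) →
    ∃ R, IsAmplification Φ ω R ∧ IsSeparableState R

/-! ### Separable operators -/

/-- `Tr_B Ω = I_A`: for every orthonormal basis `(eₖ)` of `H_B`,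
`∑ₖ ⟨eₖ ⊗ ψ|Ω|eₖ ⊗ ψ'⟩ = ⟨ψ|ψ'⟩`. -/
def PartialTraceEqOne (Ω : HTensor HB HA →L[ℂ] HTensor HB HA) : Prop :=
  ∀ (w : Set HB) (e : HilbertBasis w ℂ HB) (ψ ψ' : HA),
    HasSum (fun k => ⟪pv (e k) ψ, Ω (pv (e k) ψ')⟫_ℂ) ⟪ψ, ψ'⟫_ℂ

variable (HB HA) in
/-- Operators `∑_α ρ_α ⊗ M_α` with states `ρ_α` and a finite resolution of the identity `M_α`. -/
def finiteSeparable : Set (HTensor HB HA →L[ℂ] HTensor HB HA) :=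
  {Ω | ∃ (n : ℕ) (ρ : Fin n → HB →L[ℂ] HB) (M : Fin n → HA →L[ℂ] HA),
    (∀ α, IsState (ρ α)) ∧ (∀ α, (M α).IsPositive) ∧ ∑ α, M α = 1 ∧
    Ω = ∑ α, tensorOp (ρ α) (M α)}

variable (HB HA) in
/-- The set `ℭ_BA` of separable operators: the bounded positive operators `Ω` with `Tr_B Ω = I_A`
in the closure of `finiteSeparable` in the weak operator topology. -/
def separableOperators : Set (HTensor HB HA →L[ℂ] HTensor HB HA) :=
  {Ω | Ω.IsPositive ∧ PartialTraceEqOne Ω ∧ ContinuousLinearMapWOT.ofCLM Ω ∈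
    closure (ContinuousLinearMapWOT.ofCLM '' finiteSeparable HB HA)}

/-! ### Integration with respect to a POVM -/

/-- A probability operator-valued measure on `X` in `H`, countably additive in the weak operator
topology. -/
structure POVM (X : Type*) [MeasurableSpace X] (H : Type*) [NormedAddCommGroup H]
    [InnerProductSpace ℂ H] [CompleteSpace H] where
  toFun : Set X → H →L[ℂ] H
  isPositive : ∀ E, MeasurableSet E → (toFun E).IsPositive
  univ_eq_one : toFun Set.univ = 1
  hasSum_iUnion : ∀ E : ℕ → Set X, (∀ n, MeasurableSet (E n)) →
    Pairwise (Function.onFun Disjoint E) → ∀ ψ ψ' : H, HasSum (fun n => ⟪ψ, toFun (E n) ψ'⟫_ℂ) ⟪ψ, toFun (⋃ n, E n) ψ'⟫_ℂ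

variable {X : Type*} [MeasurableSpace X]

/-- A Borel function with values in the states. -/
def IsBorelStateFun (ρ : X → HB →L[ℂ] HB) : Prop :=
  (∀ x, IsState (ρ x)) ∧ ∀ ψ ψ' : HB, Measurable fun x => ⟪ψ, ρ x ψ'⟫_ℂ

/-- `μ` is the probability measure `μ_ρ(E) = Tr ρ M(E)`. -/
def IsOutcomeMeasure (M : POVM X HA) (ρ : HA →L[ℂ] HA) (μ : Measure X) : Prop :=
  ∀ E, MeasurableSet E → μ E = ENNReal.ofReal (trace (ρ ∘L M.toFun E)).re

/-- `Φ(ρ) = ∫ ρ_B(x) μ_ρ(dx)` for all states `ρ`, where `μ_ρ(E) = Tr ρ M(E)`; the integral of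
the operator-valued function `ρ_B` is expressed through its matrix elements. -/
def HasRepresentation (Φ : TraceClass HA →ₗ[ℂ] TraceClass HB) (ρB : X → HB →L[ℂ] HB)
    (M : POVM X HA) : Prop :=
  ∀ ρ : TraceClass HA, IsState (ρ : HA →L[ℂ] HA) →
    ∃ μ : Measure X, IsOutcomeMeasure M (ρ : HA →L[ℂ] HA) μ ∧
      ∀ ψ ψ' : HB, ⟪ψ, (Φ ρ : HB →L[ℂ] HB) ψ'⟫_ℂ = ∫ x, ⟪ψ, ρB x ψ'⟫_ℂ ∂μ

/-- `∫ s(x) ⊗ M̄(dx) = ∑_α ρ_α ⊗ M̄(E_α)` for a simple function `s = ∑_α ρ_α 1_{E_α}`. -/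
def simpleIntegral (b : HilbertBasis ι ℂ HA) (s : SimpleFunc X (HB →L[ℂ] HB)) (M : POVM X HA) :
    HTensor HB HA →L[ℂ] HTensor HB HA :=
  ∑ r ∈ s.range, tensorOp r (conjOp b (M.toFun (s ⁻¹' {r})))

/-- The state-valued simple functions `sₙ` converge to `ρ` in trace norm `M`-almost everywhere.
The sets `N` with `M(N) = 0` are the null sets of `E ↦ Tr σ M(E)` for any full-rank state `σ`. -/
def IsSimpleApprox (ρ : X → HB →L[ℂ] HB) (M : POVM X HA)
    (s : ℕ → SimpleFunc X (HB →L[ℂ] HB)) : Prop :=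
  (∀ n x, IsState (s n x)) ∧ ∃ N, MeasurableSet N ∧ M.toFun N = 0 ∧
    ∀ x ∉ N, Tendsto (fun n => traceNorm (ρ x - s n x)) atTop (𝓝 0)

/-- `Ω = ∫ ρ(x) ⊗ M̄(dx)`: approximating sequences of simple functions exist, and for each of them
the integrals of the simple functions converge to `Ω` in the weak operator topology. -/
def IsPOVMIntegral (b : HilbertBasis ι ℂ HA) (ρ : X → HB →L[ℂ] HB) (M : POVM X HA)
    (Ω : HTensor HB HA →L[ℂ] HTensor HB HA) : Prop :=
  (∃ s, IsSimpleApprox ρ M s) ∧ ∀ s, IsSimpleApprox ρ M s →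
    Tendsto (fun n => ContinuousLinearMapWOT.ofCLM (simpleIntegral b (s n) M)) atTop
      (𝓝 (ContinuousLinearMapWOT.ofCLM Ω))

end Channels

end CJ

end

/-! Everything rests on one uniform bound. A state satisfies ρ ≤ I, so ∑ ρ_α ⊗ M_α ≤ ∑ I ⊗ M_α = I
(`norm_finiteSeparable_le`). A sesquilinear form on the algebraic tensor product that is a pointwise
limit of such operators is therefore bounded by 1, is given by a positive operator, and that
operator is their weak limit (`exists_op_of_tendsto_finiteSeparable`). The condition Tr_B Ω = I need
not survive weak limits; it is read off from trace preservation of Φ instead.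

Entanglement-breaking channels: over a finite orthonormal family g_1, …, g_n, the CJ form is n times
the matrix of (Φ ⊗ Id) applied to the maximally entangled state. This state is a weak limit of
convex combinations R_k of product states. On the span of g the matrices of Tr_B R_k tend to I/n,
because each R_k has mass at most 1 there and the limit has mass exactly 1
(`tendsto_partialTraceElem`). So n R_k, compressed to the span, scaled by a factor tending to 1 and
completed by one extra term, is a finite separable operator with almost the right matrix elements
(`exists_finiteSeparable_of_convexHull`). Letting the finite family grow gives the form everywhere.

Integral representation: diagonal matrix elements of the integral of a simple function are scalar
integrals against μ_ρ, so dominated convergence and polarization give convergence to the CJ form for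
every approximating sequence. Such sequences exist since, on states, convergence of matrix elements
forces convergence in trace norm.

Converse: write Ω = A*A. Then Tr_B Ω = I says that ψ ↦ A(ψ ⊗ a) is Hilbert–Schmidt of norm ‖a‖,
which makes Φ(|x⟩⟨y|) trace class (`exists_cj_image`). For ω = ∑ |u_n⟩⟨v_n| the state (Φ ⊗ Id)(ω) is
∑ (1 ⊗ K_{u_n})* Ω (1 ⊗ K_{v_n}), with K the Hilbert–Schmidt operators `slant`. This expression is
weakly continuous in Ω on the unit ball and takes finite separable operators to convex combinations
of product states. -/

namespace CJ

open ContinuousLinearMap (adjoint)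

/-! ### Nuclear representations, trace norm, trace, and Hilbert–Schmidt products. -/

section Trace

variable {H K : Type*} [NormedAddCommGroup H] [InnerProductSpace ℂ H]
  [NormedAddCommGroup K] [InnerProductSpace ℂ K]

/-- `T` has a nuclear representation of total weight at most `c`. -/
def NuclearBound (T : H →L[ℂ] H) (c : ℝ) : Prop :=
  ∃ x y : ℕ → H, IsNuclearRep T x y ∧ ∑' n, ‖x n‖ * ‖y n‖ ≤ c

theorem NuclearBound.isTraceClass {T : H →L[ℂ] H} {c : ℝ} (h : NuclearBound T c) :
    IsTraceClass T := by
  obtain ⟨x, y, h, -⟩ := h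
  exact ⟨x, y, h⟩

theorem NuclearBound.traceNorm_le {T : H →L[ℂ] H} {c : ℝ} (h : NuclearBound T c) :
    traceNorm T ≤ c := by
  obtain ⟨x, y, h, hc⟩ := h
  refine le_trans (csInf_le ⟨0, ?_⟩ ⟨x, y, h, rfl⟩) hc
  rintro _ ⟨x, y, -, rfl⟩
  exact tsum_nonneg fun n => by positivity

theorem traceNorm_nonneg (T : H →L[ℂ] H) : 0 ≤ traceNorm T := by
  refine Real.sInf_nonneg ?_
  rintro _ ⟨x, y, -, rfl⟩
  exact tsum_nonneg fun n => by positivity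

/-- A nuclear representation over an arbitrary index set. -/
theorem nuclearBound_of_hasSum {κ : Type*} {T : H →L[ℂ] H} {x y : κ → H}
    (hs : Summable fun k => ‖x k‖ * ‖y k‖) (hT : ∀ z, HasSum (fun k => ⟪y k, z⟫_ℂ • x k) (T z)) :
    NuclearBound T (∑' k, ‖x k‖ * ‖y k‖) := by
  -- Summability forces countable support, so the index set embeds in ℕ, padded by zeros.
  have hc : (Function.support fun k => ‖x k‖ * ‖y k‖).Countable := hs.countable_support
  set s := Function.support fun k => ‖x k‖ * ‖y k‖ with hsdef
  have : Countable s := hc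
  obtain ⟨f, hf⟩ := exists_injective_nat s
  have hz : ∀ z, Function.support (fun k => ⟪y k, z⟫_ℂ • x k) ⊆ s := by
    intro z k hk
    simp only [Function.mem_support, ne_eq, smul_eq_zero, not_or, hsdef, mul_eq_zero,
      norm_eq_zero] at hk ⊢
    refine ⟨hk.2, fun h => hk.1 (by simp [h])⟩
  have e1 : (fun n => ‖Function.extend f (fun k : s => x k) 0 n‖ *
      ‖Function.extend f (fun k : s => y k) 0 n‖) =
      Function.extend f (fun k : s => ‖x k‖ * ‖y k‖) 0 := by
    ext n
    by_cases hn : ∃ k, f k = n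
    · obtain ⟨k, rfl⟩ := hn
      simp [hf.extend_apply]
    · simp [Function.extend_apply' _ _ _ hn]
  have hsum : HasSum (Function.extend f (fun k : s => ‖x k‖ * ‖y k‖) 0)
      (∑' k, ‖x k‖ * ‖y k‖) := by
    rw [hasSum_extend_zero hf]
    exact (hasSum_subtype_iff_of_support_subset subset_rfl).2 hs.hasSum
  refine ⟨Function.extend f (fun k : s => x k) 0, Function.extend f (fun k : s => y k) 0,
    ⟨?_, fun z => ?_⟩, ?_⟩
  · rw [e1]; exact hsum.summable
  · have e2 : (fun n => ⟪Function.extend f (fun k : s => y k) 0 n, z⟫_ℂ •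
        Function.extend f (fun k : s => x k) 0 n) =
        Function.extend f (fun k : s => ⟪y k, z⟫_ℂ • x k) 0 := by
      ext n
      by_cases hn : ∃ k, f k = n
      · obtain ⟨k, rfl⟩ := hn
        simp [hf.extend_apply]
      · simp [Function.extend_apply' _ _ _ hn]
    rw [e2, hasSum_extend_zero hf]
    exact (hasSum_subtype_iff_of_support_subset (hz z)).2 (hT z)
  · rw [e1, hsum.tsum_eq]

theorem NuclearBound.add {S T : H →L[ℂ] H} {c d : ℝ} (hS : NuclearBound S c)
    (hT : NuclearBound T d) : NuclearBound (S + T) (c + d) := by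
  obtain ⟨x, y, ⟨h1, h2⟩, h3⟩ := hS
  obtain ⟨x', y', ⟨h1', h2'⟩, h3'⟩ := hT
  have hsum := HasSum.sum (f := fun s => ‖Sum.elim x x' s‖ * ‖Sum.elim y y' s‖)
    h1.hasSum h1'.hasSum
  obtain ⟨a, b, hab, hle⟩ := nuclearBound_of_hasSum (T := S + T) hsum.summable
    (fun z => HasSum.sum (f := fun s => ⟪Sum.elim y y' s, z⟫_ℂ • Sum.elim x x' s) (h2 z) (h2' z))
  refine ⟨a, b, hab, hle.trans ?_⟩
  rw [hsum.tsum_eq]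
  exact add_le_add h3 h3'

theorem NuclearBound.mono {T : H →L[ℂ] H} {c d : ℝ} (h : NuclearBound T c) (hcd : c ≤ d) :
    NuclearBound T d :=
  let ⟨x, y, h, hc⟩ := h; ⟨x, y, h, hc.trans hcd⟩

theorem nuclearBound_rankOne (x y : H) :
    NuclearBound (InnerProductSpace.rankOne ℂ x y) (‖x‖ * ‖y‖) := by
  have h := nuclearBound_of_hasSum (κ := Unit) (T := InnerProductSpace.rankOne ℂ x y)
    (x := fun _ => x) (y := fun _ => y) (hasSum_fintype _).summable (fun z => by simp)
  simpa using h

theorem nuclearBound_zero : NuclearBound (0 : H →L[ℂ] H) 0 := by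
  simpa using nuclearBound_rankOne (0 : H) 0

theorem NuclearBound.sum {κ : Type*} (s : Finset κ) {T : κ → H →L[ℂ] H} {c : κ → ℝ}
    (h : ∀ k ∈ s, NuclearBound (T k) (c k)) : NuclearBound (∑ k ∈ s, T k) (∑ k ∈ s, c k) := by
  classical
  induction s using Finset.induction_on with
  | empty => simpa using nuclearBound_zero
  | insert a s ha ih =>
    rw [Finset.sum_insert ha, Finset.sum_insert ha]
    exact (h a (by simp)).add (ih fun k hk => h k (by simp [hk]))

theorem NuclearBound.neg {T : H →L[ℂ] H} {c : ℝ} (h : NuclearBound T c) : NuclearBound (-T) c := by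
  obtain ⟨x, y, ⟨h1, h2⟩, h3⟩ := h
  exact ⟨fun n => - x n, y, ⟨by simpa using h1, fun z => by simpa using (h2 z).neg⟩, by simpa using h3⟩

theorem IsTraceClass.exists_nuclearBound {T : H →L[ℂ] H} (hT : IsTraceClass T) {ε : ℝ}
    (hε : 0 < ε) : NuclearBound T (traceNorm T + ε) := by
  obtain ⟨x, y, h⟩ := hT
  obtain ⟨_, ⟨x', y', h', rfl⟩, hlt⟩ := exists_lt_of_csInf_lt
    (s := {c : ℝ | ∃ x y : ℕ → H, IsNuclearRep T x y ∧ c = ∑' n, ‖x n‖ * ‖y n‖}) ⟨_, x, y, h, rfl⟩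
    (lt_add_of_pos_right (traceNorm T) hε)
  exact ⟨x', y', h', hlt.le⟩

theorem NuclearBound.norm_le {T : H →L[ℂ] H} {c : ℝ} (h : NuclearBound T c) : ‖T‖ ≤ c := by
  obtain ⟨x, y, ⟨h1, h2⟩, h3⟩ := h
  refine T.opNorm_le_bound ((tsum_nonneg fun n => by positivity).trans h3) fun z => ?_
  rw [← (h2 z).tsum_eq]
  have hb : ∀ n, ‖⟪y n, z⟫_ℂ • x n‖ ≤ (‖x n‖ * ‖y n‖) * ‖z‖ := fun n => by
    rw [norm_smul]
    calc ‖⟪y n, z⟫_ℂ‖ * ‖x n‖ ≤ (‖y n‖ * ‖z‖) * ‖x n‖ := by gcongr; exact norm_inner_le_norm _ _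
      _ = _ := by ring
  refine (tsum_of_norm_bounded (h1.mul_right ‖z‖).hasSum hb).trans ?_
  rw [tsum_mul_right]
  gcongr

theorem IsTraceClass.norm_le_traceNorm {T : H →L[ℂ] H} (hT : IsTraceClass T) :
    ‖T‖ ≤ traceNorm T :=
  le_of_forall_pos_le_add fun _ hε => (hT.exists_nuclearBound hε).norm_le

theorem sum_norm_inner_mul_inner_le {ι : Type*} {e : ι → H} (he : Orthonormal ℂ e) (x y : H)
    (s : Finset ι) : ∑ i ∈ s, ‖⟪x, e i⟫_ℂ * ⟪e i, y⟫_ℂ‖ ≤ ‖x‖ * ‖y‖ := by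
  have h1 : ∑ i ∈ s, ‖⟪x, e i⟫_ℂ‖ ^ 2 ≤ ‖x‖ ^ 2 := by
    simpa only [norm_inner_symm] using he.sum_inner_products_le x (s := s)
  have h2 := he.sum_inner_products_le y (s := s)
  calc ∑ i ∈ s, ‖⟪x, e i⟫_ℂ * ⟪e i, y⟫_ℂ‖ = ∑ i ∈ s, ‖⟪x, e i⟫_ℂ‖ * ‖⟪e i, y⟫_ℂ‖ := by simp
    _ ≤ √(∑ i ∈ s, ‖⟪x, e i⟫_ℂ‖ ^ 2) * √(∑ i ∈ s, ‖⟪e i, y⟫_ℂ‖ ^ 2) :=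
        Real.sum_mul_le_sqrt_mul_sqrt _ _ _
    _ ≤ √(‖x‖ ^ 2) * √(‖y‖ ^ 2) := by gcongr
    _ = _ := by simp

/-- The trace of a nuclear operator does not depend on the basis. -/
theorem hasSum_inner_basis_of_nuclear {κ ι : Type*} (e : HilbertBasis ι ℂ H) {T : H →L[ℂ] H}
    {x y : κ → H} (hs : Summable fun k => ‖x k‖ * ‖y k‖)
    (hT : ∀ z, HasSum (fun k => ⟪y k, z⟫_ℂ • x k) (T z)) :
    HasSum (fun i => ⟪e i, T (e i)⟫_ℂ) (∑' k, ⟪y k, x k⟫_ℂ) := by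
  -- By Bessel and Cauchy–Schwarz the double series is absolutely summable, with rows bounded by
  -- ‖x_k‖‖y_k‖. Summing over i first gives ∑ ⟨y_k, x_k⟩, over k first the diagonal elements of T.
  let F : κ × ι → ℂ := fun p => ⟪y p.1, e p.2⟫_ℂ * ⟪e p.2, x p.1⟫_ℂ
  have hFs : Summable F := by
    refine Summable.of_norm ((summable_prod_of_nonneg fun p => norm_nonneg _).2 ⟨fun k => ?_, ?_⟩)
    · exact summable_of_sum_le (fun i => norm_nonneg _)
        fun s => sum_norm_inner_mul_inner_le e.orthonormal (y k) (x k) s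
    · refine Summable.of_nonneg_of_le (fun k => tsum_nonneg fun i => norm_nonneg _)
        (fun k => ?_) hs
      rw [mul_comm]
      exact Real.tsum_le_of_sum_le (fun i => norm_nonneg _)
        fun s => sum_norm_inner_mul_inner_le e.orthonormal (y k) (x k) s
  have h1 : ∑' k, ⟪y k, x k⟫_ℂ = ∑' p, F p := by
    rw [hFs.tsum_prod]
    exact tsum_congr fun k => (e.hasSum_inner_mul_inner _ _).tsum_eq.symm
  rw [h1]
  have h2 := (Equiv.prodComm ι κ).hasSum_iff.2 hFs.hasSum
  refine h2.prod_fiberwise fun i => ?_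
  have h3 := (hT (e i)).mapL (innerSL ℂ (e i))
  simpa [F, inner_smul_right] using h3

theorem summable_inner_of_nuclear {κ : Type*} {x y : κ → H}
    (hs : Summable fun k => ‖x k‖ * ‖y k‖) : Summable fun k => ⟪y k, x k⟫_ℂ :=
  hs.of_norm_bounded fun k => by rw [mul_comm]; exact norm_inner_le_norm _ _

theorem hasSum_norm_sq_inner {ι : Type*} (e : HilbertBasis ι ℂ H) (x : H) :
    HasSum (fun i => ‖⟪e i, x⟫_ℂ‖ ^ 2) (‖x‖ ^ 2) := by
  have h := (e.hasSum_inner_mul_inner x x).mapL Complex.reCLM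
  simp only [Complex.reCLM_apply] at h
  convert h using 1
  · ext i
    rw [← inner_conj_symm x, mul_comm, Complex.mul_conj, Complex.normSq_eq_norm_sq, Complex.ofReal_re]
  · rw [inner_self_eq_norm_sq_to_K]
    norm_cast

variable [CompleteSpace H] [CompleteSpace K]

theorem trace_eq_of_nuclear {κ : Type*} {T : H →L[ℂ] H}
    {x y : κ → H} (hs : Summable fun k => ‖x k‖ * ‖y k‖)
    (hT : ∀ z, HasSum (fun k => ⟪y k, z⟫_ℂ • x k) (T z)) : trace T = ∑' k, ⟪y k, x k⟫_ℂ :=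
  (hasSum_inner_basis_of_nuclear (someBasis H) hs hT).tsum_eq

theorem IsTraceClass.hasSum_trace {ι : Type*} (e : HilbertBasis ι ℂ H) {T : H →L[ℂ] H}
    (hT : IsTraceClass T) : HasSum (fun i => ⟪e i, T (e i)⟫_ℂ) (trace T) := by
  obtain ⟨x, y, h1, h2⟩ := hT
  rw [trace_eq_of_nuclear h1 h2]
  exact hasSum_inner_basis_of_nuclear e h1 h2

theorem trace_rankOne (x y : H) : trace (InnerProductSpace.rankOne ℂ x y) = ⟪y, x⟫_ℂ := by
  have h := trace_eq_of_nuclear (κ := Unit) (T := InnerProductSpace.rankOne ℂ x y)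
    (x := fun _ => x) (y := fun _ => y) (hasSum_fintype _).summable (fun z => by simp)
  simpa using h

theorem trace_add {S T : H →L[ℂ] H} (hS : IsTraceClass S) (hT : IsTraceClass T) :
    trace (S + T) = trace S + trace T := by
  have h := (hS.hasSum_trace (someBasis H)).add (hT.hasSum_trace (someBasis H))
  simpa [trace, inner_add_right] using h.tsum_eq

theorem trace_smul (c : ℂ) (T : H →L[ℂ] H) : trace (c • T) = c * trace T := by
  simp [trace, tsum_mul_left]

/-- An operator series which converges absolutely in trace norm. -/
theorem nuclearBound_series {κ : Type*} {T : κ → H →L[ℂ] H} {c : κ → ℝ} (hc : Summable c)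
    (hT : ∀ k, NuclearBound (T k) (c k)) {S : H →L[ℂ] H}
    (hS : ∀ z, HasSum (fun k => T k z) (S z)) :
    NuclearBound S (∑' k, c k) ∧ HasSum (fun k => trace (T k)) (trace S) := by
  choose x y hxy hle using hT
  have hs : Summable fun p : κ × ℕ => ‖x p.1 p.2‖ * ‖y p.1 p.2‖ := by
    refine (summable_prod_of_nonneg fun p => by positivity).2 ⟨fun k => (hxy k).1, ?_⟩
    exact Summable.of_nonneg_of_le (fun k => tsum_nonneg fun n => by positivity) hle hc
  have hz : ∀ z, HasSum (fun p : κ × ℕ => ⟪y p.1 p.2, z⟫_ℂ • x p.1 p.2) (S z) := by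
    intro z
    have hsum : Summable (fun p : κ × ℕ => ⟪y p.1 p.2, z⟫_ℂ • x p.1 p.2) := by
      refine (hs.mul_right ‖z‖).of_norm_bounded fun p => ?_
      rw [norm_smul]
      calc ‖⟪y p.1 p.2, z⟫_ℂ‖ * ‖x p.1 p.2‖ ≤ (‖y p.1 p.2‖ * ‖z‖) * ‖x p.1 p.2‖ := by
            gcongr; exact norm_inner_le_norm _ _
        _ = _ := by ring
    have h := hsum.hasSum.prod_fiberwise fun k => (hxy k).2 z
    rw [(hS z).unique h]
    exact hsum.hasSum
  constructor
  · refine (nuclearBound_of_hasSum hs hz).mono ?_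
    rw [hs.tsum_prod]
    exact Summable.tsum_le_tsum hle (Summable.of_nonneg_of_le
      (fun k => tsum_nonneg fun n => by positivity) hle hc) hc
  · rw [trace_eq_of_nuclear hs hz]
    refine (summable_inner_of_nuclear hs).hasSum.prod_fiberwise fun k => ?_
    rw [trace_eq_of_nuclear (hxy k).1 (hxy k).2]
    exact (summable_inner_of_nuclear (hxy k).1).hasSum

/-- The Hilbert-Schmidt norms of an operator and of its adjoint agree. -/
theorem hasSum_norm_sq_adjoint {ι κ : Type*} (e : HilbertBasis ι ℂ H) (f : HilbertBasis κ ℂ K)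
    {S : H →L[ℂ] K} {a : ℝ} (hS : HasSum (fun i => ‖S (e i)‖ ^ 2) a) :
    HasSum (fun k => ‖adjoint S (f k)‖ ^ 2) a := by
  let F : ι × κ → ℝ := fun p => ‖⟪f p.2, S (e p.1)⟫_ℂ‖ ^ 2
  have hF : ∀ i, HasSum (fun k => F (i, k)) (‖S (e i)‖ ^ 2) := fun i =>
    hasSum_norm_sq_inner f (S (e i))
  have hFs : Summable F := by
    refine (summable_prod_of_nonneg fun p => by positivity).2 ⟨fun i => (hF i).summable, ?_⟩
    simpa only [fun i => (hF i).tsum_eq] using hS.summable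
  have h := (hFs.hasSum.prod_fiberwise hF).unique hS
  rw [← h]
  have h2 := (Equiv.prodComm κ ι).hasSum_iff.2 hFs.hasSum
  refine h2.prod_fiberwise fun k => ?_
  have := hasSum_norm_sq_inner e (adjoint S (f k))
  convert this using 2 with i
  simp only [Function.comp, Equiv.prodComm_apply, Prod.swap, F, ContinuousLinearMap.adjoint_inner_right]
  rw [norm_inner_symm]

/-- The product of two Hilbert-Schmidt operators is nuclear. -/
theorem nuclearBound_adjoint_comp {ι ι' : Type*} (e : HilbertBasis ι ℂ H) (e' : HilbertBasis ι' ℂ H)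
    {S T : H →L[ℂ] K} {a b : ℝ} (hS : HasSum (fun i => ‖S (e i)‖ ^ 2) a)
    (hT : HasSum (fun i => ‖T (e' i)‖ ^ 2) b) : NuclearBound (adjoint S ∘L T) (√a * √b) := by
  let f := someBasis K
  have h1 := hasSum_norm_sq_adjoint e f hS
  have h2 := hasSum_norm_sq_adjoint e' f hT
  have hle : ∀ s : Finset (someBasisSet K),
      ∑ k ∈ s, ‖adjoint S (f k)‖ * ‖adjoint T (f k)‖ ≤ √a * √b := fun s => by
    refine (Real.sum_mul_le_sqrt_mul_sqrt _ _ _).trans ?_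
    gcongr
    · exact sum_le_hasSum _ (fun _ _ => by positivity) h1
    · exact sum_le_hasSum _ (fun _ _ => by positivity) h2
  refine (nuclearBound_of_hasSum (x := fun k => adjoint S (f k)) (y := fun k => adjoint T (f k))
    (summable_of_sum_le (fun _ => by positivity) hle) fun z => ?_).mono
      (Real.tsum_le_of_sum_le (fun _ => by positivity) hle)
  -- Inserting the basis f between the factors: S*T = ∑ |S*f_k⟩⟨T*f_k|.
  have h := (f.hasSum_repr (T z)).mapL (adjoint S)
  simpa [f.repr_apply_apply, ContinuousLinearMap.adjoint_inner_left] using h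

end Trace

/-! ### Positive operators and states. -/

section States

variable {H K : Type*} [NormedAddCommGroup H] [InnerProductSpace ℂ H]
  [NormedAddCommGroup K] [InnerProductSpace ℂ K]

theorem isPositive_of_inner_nonneg {T : H →L[ℂ] H} (h : ∀ x, 0 ≤ ⟪x, T x⟫_ℂ) : T.IsPositive := by
  rw [ContinuousLinearMap.isPositive_iff_complex]
  intro x
  have h1 := h x
  rw [Complex.le_def] at h1
  have h2 : ⟪T x, x⟫_ℂ = ⟪x, T x⟫_ℂ := by
    rw [← inner_conj_symm, Complex.conj_eq_iff_im]
    exact h1.2.symm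
  rw [h2]
  exact ⟨Complex.ext (by simp) (by simpa using h1.2), by simpa using h1.1⟩

theorem IsNuclearRep.comp_left {T : H →L[ℂ] H} {x y : ℕ → H} (h : IsNuclearRep T x y)
    (N : H →L[ℂ] H) : IsNuclearRep (N ∘L T) (fun n => N (x n)) y := by
  refine ⟨Summable.of_nonneg_of_le (fun n => by positivity) (fun n => ?_) (h.1.mul_left ‖N‖),
    fun z => by simpa using (h.2 z).mapL N⟩
  rw [← mul_assoc]
  gcongr
  exact N.le_opNorm _

theorem isPositive_rankOne_self (x : H) : (InnerProductSpace.rankOne ℂ x x).IsPositive :=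
  isPositive_of_inner_nonneg fun z => by
    rw [InnerProductSpace.rankOne_apply, inner_smul_right, ← inner_conj_symm, mul_comm,
      Complex.mul_conj]
    exact_mod_cast Complex.normSq_nonneg _

variable [CompleteSpace H] [CompleteSpace K]

theorem exists_eq_adjoint_comp {T : H →L[ℂ] H} (hT : T.IsPositive) :
    ∃ A : H →L[ℂ] H, T = adjoint A ∘L A := by
  rw [← ContinuousLinearMap.nonneg_iff_isPositive] at hT
  obtain ⟨A, hA⟩ := CStarAlgebra.nonneg_iff_eq_star_mul_self.1 hT
  exact ⟨A, hA⟩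

theorem inner_adjoint_comp_self (A : H →L[ℂ] K) (x : H) :
    ⟪x, (adjoint A ∘L A) x⟫_ℂ = ((‖A x‖ ^ 2 : ℝ) : ℂ) := by
  rw [ContinuousLinearMap.comp_apply, ContinuousLinearMap.adjoint_inner_right,
    inner_self_eq_norm_sq_to_K]
  norm_cast

theorem isPositive_adjoint_comp (A : H →L[ℂ] K) : (adjoint A ∘L A).IsPositive :=
  isPositive_of_inner_nonneg fun x => by
    rw [inner_adjoint_comp_self]
    exact Complex.zero_le_real.2 (sq_nonneg _)

/-- Cauchy-Schwarz for a positive operator, in the arithmetic mean form. -/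
theorem norm_inner_le_of_isPositive {T : H →L[ℂ] H} (hT : T.IsPositive) (x y : H) :
    ‖⟪x, T y⟫_ℂ‖ ≤ ((⟪x, T x⟫_ℂ).re + (⟪y, T y⟫_ℂ).re) / 2 := by
  obtain ⟨A, rfl⟩ := exists_eq_adjoint_comp hT
  rw [inner_adjoint_comp_self, inner_adjoint_comp_self, ContinuousLinearMap.comp_apply,
    ContinuousLinearMap.adjoint_inner_right, Complex.ofReal_re, Complex.ofReal_re]
  have := norm_inner_le_norm (𝕜 := ℂ) (A x) (A y)
  nlinarith [sq_nonneg (‖A x‖ - ‖A y‖)]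

theorem norm_le_one_of_isPositive {T : H →L[ℂ] H} (hT : T.IsPositive) (h1 : (1 - T).IsPositive) :
    ‖T‖ ≤ 1 := by
  rw [CStarAlgebra.norm_le_one_iff_of_nonneg T
    ((ContinuousLinearMap.nonneg_iff_isPositive T).2 hT)]
  exact (ContinuousLinearMap.le_def _ _).2 h1

theorem IsTraceClass.comp_left {T : H →L[ℂ] H} (hT : IsTraceClass T) (N : H →L[ℂ] H) :
    IsTraceClass (N ∘L T) := by
  simpa using hT.conj N (ContinuousLinearMap.id ℂ H)

theorem IsNuclearRep.hasSum_trace_comp {T : H →L[ℂ] H} {x y : ℕ → H} (h : IsNuclearRep T x y)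
    (N : H →L[ℂ] H) : HasSum (fun n => ⟪y n, N (x n)⟫_ℂ) (trace (N ∘L T)) := by
  have h' := h.comp_left N
  rw [trace_eq_of_nuclear h'.1 h'.2]
  exact (summable_inner_of_nuclear h'.1).hasSum

theorem IsNuclearRep.hasSum_trace {T : H →L[ℂ] H} {x y : ℕ → H} (h : IsNuclearRep T x y) :
    HasSum (fun n => ⟪y n, x n⟫_ℂ) (trace T) :=
  h.hasSum_trace_comp (ContinuousLinearMap.id ℂ H)

theorem trace_nonneg {T : H →L[ℂ] H} (hT : IsTraceClass T) (hp : T.IsPositive) : 0 ≤ trace T :=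
  (hT.hasSum_trace (someBasis H)).nonneg fun _ => hp.inner_nonneg_right _

/-- Cyclicity of the trace: with N = A*A and T = ∑ |x_n⟩⟨y_n|, both Tr(A*A T) and Tr(A T A*) equal ∑
⟨A y_n, A x_n⟩, and A T A* is positive. -/
theorem trace_comp_nonneg {N T : H →L[ℂ] H} (hT : IsTraceClass T) (hp : T.IsPositive)
    (hN : N.IsPositive) : 0 ≤ trace (N ∘L T) := by
  obtain ⟨A, rfl⟩ := exists_eq_adjoint_comp hN
  have hA : IsTraceClass (A ∘L T ∘L adjoint A) := hT.conj A (adjoint A)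
  have hAp : (A ∘L T ∘L adjoint A).IsPositive := isPositive_of_inner_nonneg fun x => by
    have := hp.inner_nonneg_right (adjoint A x)
    rwa [ContinuousLinearMap.adjoint_inner_left] at this
  obtain ⟨x, y, h⟩ := hT
  suffices trace ((adjoint A ∘L A) ∘L T) = trace (A ∘L T ∘L adjoint A) by
    rw [this]; exact trace_nonneg hA hAp
  have h1 := (h.hasSum_trace_comp (adjoint A ∘L A)).tsum_eq
  have hs : Summable fun n => ‖A (x n)‖ * ‖A (y n)‖ := by
    refine Summable.of_nonneg_of_le (fun n => by positivity) (fun n => ?_)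
      (h.1.mul_left (‖A‖ * ‖A‖))
    calc ‖A (x n)‖ * ‖A (y n)‖ ≤ (‖A‖ * ‖x n‖) * (‖A‖ * ‖y n‖) := by
          gcongr <;> exact A.le_opNorm _
      _ = _ := by ring
  rw [← h1, trace_eq_of_nuclear (x := fun n => A (x n)) (y := fun n => A (y n)) hs]
  · simp [ContinuousLinearMap.adjoint_inner_right]
  · intro z
    have := (h.2 (adjoint A z)).mapL A
    simpa [ContinuousLinearMap.adjoint_inner_right] using this

theorem isState_ketbra {x : H} (hx : ‖x‖ = 1) : IsState (ketbra x x : H →L[ℂ] H) where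
  isTraceClass := (ketbra x x).2
  isPositive := isPositive_rankOne_self x
  trace_eq_one := by
    rw [ketbra, trace_rankOne, inner_self_eq_norm_sq_to_K, hx]; norm_num

/-- The family extends to an orthonormal basis, in which the trace is a sum of nonnegative diagonal
entries. -/
theorem IsTraceClass.sum_inner_le {ι : Type*} {T : H →L[ℂ] H} (hT : IsTraceClass T)
    (hp : T.IsPositive) {g : ι → H} (hg : Orthonormal ℂ g) (s : Finset ι) :
    ∑ i ∈ s, (⟪g i, T (g i)⟫_ℂ).re ≤ (trace T).re := by
  classical
  obtain ⟨w, e, hgw, he⟩ := hg.toSubtypeRange.exists_hilbertBasis_extension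
  have h := (hT.hasSum_trace e).mapL Complex.reCLM
  have hinj : Function.Injective g := hg.linearIndependent.injective
  have hmem : ∀ i, g i ∈ w := fun i => hgw (Set.mem_range_self i)
  let j : ι ↪ w := ⟨fun i => ⟨g i, hmem i⟩, fun a b hab => hinj (congrArg Subtype.val hab)⟩
  have := sum_le_hasSum (s.map j) (fun i _ => by
    have := hp.inner_nonneg_right (e i)
    simpa using (Complex.le_def.1 this).1) h
  rw [Finset.sum_map] at this
  have hj : ∀ i, e (j i) = g i := fun i => by rw [he]; rfl
  simpa [hj] using this

namespace IsState

variable {ρ : H →L[ℂ] H}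

theorem sum_inner_le_one (hρ : IsState ρ) {ι : Type*} {g : ι → H} (hg : Orthonormal ℂ g)
    (s : Finset ι) : ∑ i ∈ s, (⟪g i, ρ (g i)⟫_ℂ).re ≤ 1 := by
  simpa [hρ.trace_eq_one] using hρ.isTraceClass.sum_inner_le hρ.isPositive hg s

theorem hasSum_inner (hρ : IsState ρ) {ι : Type*} (e : HilbertBasis ι ℂ H) :
    HasSum (fun i => ⟪e i, ρ (e i)⟫_ℂ) 1 := by
  simpa [hρ.trace_eq_one] using hρ.isTraceClass.hasSum_trace e

theorem isPositive_one_sub (hρ : IsState ρ) : (1 - ρ).IsPositive := by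
  refine isPositive_of_inner_nonneg fun x => ?_
  by_cases hx : x = 0
  · simp [hx]
  have hu : ‖((‖x‖⁻¹ : ℝ) : ℂ) • x‖ = 1 := by
    simp [norm_smul, norm_ne_zero_iff.2 hx]
  have hon : Orthonormal ℂ (fun _ : Unit => ((‖x‖⁻¹ : ℝ) : ℂ) • x) :=
    ⟨fun _ => hu, fun i j hij => (hij (Subsingleton.elim _ _)).elim⟩
  have h := hρ.sum_inner_le_one hon Finset.univ
  have h0 := hρ.isPositive.inner_nonneg_right x
  obtain ⟨r, hr, hr'⟩ : ∃ r : ℝ, 0 ≤ r ∧ ⟪x, ρ x⟫_ℂ = r :=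
    ⟨(⟪x, ρ x⟫_ℂ).re, (Complex.le_def.1 h0).1, Complex.ext rfl (by simpa using (Complex.le_def.1 h0).2.symm)⟩
  simp only [Finset.univ_unique, map_smul, inner_smul_left, inner_smul_right, hr',
    Finset.sum_singleton, Complex.conj_ofReal] at h
  norm_cast at h
  have hxp : 0 < ‖x‖ := norm_pos_iff.2 hx
  have h' : r ≤ ‖x‖ ^ 2 := by
    have : ‖x‖⁻¹ * (‖x‖⁻¹ * r) * ‖x‖ ^ 2 ≤ 1 * ‖x‖ ^ 2 := by gcongr
    field_simp at this
    simpa using this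
  rw [sub_apply, inner_sub_right, hr', one_apply_eq_self,
    inner_self_eq_norm_sq_to_K]
  have : (0 : ℂ) ≤ ((‖x‖ ^ 2 - r : ℝ) : ℂ) := by exact_mod_cast sub_nonneg.2 h'
  simpa using this

theorem norm_le_one (hρ : IsState ρ) : ‖ρ‖ ≤ 1 :=
  norm_le_one_of_isPositive hρ.isPositive hρ.isPositive_one_sub

end IsState

theorem hasSum_norm_sq_of_trace {A : H →L[ℂ] K} {ι : Type*} (e : HilbertBasis ι ℂ H)
    {r : ℝ} (h : HasSum (fun i => ⟪e i, (adjoint A ∘L A) (e i)⟫_ℂ) (r : ℂ)) :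
    HasSum (fun i => ‖A (e i)‖ ^ 2) r := by
  have := h.mapL Complex.reCLM
  simpa only [inner_adjoint_comp_self, Complex.reCLM_apply, Complex.ofReal_re] using this

end States

/-! ### Operators on the Hilbert space tensor product. -/

section Tensor

variable {E F G : Type*} [NormedAddCommGroup E] [InnerProductSpace ℂ E]
  [NormedAddCommGroup F] [InnerProductSpace ℂ F] [NormedAddCommGroup G] [InnerProductSpace ℂ G]

theorem inner_pv (x x' : E) (y y' : F) :
    ⟪pv x y, pv x' y'⟫_ℂ = ⟪x, x'⟫_ℂ * ⟪y, y'⟫_ℂ := by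
  rw [pv, pv, UniformSpace.Completion.inner_coe, TensorProduct.inner_tmul]

theorem norm_pv (x : E) (y : F) : ‖pv x y‖ = ‖x‖ * ‖y‖ := by
  rw [pv, UniformSpace.Completion.norm_coe, TensorProduct.norm_tmul]

theorem pv_add_right (x : E) (y y' : F) : pv x (y + y') = pv x y + pv x y' := by
  simp only [pv, TensorProduct.tmul_add, UniformSpace.Completion.coe_add]

theorem pv_smul_right (c : ℂ) (x : E) (y : F) : pv x (c • y) = c • pv x y := by
  simp only [pv, TensorProduct.tmul_smul, UniformSpace.Completion.coe_smul]

theorem coe_sum {ι : Type*} (s : Finset ι) (f : ι → E ⊗[ℂ] F) :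
    ((∑ i ∈ s, f i : E ⊗[ℂ] F) : HTensor E F) = ∑ i ∈ s, (f i : HTensor E F) :=
  map_sum (UniformSpace.Completion.toComplL (𝕜 := ℂ) (E := E ⊗[ℂ] F)) f s

theorem clm_ext_pv {G : Type*} [NormedAddCommGroup G] [NormedSpace ℂ G]
    {S T : HTensor E F →L[ℂ] G} (h : ∀ x y, S (pv x y) = T (pv x y)) : S = T := by
  ext u
  induction u using UniformSpace.Completion.induction_on with
  | hp => exact isClosed_eq S.continuous T.continuous
  | ih u =>
    induction u with
    | zero => rw [UniformSpace.Completion.coe_zero, map_zero, map_zero]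
    | tmul x y => exact h x y
    | add a b ha hb => rw [UniformSpace.Completion.coe_add, map_add, map_add, ha, hb]

theorem ext_inner_pv {u v : HTensor E F} (h : ∀ x y, ⟪pv x y, u⟫_ℂ = ⟪pv x y, v⟫_ℂ) : u = v := by
  have : innerSL ℂ u = innerSL ℂ v := clm_ext_pv fun x y => by
    rw [innerSL_apply_apply, innerSL_apply_apply, ← inner_conj_symm, h, inner_conj_symm]
  exact ext_inner_right ℂ fun w => DFunLike.congr_fun this w

theorem op_ext_pv {S T : HTensor E F →L[ℂ] HTensor E F}
    (h : ∀ x y x' y', ⟪pv x y, S (pv x' y')⟫_ℂ = ⟪pv x y, T (pv x' y')⟫_ℂ) : S = T :=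
  clm_ext_pv fun x' y' => ext_inner_pv fun x y => h x y x' y'

theorem tensorOp_comp (S S' : E →L[ℂ] E) (T T' : F →L[ℂ] F) :
    tensorOp S T ∘L tensorOp S' T' = tensorOp (S ∘L S') (T ∘L T') :=
  clm_ext_pv fun x y => by simp [tensorOp_pv]

theorem tensorOp_one : tensorOp (1 : E →L[ℂ] E) (1 : F →L[ℂ] F) = 1 :=
  clm_ext_pv fun x y => by simp [tensorOp_pv]

theorem tensorOp_sub_left (S S' : E →L[ℂ] E) (T : F →L[ℂ] F) :
    tensorOp (S - S') T = tensorOp S T - tensorOp S' T :=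
  clm_ext_pv fun x y => by
    rw [sub_apply, tensorOp_pv, tensorOp_pv, tensorOp_pv, pv, sub_apply, TensorProduct.sub_tmul,
      UniformSpace.Completion.coe_sub]
    rfl

theorem tensorOp_sum_right {ι : Type*} (s : Finset ι) (S : E →L[ℂ] E) (T : ι → F →L[ℂ] F) :
    tensorOp S (∑ i ∈ s, T i) = ∑ i ∈ s, tensorOp S (T i) :=
  clm_ext_pv fun x y => by
    simp only [tensorOp_pv, sum_apply]
    simp only [pv, TensorProduct.tmul_sum, coe_sum]

theorem tensorOp_smul_right (c : ℂ) (S : E →L[ℂ] E) (T : F →L[ℂ] F) :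
    tensorOp S (c • T) = c • tensorOp S T :=
  clm_ext_pv fun x y => by simp [tensorOp_pv, pv_smul_right]

theorem inner_tensorOp_pv (S : E →L[ℂ] E) (T : F →L[ℂ] F) (x x' : E) (y y' : F) :
    ⟪pv x y, tensorOp S T (pv x' y')⟫_ℂ = ⟪x, S x'⟫_ℂ * ⟪y, T y'⟫_ℂ := by
  rw [tensorOp_pv, inner_pv]

/-- The bounded operator `y ↦ x ⊗ y` from `F` to `E ⊗ F`. -/
noncomputable def tensorLeft (x : E) : F →L[ℂ] HTensor E F :=
  UniformSpace.Completion.toComplL ∘L TensorProduct.mkL ℂ E F x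

theorem tensorLeft_apply (x : E) (y : F) : tensorLeft x y = pv x y := rfl

theorem norm_tensorRight_le (y : F) : ‖(tensorRight y : E →L[ℂ] HTensor E F)‖ ≤ ‖y‖ :=
  ContinuousLinearMap.opNorm_le_bound _ (norm_nonneg _) fun x => by
    rw [tensorRight_apply, norm_pv, mul_comm]

theorem tensorRight_add (y y' : F) :
    (tensorRight (y + y') : E →L[ℂ] HTensor E F) = tensorRight y + tensorRight y' := by
  ext x; simp [tensorRight_apply, pv_add_right]

theorem tensorRight_smul (c : ℂ) (y : F) :
    (tensorRight (c • y) : E →L[ℂ] HTensor E F) = c • tensorRight y := by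
  ext x; simp [tensorRight_apply, pv_smul_right]

/-- The product of two orthonormal bases. -/
theorem exists_prodBasis {ι κ : Type*} (e : HilbertBasis ι ℂ E) (f : HilbertBasis κ ℂ F) :
    ∃ g : HilbertBasis (ι × κ) ℂ (HTensor E F), ∀ p, g p = pv (e p.1) (f p.2) := by
  have hon : Orthonormal ℂ (fun p : ι × κ => pv (e p.1) (f p.2)) := by
    refine ⟨fun p => by rw [norm_pv, e.orthonormal.1, f.orthonormal.1, one_mul], ?_⟩
    rintro ⟨i, k⟩ ⟨i', k'⟩ hne
    rw [inner_pv]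
    by_cases h : i = i'
    · subst h
      rw [f.orthonormal.2 (fun h => hne (by simp_all)), mul_zero]
    · rw [e.orthonormal.2 h, zero_mul]
  have hsp : (Submodule.span ℂ (Set.range fun p : ι × κ => pv (e p.1) (f p.2)))ᗮ = ⊥ := by
    refine (Submodule.eq_bot_iff _).2 fun u hu => ext_inner_pv fun x y => ?_
    have h0 : ∀ i k, ⟪u, pv (e i) (f k)⟫_ℂ = 0 := fun i k =>
      (Submodule.mem_orthogonal' _ _).1 hu _ (Submodule.subset_span ⟨(i, k), rfl⟩)
    have h1 : ∀ i y, ⟪u, pv (e i) y⟫_ℂ = 0 := fun i y => by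
      have := (f.hasSum_repr y).mapL (innerSL ℂ u ∘L tensorLeft (e i))
      refine this.unique ?_
      simp [tensorLeft_apply, h0, hasSum_zero]
    have h2 : ⟪u, pv x y⟫_ℂ = 0 := by
      have := (e.hasSum_repr x).mapL (innerSL ℂ u ∘L tensorRight y)
      refine this.unique ?_
      simp [tensorRight_apply, h1, hasSum_zero]
    rw [← inner_conj_symm, h2]
    simp
  exact ⟨HilbertBasis.mkOfOrthogonalEqBot hon hsp, fun p => by simp⟩

variable [CompleteSpace E] [CompleteSpace F]

theorem adjoint_tensorOp (S : E →L[ℂ] E) (T : F →L[ℂ] F) :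
    adjoint (tensorOp S T) = tensorOp (adjoint S) (adjoint T) :=
  op_ext_pv fun x y x' y' => by
    rw [ContinuousLinearMap.adjoint_inner_right, tensorOp_pv, tensorOp_pv, inner_pv, inner_pv,
      ContinuousLinearMap.adjoint_inner_right, ContinuousLinearMap.adjoint_inner_right]

theorem isPositive_tensorOp {S : E →L[ℂ] E} {T : F →L[ℂ] F} (hS : S.IsPositive)
    (hT : T.IsPositive) : (tensorOp S T).IsPositive := by
  obtain ⟨A, rfl⟩ := exists_eq_adjoint_comp hS
  obtain ⟨B, rfl⟩ := exists_eq_adjoint_comp hT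
  rw [← tensorOp_comp, ← adjoint_tensorOp]
  exact isPositive_adjoint_comp _

theorem isPositive_finiteSeparable {Ω : HTensor E F →L[ℂ] HTensor E F}
    (h : Ω ∈ finiteSeparable E F) : Ω.IsPositive := by
  obtain ⟨n, ρ, M, hρ, hM, -, rfl⟩ := h
  exact ContinuousLinearMap.isPositive_sum _ fun α _ =>
    isPositive_tensorOp (hρ α).isPositive (hM α)

/-- Since ∑ M_α = I, the difference I − ∑ ρ_α ⊗ M_α equals ∑ (I − ρ_α) ⊗ M_α, a sum of positive
operators. This uniform bound is what allows all later passages to the limit. -/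
theorem norm_finiteSeparable_le {Ω : HTensor E F →L[ℂ] HTensor E F}
    (h : Ω ∈ finiteSeparable E F) : ‖Ω‖ ≤ 1 := by
  refine norm_le_one_of_isPositive (isPositive_finiteSeparable h) ?_
  obtain ⟨n, ρ, M, hρ, hM, hsum, rfl⟩ := h
  have : 1 - ∑ α, tensorOp (ρ α) (M α) = ∑ α, tensorOp (1 - ρ α) (M α) := by
    simp only [tensorOp_sub_left, Finset.sum_sub_distrib, ← tensorOp_sum_right, hsum, tensorOp_one]
  rw [this]
  exact ContinuousLinearMap.isPositive_sum _ fun α _ =>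
    isPositive_tensorOp (hρ α).isPositive_one_sub (hM α)

end Tensor

/-! ### Complex conjugation of vectors and operators. -/

section Conj

variable {H : Type*} [NormedAddCommGroup H] [InnerProductSpace ℂ H] {ι : Type*}
  (b : HilbertBasis ι ℂ H)

theorem inner_basis_conjVec (i : ι) (x : H) :
    ⟪b i, conjVec b x⟫_ℂ = (starRingEnd ℂ) ⟪b i, x⟫_ℂ := by
  rw [← b.repr_apply_apply, ← b.repr_apply_apply]
  change b.repr (b.repr.symm (star (b.repr x))) i = _
  rw [LinearIsometryEquiv.apply_symm_apply, lp.star_apply]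
  rfl

theorem inner_conjVec_conjVec (x y : H) : ⟪conjVec b x, conjVec b y⟫_ℂ = ⟪y, x⟫_ℂ := by
  refine (b.hasSum_inner_mul_inner (conjVec b x) (conjVec b y)).unique ?_
  convert b.hasSum_inner_mul_inner y x using 2 with i
  rw [inner_basis_conjVec, ← inner_conj_symm, inner_basis_conjVec, Complex.conj_conj,
    inner_conj_symm, mul_comm]

theorem conjVec_conjVec (x : H) : conjVec b (conjVec b x) = x := by
  apply b.repr.injective
  ext i
  rw [b.repr_apply_apply, b.repr_apply_apply, inner_basis_conjVec, inner_basis_conjVec,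
    Complex.conj_conj]

theorem conjVec_basis (i : ι) : conjVec b (b i) = b i := by
  apply b.repr.injective
  ext j
  rw [b.repr_apply_apply, b.repr_apply_apply, inner_basis_conjVec]
  classical
  rw [(orthonormal_iff_ite.1 b.orthonormal) j i]
  split_ifs <;> simp

theorem norm_conjVec (x : H) : ‖conjVec b x‖ = ‖x‖ := by
  have h := inner_conjVec_conjVec b x x
  rw [inner_self_eq_norm_sq_to_K, inner_self_eq_norm_sq_to_K] at h
  have h' : ‖conjVec b x‖ ^ 2 = ‖x‖ ^ 2 := by exact_mod_cast h
  exact (sq_eq_sq₀ (norm_nonneg _) (norm_nonneg _)).1 h'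

theorem inner_conjVec_left (x y : H) : ⟪conjVec b x, y⟫_ℂ = ⟪conjVec b y, x⟫_ℂ := by
  conv_lhs => rw [← conjVec_conjVec b y]
  exact inner_conjVec_conjVec b _ _

theorem inner_conjVec_right (x y : H) : ⟪x, conjVec b y⟫_ℂ = ⟪y, conjVec b x⟫_ℂ := by
  conv_lhs => rw [← conjVec_conjVec b x]
  exact inner_conjVec_conjVec b _ _

theorem conjOp_apply (M : H →L[ℂ] H) (x : H) :
    conjOp b M x = conjVec b (M (conjVec b x)) := rfl

theorem inner_conjOp (M : H →L[ℂ] H) (x y : H) :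
    ⟪x, conjOp b M y⟫_ℂ = ⟪M (conjVec b y), conjVec b x⟫_ℂ := by
  rw [conjOp_apply, inner_conjVec_right]

theorem conjOp_one : conjOp b 1 = 1 := by
  ext x; simp [conjOp_apply, conjVec_conjVec]

theorem conjOp_sum {κ : Type*} (s : Finset κ) (M : κ → H →L[ℂ] H) :
    conjOp b (∑ k ∈ s, M k) = ∑ k ∈ s, conjOp b (M k) := by
  ext x; simp [conjOp_apply]

theorem isPositive_conjOp {M : H →L[ℂ] H} (hM : M.IsPositive) : (conjOp b M).IsPositive :=
  isPositive_of_inner_nonneg fun x => by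
    rw [inner_conjOp]
    exact hM.inner_nonneg_left _

end Conj

/-! ### Sesquilinear forms and weak operator limits. -/

section Forms

/-- The polarization identity for a sesquilinear form. -/
theorem sesq_polarization {H : Type*} [AddCommGroup H] [Module ℂ H]
    (B : H →ₗ⋆[ℂ] H →ₗ[ℂ] ℂ) (x y : H) :
    B x y = (B (x + y) (x + y) - B (x - y) (x - y) - Complex.I * B (x + Complex.I • y)
      (x + Complex.I • y) + Complex.I * B (x - Complex.I • y) (x - Complex.I • y)) / 4 := by
  have hI := Complex.I_mul_I
  simp only [map_add, map_sub, LinearMap.add_apply, LinearMap.sub_apply, map_smul,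
    LinearMap.map_smulₛₗ, LinearMap.smul_apply, smul_eq_mul, Complex.conj_I]
  linear_combination ((B x) y - (B y) x) / 2 * hI

/-- Scaling and polarization. It is needed because channels and integral representations are
controlled only on states, hence only on |z⟩⟨z| with z a unit vector. -/
theorem sesq_tendsto_of_unit {H : Type*} [NormedAddCommGroup H] [NormedSpace ℂ H] {κ : Type*}
    {l : Filter κ} {B : κ → H →ₗ⋆[ℂ] H →ₗ[ℂ] ℂ} {B' : H →ₗ⋆[ℂ] H →ₗ[ℂ] ℂ}
    (h : ∀ z, ‖z‖ = 1 → Tendsto (fun k => B k z z) l (𝓝 (B' z z))) (x y : H) :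
    Tendsto (fun k => B k x y) l (𝓝 (B' x y)) := by
  have h' : ∀ z, Tendsto (fun k => B k z z) l (𝓝 (B' z z)) := fun z => by
    by_cases hz : z = 0
    · simp [hz, tendsto_const_nhds]
    have hu : ‖((‖z‖⁻¹ : ℝ) : ℂ) • z‖ = 1 := by simp [norm_smul, norm_ne_zero_iff.2 hz]
    have hzu : z = (‖z‖ : ℂ) • ((‖z‖⁻¹ : ℝ) : ℂ) • z := by
      rw [smul_smul, ← Complex.ofReal_mul, mul_inv_cancel₀ (norm_ne_zero_iff.2 hz)]; simp
    have := ((h _ hu).const_mul ((starRingEnd ℂ) (‖z‖ : ℂ))).const_mul (‖z‖ : ℂ)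
    generalize ((‖z‖⁻¹ : ℝ) : ℂ) • z = w at *
    rw [hzu]
    simpa only [map_smul, LinearMap.map_smulₛₗ, LinearMap.smul_apply, smul_eq_mul] using this
  rw [sesq_polarization B' x y]
  simp_rw [fun k => sesq_polarization (B k) x y]
  exact ((((h' _).sub (h' _)).sub ((h' _).const_mul _)).add ((h' _).const_mul _)).div_const _

theorem sesq_eq_of_unit {H : Type*} [NormedAddCommGroup H] [NormedSpace ℂ H]
    {B B' : H →ₗ⋆[ℂ] H →ₗ[ℂ] ℂ} (h : ∀ z, ‖z‖ = 1 → B z z = B' z z) (x y : H) :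
    B x y = B' x y :=
  tendsto_nhds_unique tendsto_const_nhds (sesq_tendsto_of_unit (l := (atTop : Filter ℕ))
    (B := fun _ => B) (B' := B') (fun z hz => by rw [h z hz]; exact tendsto_const_nhds) x y)

variable {V : Type*} [NormedAddCommGroup V] [InnerProductSpace ℂ V]

/-- A bounded sesquilinear form on a pre-Hilbert space is given by a bounded operator on the
completion. -/
theorem exists_op_of_bounded_form (q : V →ₗ⋆[ℂ] V →ₗ[ℂ] ℂ) {C : ℝ}
    (hq : ∀ x y, ‖q x y‖ ≤ C * ‖x‖ * ‖y‖) :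
    ∃ Ω : UniformSpace.Completion V →L[ℂ] UniformSpace.Completion V, ∀ x y : V,
      q x y = ⟪(x : UniformSpace.Completion V), Ω (y : UniformSpace.Completion V)⟫_ℂ := by
  let j : V →L[ℂ] UniformSpace.Completion V := UniformSpace.Completion.toComplL
  have hd : DenseRange j := UniformSpace.Completion.denseRange_coe
  have hj : IsUniformInducing j := UniformSpace.Completion.isUniformInducing_coe _
  let q₀ : V →L⋆[ℂ] V →L[ℂ] ℂ := q.mkContinuous₂ C hq
  -- The form is extended by density one variable at a time, with a flip in between. The operator
  -- attached to a bilinear form stands in the first argument, so its adjoint is the one wanted.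
  let q₁ : UniformSpace.Completion V →L⋆[ℂ] V →L[ℂ] ℂ := q₀.extend j
  let q₂ : UniformSpace.Completion V →L[ℂ] UniformSpace.Completion V →L⋆[ℂ] ℂ := q₁.flip.extend j
  let B : UniformSpace.Completion V →L⋆[ℂ] UniformSpace.Completion V →L[ℂ] ℂ := q₂.flip
  refine ⟨adjoint (InnerProductSpace.continuousLinearMapOfBilin B), fun x y => ?_⟩
  rw [ContinuousLinearMap.adjoint_inner_right,
    InnerProductSpace.continuousLinearMapOfBilin_apply]
  have h1 : q₁ (j x) = q₀ x := ContinuousLinearMap.extend_eq q₀ hd hj x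
  have h2 : q₂ (j y) = q₁.flip y := ContinuousLinearMap.extend_eq q₁.flip hd hj y
  change q x y = q₂ (j y) (j x)
  rw [h2, ContinuousLinearMap.flip_apply, h1]
  rfl

/-- A uniform Lipschitz constant gives equicontinuity, and for an equicontinuous family the points
of convergence to a continuous limit form a closed set. -/
theorem tendsto_clm_of_dense {W : Type*} [NormedAddCommGroup W] [NormedSpace ℂ W] {κ : Type*}
    {l : Filter κ} {f : κ → W → ℂ} {f' : W → ℂ} {C : NNReal} (hf : ∀ k, LipschitzWith C (f k))
    (hf' : Continuous f') {s : Set W} (hs : Dense s)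
    (h : ∀ x ∈ s, Tendsto (fun k => f k x) l (𝓝 (f' x))) (x : W) :
    Tendsto (fun k => f k x) l (𝓝 (f' x)) := by
  have he : Equicontinuous f :=
    (LipschitzWith.uniformEquicontinuous f C hf).equicontinuous
  have hc := he.isClosed_setOfPred_tendsto (l := l) hf'
  exact (hc.closure_subset_iff.2 h) (hs x)

/-- For uniformly bounded operators it suffices to test weak convergence on a dense subspace. -/
theorem tendsto_wot_of_dense {κ : Type*} {l : Filter κ}
    {S : κ → UniformSpace.Completion V →L[ℂ] UniformSpace.Completion V}
    {Ω : UniformSpace.Completion V →L[ℂ] UniformSpace.Completion V} (hS : ∀ k, ‖S k‖ ≤ 1)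
    (h : ∀ x y : V, Tendsto (fun k => ⟪(x : UniformSpace.Completion V), S k y⟫_ℂ) l
      (𝓝 ⟪(x : UniformSpace.Completion V), Ω y⟫_ℂ)) :
    Tendsto (fun k => ContinuousLinearMapWOT.ofCLM (S k)) l
      (𝓝 (ContinuousLinearMapWOT.ofCLM Ω)) := by
  rw [ContinuousLinearMapWOT.tendsto_iff_forall_inner_apply_tendsto]
  intro v u
  change Tendsto (fun k => ⟪u, S k v⟫_ℂ) l (𝓝 ⟪u, Ω v⟫_ℂ)
  have hd : Dense (Set.range ((↑) : V → UniformSpace.Completion V)) :=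
    UniformSpace.Completion.denseRange_coe
  refine tendsto_clm_of_dense (f := fun k u => ⟪u, S k v⟫_ℂ) (f' := fun u => ⟪u, Ω v⟫_ℂ)
    (C := ‖v‖₊) (fun k => ?_) (by fun_prop) hd ?_ u
  · refine LipschitzWith.of_dist_le_mul fun a b => ?_
    rw [dist_eq_norm, dist_eq_norm, ← inner_sub_left, mul_comm, coe_nnnorm]
    refine (norm_inner_le_norm _ _).trans ?_
    gcongr
    simpa using (S k).le_of_opNorm_le (hS k) v
  rintro _ ⟨x, rfl⟩
  refine tendsto_clm_of_dense (f := fun k v => ⟪(x : UniformSpace.Completion V), S k v⟫_ℂ)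
    (f' := fun v => ⟪(x : UniformSpace.Completion V), Ω v⟫_ℂ)
    (C := ‖x‖₊) (fun k => ?_) (by fun_prop) hd ?_ v
  · refine LipschitzWith.of_dist_le_mul fun a b => ?_
    rw [dist_eq_norm, dist_eq_norm, ← inner_sub_right, ← map_sub, coe_nnnorm]
    refine (norm_inner_le_norm _ _).trans ?_
    rw [UniformSpace.Completion.norm_coe]
    gcongr
    simpa using (S k).le_of_opNorm_le (hS k) (a - b)
  rintro _ ⟨y, rfl⟩
  exact h x y

theorem isPositive_of_tendsto_wot {W : Type*} [NormedAddCommGroup W] [InnerProductSpace ℂ W]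
    [CompleteSpace W] {κ : Type*} {l : Filter κ} [l.NeBot] {S : κ → W →L[ℂ] W} {Ω : W →L[ℂ] W}
    (hS : ∀ k, (S k).IsPositive)
    (h : Tendsto (fun k => ContinuousLinearMapWOT.ofCLM (S k)) l
      (𝓝 (ContinuousLinearMapWOT.ofCLM Ω))) : Ω.IsPositive := by
  rw [ContinuousLinearMapWOT.tendsto_iff_forall_inner_apply_tendsto] at h
  exact isPositive_of_inner_nonneg fun x =>
    ge_of_tendsto' (h x x) fun k => (hS k).inner_nonneg_right x

end Forms

/-! ### Limits of finite separable operators; the partial trace of a CJ operator. -/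

section Channels

variable {HB HA : Type*}
  [NormedAddCommGroup HB] [InnerProductSpace ℂ HB] [CompleteSpace HB]
  [NormedAddCommGroup HA] [InnerProductSpace ℂ HA] [CompleteSpace HA] {ι : Type*}

/-- A form which is a pointwise limit of finite separable operators is given by a positive
operator in their closure. -/
theorem exists_op_of_tendsto_finiteSeparable {q : (HB ⊗[ℂ] HA) →ₗ⋆[ℂ] (HB ⊗[ℂ] HA) →ₗ[ℂ] ℂ}
    {κ : Type*} {l : Filter κ} [l.NeBot] {S : κ → HTensor HB HA →L[ℂ] HTensor HB HA}
    (hS : ∀ k, S k ∈ finiteSeparable HB HA)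
    (h : ∀ x y : HB ⊗[ℂ] HA, Tendsto (fun k => ⟪(x : HTensor HB HA), S k y⟫_ℂ) l (𝓝 (q x y))) :
    ∃ Ω : HTensor HB HA →L[ℂ] HTensor HB HA, Ω.IsPositive ∧ ContinuousLinearMapWOT.ofCLM Ω ∈
      closure (ContinuousLinearMapWOT.ofCLM '' finiteSeparable HB HA) ∧
      ∀ x y : HB ⊗[ℂ] HA, q x y = ⟪(x : HTensor HB HA), Ω (y : HTensor HB HA)⟫_ℂ := by
  -- The norm bound on the approximants passes to the limit form; this is where boundedness of the
  -- CJ form comes from.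
  have hb : ∀ x y, ‖q x y‖ ≤ 1 * ‖x‖ * ‖y‖ := fun x y => by
    refine le_of_tendsto' (h x y).norm fun k => (norm_inner_le_norm _ _).trans ?_
    rw [one_mul, UniformSpace.Completion.norm_coe]
    gcongr
    simpa using (S k).le_of_opNorm_le (norm_finiteSeparable_le (hS k)) y
  obtain ⟨Ω, hΩ⟩ := exists_op_of_bounded_form q hb
  have ht := tendsto_wot_of_dense (fun k => norm_finiteSeparable_le (hS k))
    (fun x y => by rw [← hΩ]; exact h x y)
  exact ⟨Ω, isPositive_of_tendsto_wot (fun k => isPositive_finiteSeparable (hS k)) ht,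
    mem_closure_of_tendsto ht (.of_forall fun k => ⟨_, hS k, rfl⟩), hΩ⟩

/-- A channel preserves the trace by assumption only on states. Both sides are sesquilinear in (y,
x), so the unit vectors x = y suffice. -/
theorem IsChannel.trace_ketbra {b : HilbertBasis ι ℂ HA} {Φ : TraceClass HA →ₗ[ℂ] TraceClass HB}
    (hΦ : IsChannel b Φ) (x y : HA) :
    trace (Φ (ketbra x y) : HB →L[ℂ] HB) = ⟪y, x⟫_ℂ := by
  let B : HA →ₗ⋆[ℂ] HA →ₗ[ℂ] ℂ := LinearMap.mk₂'ₛₗ (starRingEnd ℂ) (RingHom.id ℂ)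
    (fun y x => trace (Φ (ketbra x y) : HB →L[ℂ] HB))
    (fun y y' x => by
      rw [ketbra_add_right, map_add, Submodule.coe_add, trace_add (Φ _).2 (Φ _).2])
    (fun c y x => by rw [ketbra_smul_right, map_smul, Submodule.coe_smul, trace_smul]; rfl)
    (fun y x x' => by
      rw [ketbra_add_left, map_add, Submodule.coe_add, trace_add (Φ _).2 (Φ _).2])
    (fun c y x => by rw [ketbra_smul_left, map_smul, Submodule.coe_smul, trace_smul]; rfl)
  refine sesq_eq_of_unit (B := B) (B' := innerₛₗ ℂ) (fun z hz => ?_) y x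
  change trace (Φ (ketbra z z) : HB →L[ℂ] HB) = ⟪z, z⟫_ℂ
  rw [(hΦ.map_state _ (isState_ketbra hz)).trace_eq_one, inner_self_eq_norm_sq_to_K, hz]
  norm_num

/-- The sum defining Tr_B Ω is the trace of Φ(|ψ̄⟩⟨ψ̄'|) in the basis e. Using the channel here
avoids taking partial traces through a weak limit. -/
theorem IsChannel.partialTraceEqOne {b : HilbertBasis ι ℂ HA}
    {Φ : TraceClass HA →ₗ[ℂ] TraceClass HB} (hΦ : IsChannel b Φ)
    {Ω : HTensor HB HA →L[ℂ] HTensor HB HA} (hΩ : IsCJOperator b Φ Ω) : PartialTraceEqOne Ω := by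
  intro w e ψ ψ'
  have h := (Φ (ketbra (conjVec b ψ) (conjVec b ψ'))).2.hasSum_trace e
  rw [hΦ.trace_ketbra, inner_conjVec_conjVec] at h
  convert h using 2 with k
  rw [← cjForm_tmul]
  exact (hΩ _ _).symm

end Channels

/-! ### Double series, nets, and series in trace norm. -/

section Series

variable {H : Type*} [NormedAddCommGroup H] [InnerProductSpace ℂ H]

theorem hasSum_prod_of_nonneg {α β : Type*} {F : α × β → ℝ} (hF : ∀ p, 0 ≤ F p) {c : β → ℝ}
    {s : ℝ} (h : ∀ k, HasSum (fun i => F (i, k)) (c k)) (hc : HasSum c s) : HasSum F s := by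
  have hs : Summable (F ∘ Equiv.prodComm β α) := by
    refine (summable_prod_of_nonneg fun p => hF _).2 ⟨fun k => (h k).summable, ?_⟩
    have : (fun k => ∑' i, (F ∘ Equiv.prodComm β α) (k, i)) = c := funext fun k => (h k).tsum_eq
    exact this.symm ▸ hc.summable
  have h1 := hs.hasSum.prod_fiberwise fun k => h k
  rw [← (Equiv.prodComm β α).hasSum_iff, hc.unique h1]
  exact hs.hasSum

/-- A net in `s` converging to a given point of the closure of `s`. -/
theorem exists_net_of_mem_closure {s : Set (H →L[ℂ] H)} {Ω : H →L[ℂ] H}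
    (h : ContinuousLinearMapWOT.ofCLM Ω ∈ closure (ContinuousLinearMapWOT.ofCLM '' s)) :
    ∃ l : Filter s, l.NeBot ∧ Tendsto (fun k : s => ContinuousLinearMapWOT.ofCLM (k : H →L[ℂ] H)) l
      (𝓝 (ContinuousLinearMapWOT.ofCLM Ω)) := by
  refine ⟨comap (fun k : s => ContinuousLinearMapWOT.ofCLM (k : H →L[ℂ] H))
    (𝓝 (ContinuousLinearMapWOT.ofCLM Ω)), comap_neBot_iff.2 fun t ht => ?_, tendsto_comap⟩
  obtain ⟨_, h1, k, hk, rfl⟩ := mem_closure_iff_nhds.1 h t ht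
  exact ⟨⟨k, hk⟩, h1⟩

variable [CompleteSpace H]

theorem exists_nuclear_series {κ : Type*} {T : κ → H →L[ℂ] H} {c : κ → ℝ} (hc : Summable c)
    (hT : ∀ k, NuclearBound (T k) (c k)) :
    ∃ S : H →L[ℂ] H, IsTraceClass S ∧ (∀ z, HasSum (fun k => T k z) (S z)) ∧
      HasSum (fun k => trace (T k)) (trace S) := by
  have hs : Summable T := hc.of_norm_bounded fun k => (hT k).norm_le
  have hS : ∀ z, HasSum (fun k => T k z) ((∑' k, T k) z) := fun z =>
    hs.hasSum.mapL (ContinuousLinearMap.apply ℂ H z)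
  exact ⟨∑' k, T k, (nuclearBound_series hc hT hS).1.isTraceClass, hS,
    (nuclearBound_series hc hT hS).2⟩

theorem eq_zero_of_trace_eq_zero {T : H →L[ℂ] H} (hT : IsTraceClass T) (hp : T.IsPositive)
    (h0 : trace T = 0) : T = 0 := by
  obtain ⟨A, rfl⟩ := exists_eq_adjoint_comp hp
  have h := hT.hasSum_trace (someBasis H)
  rw [h0, ← Complex.ofReal_zero] at h
  have h' := hasSum_norm_sq_of_trace _ h
  have := (nuclearBound_adjoint_comp _ _ h' h').norm_le
  rw [Real.sqrt_zero, zero_mul] at this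
  exact norm_le_zero_iff.1 this

end Series

/-! ### The channel defined by a positive operator with Tr_B Ω = I. -/

section CJChannel

variable {HB HA : Type*}
  [NormedAddCommGroup HB] [InnerProductSpace ℂ HB] [CompleteSpace HB]
  [NormedAddCommGroup HA] [InnerProductSpace ℂ HA] [CompleteSpace HA] {ι : Type*}
  (b : HilbertBasis ι ℂ HA)

/-- The operator `N` in `H_A` with `⟨y|N|x⟩ = ⟨ψ ⊗ x̄|Ω|ψ' ⊗ ȳ⟩`. -/
noncomputable def cjKernel (Ω : HTensor HB HA →L[ℂ] HTensor HB HA) (ψ ψ' : HB) : HA →L[ℂ] HA :=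
  adjoint (conjOp b (adjoint (tensorLeft ψ) ∘L Ω ∘L tensorLeft ψ'))

theorem inner_cjKernel (Ω : HTensor HB HA →L[ℂ] HTensor HB HA) (ψ ψ' : HB) (x y : HA) :
    ⟪y, cjKernel b Ω ψ ψ' x⟫_ℂ = ⟪pv ψ (conjVec b x), Ω (pv ψ' (conjVec b y))⟫_ℂ := by
  rw [cjKernel, ContinuousLinearMap.adjoint_inner_right, conjOp_apply, inner_conjVec_left,
    ContinuousLinearMap.comp_apply, ContinuousLinearMap.adjoint_inner_right,
    ContinuousLinearMap.comp_apply, tensorLeft_apply, tensorLeft_apply]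

theorem isPositive_cjKernel {Ω : HTensor HB HA →L[ℂ] HTensor HB HA} (hΩ : Ω.IsPositive) (ψ : HB) :
    (cjKernel b Ω ψ ψ).IsPositive :=
  isPositive_of_inner_nonneg fun x => by
    rw [inner_cjKernel]
    exact hΩ.inner_nonneg_right _

variable {b}

/-- The use of Tr_B Ω = I in estimates: ψ ↦ A(ψ ⊗ a) is Hilbert–Schmidt with norm ‖a‖. -/
theorem PartialTraceEqOne.hasSum_norm_sq {A : HTensor HB HA →L[ℂ] HTensor HB HA}
    (h : PartialTraceEqOne (adjoint A ∘L A)) (a : HA) :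
    HasSum (fun i => ‖A (pv (someBasis HB i) a)‖ ^ 2) (‖a‖ ^ 2) := by
  have := (h _ (someBasis HB) a a).mapL Complex.reCLM
  rw [inner_self_eq_norm_sq_to_K] at this
  simp only [inner_adjoint_comp_self, Complex.reCLM_apply, Complex.ofReal_re] at this
  convert this using 1
  norm_cast

variable {Ω : HTensor HB HA →L[ℂ] HTensor HB HA}

/-- With Ω = A*A and J_a ψ = ψ ⊗ ā, the image of |x⟩⟨y| is (A J_x)*(A J_y), a product of
Hilbert–Schmidt operators of norms ‖x‖ and ‖y‖. A nuclear representation of T therefore goes to a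
series converging absolutely in trace norm. The formula with `cjKernel` does not involve the
representation, which later gives linearity. -/
theorem exists_cj_image (b : HilbertBasis ι ℂ HA) (hΩ : Ω.IsPositive) (htr : PartialTraceEqOne Ω)
    (T : TraceClass HA) :
    ∃ S : TraceClass HB, trace (S : HB →L[ℂ] HB) = trace (T : HA →L[ℂ] HA) ∧
      ∀ ψ ψ', ⟪ψ, (S : HB →L[ℂ] HB) ψ'⟫_ℂ =
        trace (cjKernel b Ω ψ ψ' ∘L (T : HA →L[ℂ] HA)) := by
  obtain ⟨A, rfl⟩ := exists_eq_adjoint_comp hΩ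
  obtain ⟨x, y, hxy⟩ := T.2
  let J : HA → HB →L[ℂ] HTensor HB HA := fun a => tensorRight (conjVec b a)
  have hJ : ∀ a, HasSum (fun i => ‖(A ∘L J a) (someBasis HB i)‖ ^ 2) (‖a‖ ^ 2) := fun a => by
    simpa [J, tensorRight_apply, norm_conjVec] using htr.hasSum_norm_sq (conjVec b a)
  have hn : ∀ n, NuclearBound (adjoint (A ∘L J (x n)) ∘L (A ∘L J (y n))) (‖x n‖ * ‖y n‖) :=
    fun n => by simpa using nuclearBound_adjoint_comp _ _ (hJ (x n)) (hJ (y n))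
  have hin : ∀ n ψ ψ', ⟪ψ, (adjoint (A ∘L J (x n)) ∘L (A ∘L J (y n))) ψ'⟫_ℂ =
      ⟪pv ψ (conjVec b (x n)), (adjoint A ∘L A) (pv ψ' (conjVec b (y n)))⟫_ℂ := fun n ψ ψ' => by
    simp [J, ContinuousLinearMap.adjoint_inner_right, tensorRight_apply]
  obtain ⟨S, hS, hSz, hStr⟩ := exists_nuclear_series hxy.1 hn
  refine ⟨⟨S, hS⟩, ?_, fun ψ ψ' => ?_⟩
  · refine hStr.unique ?_
    have : ∀ n, trace (adjoint (A ∘L J (x n)) ∘L (A ∘L J (y n))) = ⟪y n, x n⟫_ℂ := fun n => by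
      rw [← inner_conjVec_conjVec b]
      exact ((hn n).isTraceClass.hasSum_trace (someBasis HB)).unique
        (by simpa only [hin] using htr _ (someBasis HB) (conjVec b (x n)) (conjVec b (y n)))
    simp only [this]
    exact hxy.hasSum_trace
  · have h1 := (hSz ψ').mapL (innerSL ℂ ψ)
    have h2 := hxy.hasSum_trace_comp (cjKernel b (adjoint A ∘L A) ψ ψ')
    simp only [inner_cjKernel] at h2
    simp only [innerSL_apply_apply, hin] at h1
    exact h1.unique h2

/-- The linear map with a given positive operator `Ω`, `Tr_B Ω = I_A`, as its
Choi-Jamiolkowski operator. -/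
theorem exists_linearMap_of_cj (b : HilbertBasis ι ℂ HA) (hΩ : Ω.IsPositive)
    (htr : PartialTraceEqOne Ω) :
    ∃ Φ : TraceClass HA →ₗ[ℂ] TraceClass HB,
      (∀ T, trace (Φ T : HB →L[ℂ] HB) = trace (T : HA →L[ℂ] HA)) ∧
      ∀ T ψ ψ', ⟪ψ, (Φ T : HB →L[ℂ] HB) ψ'⟫_ℂ =
        trace (cjKernel b Ω ψ ψ' ∘L (T : HA →L[ℂ] HA)) := by
  choose f hf1 hf2 using exists_cj_image b hΩ htr
  have hext : ∀ S S' : TraceClass HB,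
      (∀ ψ ψ', ⟪ψ, (S : HB →L[ℂ] HB) ψ'⟫_ℂ = ⟪ψ, (S' : HB →L[ℂ] HB) ψ'⟫_ℂ) → S = S' :=
    fun S S' h => Subtype.ext (ContinuousLinearMap.ext fun z => ext_inner_left ℂ fun w => h w z)
  refine ⟨{ toFun := f, map_add' := fun T T' => hext _ _ fun ψ ψ' => ?_,
            map_smul' := fun c T => hext _ _ fun ψ ψ' => ?_ }, hf1, hf2⟩
  · rw [hf2, Submodule.coe_add, Submodule.coe_add, add_apply, inner_add_right, hf2, hf2,
      ContinuousLinearMap.comp_add, trace_add (T.2.comp_left _) (T'.2.comp_left _)]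
  · rw [hf2, Submodule.coe_smul, RingHom.id_apply, Submodule.coe_smul, smul_apply,
      inner_smul_right, hf2, ContinuousLinearMap.comp_smul, trace_smul]

theorem isCJOperator_of_tmul {Φ : TraceClass HA →ₗ[ℂ] TraceClass HB}
    (h : ∀ ψ ψ' a a', ⟪ψ, (Φ (ketbra (conjVec b a) (conjVec b a')) : HB →L[ℂ] HB) ψ'⟫_ℂ =
      ⟪pv ψ a, Ω (pv ψ' a')⟫_ℂ) : IsCJOperator b Φ Ω := by
  intro x y
  induction x with
  | zero => rw [map_zero, LinearMap.zero_apply, UniformSpace.Completion.coe_zero, inner_zero_left]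
  | add x x' hx hx' =>
    rw [map_add, LinearMap.add_apply, hx, hx', UniformSpace.Completion.coe_add, inner_add_left]
  | tmul ψ a =>
    induction y with
    | zero => rw [map_zero, UniformSpace.Completion.coe_zero, map_zero, inner_zero_right]
    | add y y' hy hy' =>
      rw [map_add, hy, hy', UniformSpace.Completion.coe_add, map_add, inner_add_right]
    | tmul ψ' a' => exact h ψ ψ' a a'

theorem trace_cjKernel_ketbra (ψ ψ' : HB) (a a' : HA) :
    trace (cjKernel b Ω ψ ψ' ∘L (ketbra a a' : HA →L[ℂ] HA)) =
      ⟪pv ψ (conjVec b a), Ω (pv ψ' (conjVec b a'))⟫_ℂ := by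
  have : cjKernel b Ω ψ ψ' ∘L (ketbra a a' : HA →L[ℂ] HA) =
      InnerProductSpace.rankOne ℂ (cjKernel b Ω ψ ψ' a) a' := by
    ext z; simp [ketbra]
  rw [this, trace_rankOne, inner_cjKernel]

theorem isChannel_of_cj {Φ : TraceClass HA →ₗ[ℂ] TraceClass HB} (hΩ : Ω.IsPositive)
    (h1 : ∀ T, trace (Φ T : HB →L[ℂ] HB) = trace (T : HA →L[ℂ] HA))
    (h2 : ∀ T ψ ψ', ⟪ψ, (Φ T : HB →L[ℂ] HB) ψ'⟫_ℂ =
        trace (cjKernel b Ω ψ ψ' ∘L (T : HA →L[ℂ] HA))) : IsChannel b Φ where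
  map_state ρ hρ :=
    { isTraceClass := (Φ ρ).2
      isPositive := isPositive_of_inner_nonneg fun ψ => by
        rw [h2]
        exact trace_comp_nonneg hρ.isTraceClass hρ.isPositive (isPositive_cjKernel b hΩ ψ)
      trace_eq_one := by rw [h1, hρ.trace_eq_one] }
  block_nonneg s ψ := by
    -- Conjugation fixes the basis vectors, so block positivity is positivity of Ω at ∑ ψ_i ⊗ b_i.
    have := hΩ.inner_nonneg_right (∑ i ∈ s, pv (ψ i) (b i))
    simp only [map_sum, sum_inner, inner_sum] at this
    rw [Finset.sum_comm] at this
    simpa only [h2, trace_cjKernel_ketbra, conjVec_basis] using this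

end CJChannel

/-! ### Separable operators define entanglement-breaking channels. -/

section EntanglementBreaking

variable {HB HA : Type*}
  [NormedAddCommGroup HB] [InnerProductSpace ℂ HB] [CompleteSpace HB]
  [NormedAddCommGroup HA] [InnerProductSpace ℂ HA] [CompleteSpace HA] {ι : Type*}
  (b : HilbertBasis ι ℂ HA)

/-- The operator `a ↦ conj ⟨a|v⟩` defined by a vector `v` of `H_A ⊗ H_A`; here `⟨a|v⟩` is the partial
inner product over the second factor. -/
noncomputable def slant (v : HTensor HA HA) : HA →L[ℂ] HA :=
  LinearMap.mkContinuous
    { toFun := fun a => conjVec b (adjoint (tensorRight a) v)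
      map_add' := fun a a' => by rw [tensorRight_add, map_add, add_apply, map_add]
      map_smul' := fun c a => by
        rw [tensorRight_smul, LinearIsometryEquiv.map_smulₛₗ, smul_apply,
          ContinuousLinearMap.map_smulₛₗ, Complex.conj_conj]
        rfl } ‖v‖
    (fun a => by
      change ‖conjVec b (adjoint (tensorRight a) v)‖ ≤ _
      rw [norm_conjVec, mul_comm]
      refine (ContinuousLinearMap.le_opNorm _ _).trans ?_
      gcongr
      rw [LinearIsometryEquiv.norm_map]
      exact norm_tensorRight_le a)

theorem slant_apply (v : HTensor HA HA) (a : HA) :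
    slant b v a = conjVec b (adjoint (tensorRight a) v) := rfl

theorem norm_slant_le (v : HTensor HA HA) : ‖slant b v‖ ≤ ‖v‖ :=
  LinearMap.mkContinuous_norm_le _ (norm_nonneg _) _

/-- Parseval in the first factor, then in the product basis: `slant` is isometric into the
Hilbert–Schmidt operators. The conjugation in it interchanges u and v. -/
theorem hasSum_inner_slant {κ : Type*} (f : HilbertBasis κ ℂ HA) (u v : HTensor HA HA) :
    HasSum (fun k => ⟪slant b u (f k), slant b v (f k)⟫_ℂ) ⟪v, u⟫_ℂ := by
  obtain ⟨g, hg⟩ := exists_prodBasis (someBasis HA) f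
  have h := (Equiv.prodComm κ (someBasisSet HA)).hasSum_iff.2 (g.hasSum_inner_mul_inner v u)
  refine h.prod_fiberwise fun k => ?_
  rw [slant_apply, slant_apply, inner_conjVec_conjVec]
  have := (someBasis HA).hasSum_inner_mul_inner (adjoint (tensorRight (f k)) v)
    (adjoint (tensorRight (f k)) u)
  simpa [hg, ContinuousLinearMap.adjoint_inner_left, ContinuousLinearMap.adjoint_inner_right,
    tensorRight_apply] using this

theorem hasSum_norm_sq_slant {κ : Type*} (f : HilbertBasis κ ℂ HA) (v : HTensor HA HA) :
    HasSum (fun k => ‖slant b v (f k)‖ ^ 2) (‖v‖ ^ 2) := by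
  have := (hasSum_inner_slant b f v v).mapL Complex.reCLM
  simp only [inner_self_eq_norm_sq_to_K, Complex.reCLM_apply] at this
  exact_mod_cast this

theorem nuclearBound_slant (u v : HTensor HA HA) (M : HA →L[ℂ] HA) :
    NuclearBound (adjoint (slant b u) ∘L (M ∘L slant b v)) (‖M‖ * (‖u‖ * ‖v‖)) := by
  have h1 := hasSum_norm_sq_slant b (someBasis HA) u
  have h2 := hasSum_norm_sq_slant b (someBasis HA) v
  have hle : ∀ i, ‖(M ∘L slant b v) (someBasis HA i)‖ ^ 2 ≤
      ‖M‖ ^ 2 * ‖slant b v (someBasis HA i)‖ ^ 2 := fun i => by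
    rw [← mul_pow]
    gcongr
    exact M.le_opNorm _
  have hs := Summable.of_nonneg_of_le (fun i => by positivity) hle (h2.summable.mul_left _)
  have hle' : ∑' i, ‖(M ∘L slant b v) (someBasis HA i)‖ ^ 2 ≤ (‖M‖ * ‖v‖) ^ 2 := by
    rw [mul_pow]
    exact hasSum_le hle hs.hasSum (h2.mul_left _)
  refine (nuclearBound_adjoint_comp _ _ h1 hs.hasSum).mono ?_
  calc √(‖u‖ ^ 2) * √(∑' i, ‖(M ∘L slant b v) (someBasis HA i)‖ ^ 2)
      ≤ √(‖u‖ ^ 2) * √((‖M‖ * ‖v‖) ^ 2) := by gcongr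
    _ = ‖M‖ * (‖u‖ * ‖v‖) := by
      rw [Real.sqrt_sq (norm_nonneg _), Real.sqrt_sq (by positivity)]; ring

variable {b}

/-- `ω` has a nuclear representation, hence so have its partial matrix elements. -/
theorem IsNuclearRep.slice {ω : TraceClass (HTensor HA HA)} {u v : ℕ → HTensor HA HA}
    (h : IsNuclearRep (ω : HTensor HA HA →L[ℂ] HTensor HA HA) u v) (a a' : HA) :
    IsNuclearRep (slice ω a a' : HA →L[ℂ] HA) (fun n => adjoint (tensorRight a) (u n))
      (fun n => adjoint (tensorRight a') (v n)) := by
  refine ⟨Summable.of_nonneg_of_le (fun n => by positivity) (fun n => ?_)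
    (h.1.mul_left (‖adjoint (tensorRight (E := HA) a)‖ * ‖adjoint (tensorRight (E := HA) a')‖)),
    fun z => ?_⟩
  · calc _ ≤ (‖adjoint (tensorRight a)‖ * ‖u n‖) * (‖adjoint (tensorRight a')‖ * ‖v n‖) := by
          gcongr <;> exact ContinuousLinearMap.le_opNorm _ _
      _ = _ := by ring
  · have := (h.2 (tensorRight a' z)).mapL (adjoint (tensorRight a))
    simpa [CJ.slice, ContinuousLinearMap.adjoint_inner_left] using this

theorem isPositive_slice {ω : TraceClass (HTensor HA HA)}
    (hω : (ω : HTensor HA HA →L[ℂ] HTensor HA HA).IsPositive) (a : HA) :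
    (slice ω a a : HA →L[ℂ] HA).IsPositive :=
  isPositive_of_inner_nonneg fun x => by
    have := hω.inner_nonneg_right (tensorRight a x)
    simpa [slice, ContinuousLinearMap.adjoint_inner_right] using this

/-- The unnormalized conditional state `Tr₁ (M̄ ⊗ I) ω`. -/
theorem exists_conditional (b : HilbertBasis ι ℂ HA) {ω : TraceClass (HTensor HA HA)}
    {u v : ℕ → HTensor HA HA}
    (h : IsNuclearRep (ω : HTensor HA HA →L[ℂ] HTensor HA HA) u v) (M : HA →L[ℂ] HA) :
    ∃ τ : HA →L[ℂ] HA, IsTraceClass τ ∧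
      (∀ a a', HasSum (fun n => ⟪slant b (u n) a, M (slant b (v n) a')⟫_ℂ) ⟪a, τ a'⟫_ℂ) ∧
      HasSum (fun n => trace (adjoint (slant b (u n)) ∘L (M ∘L slant b (v n)))) (trace τ) := by
  obtain ⟨τ, h1, h2, h3⟩ := exists_nuclear_series (h.1.mul_left ‖M‖)
    (fun n => nuclearBound_slant b (u n) (v n) M)
  refine ⟨τ, h1, fun a a' => ?_, h3⟩
  have := (h2 a').mapL (innerSL ℂ a)
  simpa [ContinuousLinearMap.adjoint_inner_right] using this

/-- The diagonal element ⟨a|τ|a⟩ is the trace of the product of the positive operators M̄ and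
⟨a|ω|a⟩. -/
theorem isPositive_conditional {ω : TraceClass (HTensor HA HA)} {u v : ℕ → HTensor HA HA}
    (h : IsNuclearRep (ω : HTensor HA HA →L[ℂ] HTensor HA HA) u v)
    (hω : (ω : HTensor HA HA →L[ℂ] HTensor HA HA).IsPositive) {M τ : HA →L[ℂ] HA}
    (hM : M.IsPositive)
    (hτ : ∀ a a', HasSum (fun n => ⟪slant b (u n) a, M (slant b (v n) a')⟫_ℂ) ⟪a, τ a'⟫_ℂ) :
    τ.IsPositive := by
  refine isPositive_of_inner_nonneg fun a => ?_
  have h1 := (h.slice a a).hasSum_trace_comp (conjOp b M)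
  have h2 : (fun n => ⟪adjoint (tensorRight a) (v n),
      conjOp b M (adjoint (tensorRight a) (u n))⟫_ℂ) =
      fun n => ⟪slant b (u n) a, M (slant b (v n) a)⟫_ℂ := by
    ext n
    rw [inner_conjOp, slant_apply, slant_apply, hM.inner_left_eq_inner_right]
  rw [h2] at h1
  rw [(hτ a a).unique h1]
  exact trace_comp_nonneg (slice ω a a).2 (isPositive_slice hω a) (isPositive_conjOp b hM)

theorem norm_tensorOp_le {E F : Type*} [NormedAddCommGroup E] [InnerProductSpace ℂ E]
    [NormedAddCommGroup F] [InnerProductSpace ℂ F] (S : E →L[ℂ] E) (T : F →L[ℂ] F) :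
    ‖tensorOp S T‖ ≤ ‖S‖ * ‖T‖ := by
  refine ContinuousLinearMap.opNorm_le_bound _ (by positivity) fun x => ?_
  induction x using UniformSpace.Completion.induction_on with
  | hp => exact isClosed_le (by fun_prop) (by fun_prop)
  | ih x =>
    have h : tensorOp S T (x : HTensor E F) =
        ((TensorProduct.map S.toLinearMap T.toLinearMap x : E ⊗[ℂ] F) : HTensor E F) := by
      induction x with
      | zero => simp only [map_zero, UniformSpace.Completion.coe_zero]
      | tmul x y => exact tensorOp_pv S T x y
      | add x y hx hy => simp only [map_add, UniformSpace.Completion.coe_add, hx, hy]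
    rw [h, UniformSpace.Completion.norm_coe, UniformSpace.Completion.norm_coe]
    exact norm_map_le S T x

theorem hasSum_apply_of_norm_le {W : Type*} [NormedAddCommGroup W] [NormedSpace ℂ W]
    [CompleteSpace W] {T : ℕ → W →L[ℂ] W} {c : ℕ → ℝ} (hc : Summable c) (hT : ∀ n, ‖T n‖ ≤ c n)
    (y : W) : HasSum (fun n => T n y) ((∑' n, T n) y) :=
  (Summable.of_norm_bounded hc hT).hasSum.mapL (ContinuousLinearMap.apply ℂ W y)

section Amplify

variable (b) (u v : ℕ → HTensor HA HA)

/-- `(Φ ⊗ Id)(∑ₙ |uₙ⟩⟨vₙ|)` for the map `Φ` with Choi-Jamiolkowski operator `Ω`. -/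
noncomputable def amplify (Ω : HTensor HB HA →L[ℂ] HTensor HB HA) :
    HTensor HB HA →L[ℂ] HTensor HB HA :=
  ∑' n, adjoint (tensorOp 1 (slant b (u n))) ∘L (Ω ∘L tensorOp 1 (slant b (v n)))

variable {u v}

theorem norm_tensorOp_one_slant_apply_le (w : HTensor HA HA) (x : HTensor HB HA) :
    ‖tensorOp 1 (slant b w) x‖ ≤ ‖w‖ * ‖x‖ := by
  refine (ContinuousLinearMap.le_of_opNorm_le _ (norm_tensorOp_le _ _) x).trans ?_
  gcongr
  calc ‖(1 : HB →L[ℂ] HB)‖ * ‖slant b w‖ ≤ 1 * ‖w‖ := by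
        gcongr
        · exact ContinuousLinearMap.norm_id_le
        · exact norm_slant_le b w
    _ = ‖w‖ := one_mul _

theorem norm_inner_slant_le (w w' : HTensor HA HA) (Ω : HTensor HB HA →L[ℂ] HTensor HB HA)
    (x y : HTensor HB HA) :
    ‖⟪tensorOp 1 (slant b w) x, Ω (tensorOp 1 (slant b w') y)⟫_ℂ‖ ≤
      ‖Ω‖ * ‖x‖ * ‖y‖ * (‖w‖ * ‖w'‖) := by
  calc _ ≤ ‖tensorOp 1 (slant b w) x‖ * ‖Ω (tensorOp 1 (slant b w') y)‖ := norm_inner_le_norm _ _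
    _ ≤ (‖w‖ * ‖x‖) * (‖Ω‖ * (‖w'‖ * ‖y‖)) := by
      gcongr
      · exact norm_tensorOp_one_slant_apply_le b w x
      · refine (Ω.le_opNorm _).trans ?_
        gcongr
        exact norm_tensorOp_one_slant_apply_le b w' y
    _ = _ := by ring

theorem norm_amplify_term_le (w w' : HTensor HA HA) (Ω : HTensor HB HA →L[ℂ] HTensor HB HA) :
    ‖adjoint (tensorOp 1 (slant b w)) ∘L (Ω ∘L tensorOp 1 (slant b w'))‖ ≤
      ‖Ω‖ * (‖w‖ * ‖w'‖) := by
  have hle : ‖adjoint (tensorOp (1 : HB →L[ℂ] HB) (slant b w))‖ ≤ ‖w‖ := by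
    rw [LinearIsometryEquiv.norm_map]
    exact ContinuousLinearMap.opNorm_le_bound _ (norm_nonneg _)
      (norm_tensorOp_one_slant_apply_le b w)
  have hle' : ‖tensorOp (1 : HB →L[ℂ] HB) (slant b w')‖ ≤ ‖w'‖ :=
    ContinuousLinearMap.opNorm_le_bound _ (norm_nonneg _) (norm_tensorOp_one_slant_apply_le b w')
  calc _ ≤ ‖adjoint (tensorOp (1 : HB →L[ℂ] HB) (slant b w))‖ *
        (‖Ω‖ * ‖tensorOp (1 : HB →L[ℂ] HB) (slant b w')‖) :=
        (ContinuousLinearMap.opNorm_comp_le _ _).trans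
          (mul_le_mul_of_nonneg_left (ContinuousLinearMap.opNorm_comp_le _ _) (norm_nonneg _))
    _ ≤ ‖w‖ * (‖Ω‖ * ‖w'‖) := by gcongr
    _ = _ := by ring

theorem hasSum_amplify (huv : Summable fun n => ‖u n‖ * ‖v n‖)
    (Ω : HTensor HB HA →L[ℂ] HTensor HB HA) (y : HTensor HB HA) :
    HasSum (fun n => (adjoint (tensorOp 1 (slant b (u n))) ∘L
      (Ω ∘L tensorOp 1 (slant b (v n)))) y) (amplify b u v Ω y) :=
  hasSum_apply_of_norm_le (huv.mul_left ‖Ω‖) (fun n => norm_amplify_term_le b (u n) (v n) Ω) y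

theorem hasSum_inner_amplify (huv : Summable fun n => ‖u n‖ * ‖v n‖)
    (Ω : HTensor HB HA →L[ℂ] HTensor HB HA) (x y : HTensor HB HA) :
    HasSum (fun n => ⟪tensorOp 1 (slant b (u n)) x, Ω (tensorOp 1 (slant b (v n)) y)⟫_ℂ)
      ⟪x, amplify b u v Ω y⟫_ℂ := by
  have := (hasSum_amplify b huv Ω y).mapL (innerSL ℂ x)
  simpa [ContinuousLinearMap.adjoint_inner_right] using this

/-- Each term of the series for a matrix element converges by weak convergence of S_k, and ∑
‖u_n‖‖v_n‖ dominates uniformly because ‖S_k‖ ≤ 1. -/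
theorem tendsto_amplify (huv : Summable fun n => ‖u n‖ * ‖v n‖) {κ : Type*} {l : Filter κ}
    {S : κ → HTensor HB HA →L[ℂ] HTensor HB HA} {Ω : HTensor HB HA →L[ℂ] HTensor HB HA}
    (hS : ∀ k, ‖S k‖ ≤ 1)
    (h : Tendsto (fun k => ContinuousLinearMapWOT.ofCLM (S k)) l
      (𝓝 (ContinuousLinearMapWOT.ofCLM Ω))) :
    Tendsto (fun k => ContinuousLinearMapWOT.ofCLM (amplify b u v (S k))) l
      (𝓝 (ContinuousLinearMapWOT.ofCLM (amplify b u v Ω))) := by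
  rw [ContinuousLinearMapWOT.tendsto_iff_forall_inner_apply_tendsto] at h ⊢
  intro y x
  change Tendsto (fun k => ⟪x, amplify b u v (S k) y⟫_ℂ) l (𝓝 ⟪x, amplify b u v Ω y⟫_ℂ)
  simp only [← fun Ω => (hasSum_inner_amplify b huv Ω x y).tsum_eq]
  refine tendsto_tsum_of_dominated_convergence (huv.mul_left (‖x‖ * ‖y‖)) (fun n => h _ _)
    (.of_forall fun k n => (norm_inner_slant_le b _ _ _ _ _).trans ?_)
  have : ‖S k‖ * ‖x‖ * ‖y‖ * (‖u n‖ * ‖v n‖) = ‖S k‖ * (‖x‖ * ‖y‖ * (‖u n‖ * ‖v n‖)) := by ring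
  rw [this]
  exact mul_le_of_le_one_left (by positivity) (hS k)

end Amplify

/-- Measuring M_α on one half of ω leaves the unnormalized state τ_α on the other, and ∑ ρ_α ⊗ M_α
becomes ∑ ρ_α ⊗ τ_α. The traces of the τ_α add up to Tr ω = 1 since ∑ M_α = I, so they serve as
convex weights. -/
theorem amplify_mem_convexHull {ω : TraceClass (HTensor HA HA)} {u v : ℕ → HTensor HA HA}
    (h : IsNuclearRep (ω : HTensor HA HA →L[ℂ] HTensor HA HA) u v)
    (hω : IsState (ω : HTensor HA HA →L[ℂ] HTensor HA HA))
    {Ω : HTensor HB HA →L[ℂ] HTensor HB HA} (hΩ : Ω ∈ finiteSeparable HB HA) :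
    amplify b u v Ω ∈ convexHull ℝ (productStates HB HA) := by
  obtain ⟨n, ρ, M, hρ, hM, hsum, rfl⟩ := hΩ
  choose τ hτ1 hτ2 hτ3 using fun α => exists_conditional b h (M α)
  have hτp : ∀ α, (τ α).IsPositive := fun α =>
    isPositive_conditional h hω.isPositive (hM α) (hτ2 α)
  have hR : amplify b u v (∑ α, tensorOp (ρ α) (M α)) = ∑ α, tensorOp (ρ α) (τ α) := by
    refine op_ext_pv fun x y x' y' => ?_
    refine (hasSum_inner_amplify b h.1 _ _ _).unique ?_
    simp only [tensorOp_pv, sum_apply, inner_sum, inner_pv, one_apply_eq_self]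
    exact hasSum_sum fun α _ => (hτ2 α y y').mul_left _
  have htr : ∑ α, trace (τ α) = 1 := by
    have h1 := hasSum_sum (s := Finset.univ) fun α _ => hτ3 α
    refine h1.unique ?_
    have h2 := h.hasSum_trace
    rw [hω.trace_eq_one] at h2
    convert h2 using 2 with k
    have h3 := hasSum_sum (s := Finset.univ) fun α _ =>
      (nuclearBound_slant b (u k) (v k) (M α)).isTraceClass.hasSum_trace (someBasis HA)
    refine h3.unique ?_
    convert hasSum_inner_slant b (someBasis HA) (u k) (v k) using 2 with i
    simp only [ContinuousLinearMap.comp_apply, ContinuousLinearMap.adjoint_inner_right]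
    rw [← inner_sum, ← sum_apply, hsum, one_apply_eq_self]
  have hnn : ∀ α, 0 ≤ trace (τ α) := fun α => trace_nonneg (hτ1 α) (hτp α)
  have hre : ∀ α, trace (τ α) = ((trace (τ α)).re : ℂ) := fun α =>
    Complex.ext rfl (by simpa using (Complex.le_def.1 (hnn α)).2.symm)
  classical
  -- Terms of trace zero cannot be normalized, but a positive operator of trace zero vanishes, so
  -- they are dropped.
  have hsub : ∑ α, tensorOp (ρ α) (τ α) = ∑ α with (trace (τ α)).re ≠ 0, (trace (τ α)).re •
      tensorOp (ρ α) ((((trace (τ α)).re⁻¹ : ℝ) : ℂ) • τ α) := by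
    rw [Finset.sum_filter]
    refine Finset.sum_congr rfl fun α _ => ?_
    split_ifs with h0
    · rw [tensorOp_smul_right, ← Complex.coe_smul, smul_smul, ← Complex.ofReal_mul,
        mul_inv_cancel₀ h0, Complex.ofReal_one, one_smul]
    · have : τ α = 0 := eq_zero_of_trace_eq_zero (hτ1 α) (hτp α) (by
        rw [hre, not_not.1 h0, Complex.ofReal_zero])
      rw [this]
      simpa using tensorOp_smul_right 0 (ρ α) (0 : HA →L[ℂ] HA)
  rw [hR, hsub]
  refine (convex_convexHull ℝ _).sum_mem (fun α _ => (Complex.le_def.1 (hnn α)).1) ?_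
    fun α hα => subset_convexHull ℝ _ ⟨ρ α, _, hρ α, ⟨?_, ?_, ?_⟩, rfl⟩
  · rw [Finset.sum_filter_ne_zero, ← Complex.re_sum, htr, Complex.one_re]
  · exact (TraceClass HA).smul_mem _ (hτ1 α)
  · exact (hτp α).smul_of_nonneg
      (by exact_mod_cast inv_nonneg.2 (Complex.le_def.1 (hnn α)).1)
  · have h0 := (Finset.mem_filter.1 hα).2
    rw [trace_smul, hre α, Complex.ofReal_re, ← Complex.ofReal_mul, inv_mul_cancel₀ h0,
      Complex.ofReal_one]

/-- The trace is not weakly continuous, so it is computed from Tr_B Ω = I and not from approximants.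
With Ω = A*A, each A(1 ⊗ `slant` w) is Hilbert–Schmidt of norm ‖w‖; summing the diagonal over the
basis of H_B first reduces each term to ⟨v_n, u_n⟩. -/
theorem isTraceClass_amplify {ω : TraceClass (HTensor HA HA)} {u v : ℕ → HTensor HA HA}
    (h : IsNuclearRep (ω : HTensor HA HA →L[ℂ] HTensor HA HA) u v)
    {Ω : HTensor HB HA →L[ℂ] HTensor HB HA} (hΩ : Ω.IsPositive) (htr : PartialTraceEqOne Ω) :
    IsTraceClass (amplify b u v Ω) ∧
      trace (amplify b u v Ω) = trace (ω : HTensor HA HA →L[ℂ] HTensor HA HA) := by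
  obtain ⟨A, rfl⟩ := exists_eq_adjoint_comp hΩ
  obtain ⟨g, hg⟩ := exists_prodBasis (someBasis HB) (someBasis HA)
  have hW : ∀ w : HTensor HA HA,
      HasSum (fun p => ‖(A ∘L tensorOp (1 : HB →L[ℂ] HB) (slant b w)) (g p)‖ ^ 2) (‖w‖ ^ 2) :=
    fun w => by
      refine hasSum_prod_of_nonneg (fun p => by positivity) (fun k => ?_)
        (hasSum_norm_sq_slant b (someBasis HA) w)
      simpa [hg, tensorOp_pv] using htr.hasSum_norm_sq (slant b w (someBasis HA k))
  have hn : ∀ n, NuclearBound (adjoint (tensorOp 1 (slant b (u n))) ∘L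
      ((adjoint A ∘L A) ∘L tensorOp 1 (slant b (v n)))) (‖u n‖ * ‖v n‖) := fun n => by
    have := nuclearBound_adjoint_comp _ _ (hW (u n)) (hW (v n))
    rw [Real.sqrt_sq (norm_nonneg _), Real.sqrt_sq (norm_nonneg _),
      ContinuousLinearMap.adjoint_comp] at this
    exact this
  obtain ⟨h1, h2⟩ := nuclearBound_series h.1 hn (hasSum_amplify b h.1 (adjoint A ∘L A))
  refine ⟨h1.isTraceClass, h2.unique ?_⟩
  convert h.hasSum_trace using 2 with n
  have h3 := (Equiv.prodComm (someBasisSet HA) (someBasisSet HB)).hasSum_iff.2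
    ((hn n).isTraceClass.hasSum_trace g)
  have h4 := h3.prod_fiberwise (g := fun k => ⟪slant b (u n) (someBasis HA k),
    slant b (v n) (someBasis HA k)⟫_ℂ) fun k => by
      have := htr _ (someBasis HB) (slant b (u n) (someBasis HA k))
        (slant b (v n) (someBasis HA k))
      convert this using 2 with m
      simp only [Function.comp_apply, Equiv.prodComm_apply, Prod.swap, hg,
        ContinuousLinearMap.comp_apply]
      rw [ContinuousLinearMap.adjoint_inner_right, tensorOp_pv, tensorOp_pv, one_apply_eq_self]
  exact h4.unique (hasSum_inner_slant b (someBasis HA) (u n) (v n))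

/-- A convex combination of product states, made explicit. -/
theorem exists_decomposition {R : HTensor HB HA →L[ℂ] HTensor HB HA}
    (hR : R ∈ convexHull ℝ (productStates HB HA)) :
    ∃ (N : ℕ) (p : Fin N → ℝ) (ρ : Fin N → HB →L[ℂ] HB) (σ : Fin N → HA →L[ℂ] HA),
      (∀ α, 0 ≤ p α) ∧ ∑ α, p α = 1 ∧ (∀ α, IsState (ρ α)) ∧ (∀ α, IsState (σ α)) ∧
      R = ∑ α, (p α : ℂ) • tensorOp (ρ α) (σ α) := by
  obtain ⟨κ, _, w, z, hw, hw1, hz, rfl⟩ := mem_convexHull_iff_exists_fintype.1 hR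
  choose S T hS hT hST using hz
  let e := (Fintype.equivFin κ).symm
  refine ⟨Fintype.card κ, fun i => w (e i), fun i => S (e i), fun i => T (e i), fun i => hw _, ?_,
    fun i => hS _, fun i => hT _, ?_⟩
  · rw [← hw1]; exact e.sum_comp w
  · simp only [hST, Complex.coe_smul]
    exact (e.sum_comp fun k => w k • tensorOp (S k) (T k)).symm

theorem isPositive_of_mem_convexHull {R : HTensor HB HA →L[ℂ] HTensor HB HA}
    (hR : R ∈ convexHull ℝ (productStates HB HA)) : R.IsPositive := by
  obtain ⟨N, p, ρ, σ, hp, -, hρ, hσ, rfl⟩ := exists_decomposition hR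
  exact ContinuousLinearMap.isPositive_sum _ fun α _ =>
    (isPositive_tensorOp (hρ α).isPositive (hσ α).isPositive).smul_of_nonneg
      (by exact_mod_cast hp α)

/-- Amplification is weakly continuous along a bounded net of finite separable operators tending to
Ω, so the limit stays in the closure of the convex hull and stays positive. -/
theorem isEntanglementBreaking_of_cj {Φ : TraceClass HA →ₗ[ℂ] TraceClass HB}
    {Ω : HTensor HB HA →L[ℂ] HTensor HB HA} (hΩ : Ω ∈ separableOperators HB HA)
    (hΦ : ∀ T ψ ψ', ⟪ψ, (Φ T : HB →L[ℂ] HB) ψ'⟫_ℂ =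
        trace (cjKernel b Ω ψ ψ' ∘L (T : HA →L[ℂ] HA))) : IsEntanglementBreaking Φ := by
  obtain ⟨hpos, htr, hcl⟩ := hΩ
  intro ω hω
  obtain ⟨u, v, h⟩ := ω.2
  obtain ⟨l, hl, ht⟩ := exists_net_of_mem_closure hcl
  have ht' := tendsto_amplify b h.1 (fun k => norm_finiteSeparable_le k.2) ht
  have hcl' := mem_closure_of_tendsto ht' (.of_forall fun k =>
    Set.mem_image_of_mem _ (amplify_mem_convexHull h hω k.2))
  obtain ⟨h1, h2⟩ := isTraceClass_amplify (b := b) h hpos htr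
  refine ⟨amplify b u v Ω, fun ψ ψ' a a' => ?_, ⟨h1, ?_, by rw [h2, hω.trace_eq_one]⟩, hcl'⟩
  · rw [hΦ]
    refine (hasSum_inner_amplify b h.1 Ω _ _).unique ?_
    simpa only [tensorOp_pv, one_apply_eq_self, inner_cjKernel, slant_apply] using
      (h.slice a a').hasSum_trace_comp (cjKernel b Ω ψ ψ')
  · refine isPositive_of_inner_nonneg fun x => ?_
    have hx := (ContinuousLinearMapWOT.tendsto_iff_forall_inner_apply_tendsto.1 ht') x x
    refine ge_of_tendsto' hx fun k => ?_
    exact (isPositive_of_mem_convexHull (amplify_mem_convexHull h hω k.2)).inner_nonneg_right x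

end EntanglementBreaking

/-- Dominated convergence for series whose dominating series converge without loss of mass. -/
theorem tendsto_tsum_of_tendsto_dominating {κ ι : Type*} {l : Filter κ} {f : κ → ι → ℂ}
    {f' : ι → ℂ} {t : κ → ι → ℝ} {t' : ι → ℝ} {a : ℝ}
    (hf : ∀ i, Tendsto (fun k => f k i) l (𝓝 (f' i)))
    (ht : ∀ i, Tendsto (fun k => t k i) l (𝓝 (t' i)))
    (hft : ∀ k i, ‖f k i‖ ≤ t k i) (hft' : ∀ i, ‖f' i‖ ≤ t' i)
    (hts : ∀ k, Summable (t k)) (hta : ∀ k, ∑' i, t k i ≤ a) (ht' : HasSum t' a) :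
    Tendsto (fun k => ∑' i, f k i) l (𝓝 (∑' i, f' i)) := by
  have htail : ∀ (f : ι → ℂ) (t : ι → ℝ), (∀ i, ‖f i‖ ≤ t i) → Summable t → ∀ F : Finset ι,
      ‖∑' i, f i - ∑ i ∈ F, f i‖ ≤ ∑' i, t i - ∑ i ∈ F, t i := by
    intro f t hft hs F
    have hfs : Summable f := hs.of_norm_bounded hft
    rw [← hfs.sum_add_tsum_subtype_compl F, ← hs.sum_add_tsum_subtype_compl F, add_sub_cancel_left,
      add_sub_cancel_left]
    exact tsum_of_norm_bounded (hs.subtype _).hasSum fun i => hft i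
  rw [Metric.tendsto_nhds]
  intro ε hε
  -- F carries almost all the limit mass. Eventually ∑_F t_k also exceeds a − ε/4, and the total is
  -- at most a, so the tails outside F are below ε/4.
  obtain ⟨F, hF⟩ : ∃ F : Finset ι, a - ε / 4 < ∑ i ∈ F, t' i :=
    (ht'.eventually (lt_mem_nhds (by linarith))).exists
  have h1 := tendsto_finsetSum F fun i _ => ht i
  have h2 := tendsto_finsetSum F fun i _ => hf i
  filter_upwards [h1.eventually (lt_mem_nhds hF),
    (Metric.tendsto_nhds.1 h2) (ε / 4) (by linarith)] with k hk1 hk2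
  have e1 := htail (f k) (t k) (hft k) (hts k) F
  have e2 := htail f' t' hft' ht'.summable F
  rw [ht'.tsum_eq] at e2
  rw [dist_eq_norm] at hk2 ⊢
  calc ‖∑' i, f k i - ∑' i, f' i‖
      = ‖(∑' i, f k i - ∑ i ∈ F, f k i) + (∑ i ∈ F, f k i - ∑ i ∈ F, f' i)
        - (∑' i, f' i - ∑ i ∈ F, f' i)‖ := by congr 1; ring
    _ ≤ ‖∑' i, f k i - ∑ i ∈ F, f k i‖ + ‖∑ i ∈ F, f k i - ∑ i ∈ F, f' i‖
        + ‖∑' i, f' i - ∑ i ∈ F, f' i‖ := (norm_sub_le _ _).trans (by gcongr; exact norm_add_le _ _)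
    _ < ε := by linarith [hta k]

/-! ### Compressions to the span of a finite orthonormal family. -/

section Compression

variable {H : Type*} [NormedAddCommGroup H] [InnerProductSpace ℂ H]

/-- The orthogonal projection on the span of the orthonormal family `g`. -/
noncomputable def projOn {n : ℕ} (g : Fin n → H) : H →L[ℂ] H :=
  ∑ i, InnerProductSpace.rankOne ℂ (g i) (g i)

theorem projOn_apply {n : ℕ} (g : Fin n → H) (x : H) :
    projOn g x = ∑ i, ⟪g i, x⟫_ℂ • g i := by
  simp [projOn]

theorem inner_projOn {n : ℕ} (g : Fin n → H) (x y : H) :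
    ⟪x, projOn g y⟫_ℂ = ⟪projOn g x, y⟫_ℂ := by
  simp only [projOn_apply, inner_sum, sum_inner, inner_smul_left, inner_smul_right, inner_conj_symm]
  exact Finset.sum_congr rfl fun i _ => mul_comm _ _

theorem projOn_self {n : ℕ} {g : Fin n → H} (hg : Orthonormal ℂ g) (j : Fin n) :
    projOn g (g j) = g j := by
  classical
  simp [projOn_apply, orthonormal_iff_ite.1 hg]

theorem inner_compress {n : ℕ} {g : Fin n → H} (hg : Orthonormal ℂ g) (T : H →L[ℂ] H)
    (i j : Fin n) : ⟪g i, (projOn g ∘L T ∘L projOn g) (g j)⟫_ℂ = ⟪g i, T (g j)⟫_ℂ := by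
  simp only [ContinuousLinearMap.comp_apply]
  rw [inner_projOn, projOn_self hg, projOn_self hg]

theorem isPositive_compress {n : ℕ} (g : Fin n → H) {T : H →L[ℂ] H} (hT : T.IsPositive) :
    (projOn g ∘L T ∘L projOn g).IsPositive :=
  isPositive_of_inner_nonneg fun x => by
    simp only [ContinuousLinearMap.comp_apply]
    rw [inner_projOn]
    exact hT.inner_nonneg_right _

/-- A compression whose matrix is close to the identity is almost dominated by the identity. -/
theorem re_inner_compress_le {n : ℕ} {g : Fin n → H} (hg : Orthonormal ℂ g) (T : H →L[ℂ] H)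
    (x : H) : (⟪x, (projOn g ∘L T ∘L projOn g) x⟫_ℂ).re ≤
      (1 + ∑ i, ∑ j, ‖⟪g i, T (g j)⟫_ℂ - ⟪g i, g j⟫_ℂ‖) * ‖x‖ ^ 2 := by
  classical
  have hb : ∀ i, ‖⟪g i, x⟫_ℂ‖ ≤ ‖x‖ := fun i => by
    simpa [hg.1 i] using norm_inner_le_norm (𝕜 := ℂ) (g i) x
  -- The matrix of T is split into the identity, bounded by Bessel, and an error bounded entry by
  -- entry.
  have h1 : ⟪x, (projOn g ∘L T ∘L projOn g) x⟫_ℂ = ((∑ i, ‖⟪g i, x⟫_ℂ‖ ^ 2 : ℝ) : ℂ) +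
      ∑ i, ∑ j, (starRingEnd ℂ) ⟪g i, x⟫_ℂ * ⟪g j, x⟫_ℂ *
        (⟪g i, T (g j)⟫_ℂ - ⟪g i, g j⟫_ℂ) := by
    simp only [ContinuousLinearMap.comp_apply]
    rw [inner_projOn]
    simp only [projOn_apply, map_sum, map_smul, inner_sum, sum_inner, inner_smul_left,
      inner_smul_right, mul_sub, Finset.sum_sub_distrib, orthonormal_iff_ite.1 hg]
    simp only [mul_ite, mul_one, mul_zero, Finset.sum_ite_eq, Finset.mem_univ, if_true]
    have : ∀ i, (starRingEnd ℂ) ⟪g i, x⟫_ℂ * ⟪g i, x⟫_ℂ = ((‖⟪g i, x⟫_ℂ‖ ^ 2 : ℝ) : ℂ) := fun i => by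
      rw [mul_comm, Complex.mul_conj, Complex.normSq_eq_norm_sq]
    simp only [this, Complex.ofReal_sum]
    rw [add_sub_cancel]
    simp only [Finset.mul_sum]
    rw [Finset.sum_comm]
    exact Finset.sum_congr rfl fun i _ => Finset.sum_congr rfl fun j _ => by ring
  rw [h1, Complex.add_re, Complex.ofReal_re, add_mul, one_mul, Finset.sum_mul]
  refine add_le_add (hg.sum_inner_products_le x) ((Complex.re_le_norm _).trans ?_)
  refine (norm_sum_le _ _).trans (Finset.sum_le_sum fun i _ => ?_)
  rw [Finset.sum_mul]
  refine (norm_sum_le _ _).trans (Finset.sum_le_sum fun j _ => ?_)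
  rw [norm_mul, norm_mul, RCLike.norm_conj, mul_comm, sq]
  gcongr
  · exact hb i
  · exact hb j

end Compression

/-! ### From separable states to finite separable operators. -/

section SeparableApproximation

variable {HB HA : Type*}
  [NormedAddCommGroup HB] [InnerProductSpace ℂ HB] [CompleteSpace HB]
  [NormedAddCommGroup HA] [InnerProductSpace ℂ HA] [CompleteSpace HA] {ι : Type*}

theorem mem_finiteSeparable_of_fintype {κ : Type*} [Fintype κ] {ρ : κ → HB →L[ℂ] HB}
    {M : κ → HA →L[ℂ] HA} (hρ : ∀ k, IsState (ρ k)) (hM : ∀ k, (M k).IsPositive)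
    (hsum : ∑ k, M k = 1) : ∑ k, tensorOp (ρ k) (M k) ∈ finiteSeparable HB HA := by
  let e := (Fintype.equivFin κ).symm
  refine ⟨Fintype.card κ, fun i => ρ (e i), fun i => M (e i), fun i => hρ _, fun i => hM _, ?_, ?_⟩
  · rw [← hsum]; exact e.sum_comp M
  · exact (e.sum_comp fun k => tensorOp (ρ k) (M k)).symm

/-- The matrix element `⟨a|Tr_B R|a'⟩`. -/
noncomputable def partialTraceElem (R : HTensor HB HA →L[ℂ] HTensor HB HA) (a a' : HA) : ℂ :=
  ∑' m, ⟪pv (someBasis HB m) a, R (pv (someBasis HB m) a')⟫_ℂ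

theorem hasSum_partialTrace_decomposition {N : ℕ} {p : Fin N → ℝ} {ρ : Fin N → HB →L[ℂ] HB}
    {σ : Fin N → HA →L[ℂ] HA} (hρ : ∀ α, IsState (ρ α)) (a a' : HA) :
    HasSum (fun m => ⟪pv (someBasis HB m) a,
      (∑ α, (p α : ℂ) • tensorOp (ρ α) (σ α)) (pv (someBasis HB m) a')⟫_ℂ)
      ⟪a, (∑ α, (p α : ℂ) • σ α) a'⟫_ℂ := by
  simp only [sum_apply, smul_apply, inner_sum, inner_smul_right, inner_tensorOp_pv]
  refine hasSum_sum fun α _ => ?_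
  simpa using (((hρ α).hasSum_inner (someBasis HB)).mul_right ⟪a, σ α a'⟫_ℂ).mul_left (p α : ℂ)

/-- Turning a separable state with `Tr_B R ≈ P / n` into a finite separable operator. -/
theorem exists_finiteSeparable_of_convexHull {n : ℕ} {g : Fin n → HA} (hg : Orthonormal ℂ g)
    {R : HTensor HB HA →L[ℂ] HTensor HB HA} (hR : R ∈ convexHull ℝ (productStates HB HA))
    {ρ₀ : HB →L[ℂ] HB} (hρ₀ : IsState ρ₀) :
    ∃ Ω ∈ finiteSeparable HB HA, ∀ ψ ψ' i j, ⟪pv ψ (g i), Ω (pv ψ' (g j))⟫_ℂ =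
      (((1 + ∑ i, ∑ j, ‖n * partialTraceElem R (g i) (g j) - ⟪g i, g j⟫_ℂ‖)⁻¹ : ℝ) : ℂ) *
        (n * ⟪pv ψ (g i), R (pv ψ' (g j))⟫_ℂ) + ⟪ψ, ρ₀ ψ'⟫_ℂ * (⟪g i, g j⟫_ℂ -
          (((1 + ∑ i, ∑ j, ‖n * partialTraceElem R (g i) (g j) - ⟪g i, g j⟫_ℂ‖)⁻¹ : ℝ) : ℂ) *
            (n * partialTraceElem R (g i) (g j))) := by
  obtain ⟨N, p, ρ, σ, hp, -, hρ, hσ, rfl⟩ := exists_decomposition hR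
  have hD : ∀ a a', partialTraceElem (∑ α, (p α : ℂ) • tensorOp (ρ α) (σ α)) a a' =
      ⟪a, (∑ α, (p α : ℂ) • σ α) a'⟫_ℂ := fun a a' =>
    (hasSum_partialTrace_decomposition hρ a a').tsum_eq
  set S : HA →L[ℂ] HA := (n : ℂ) • ∑ α, (p α : ℂ) • σ α with hSdef
  have hS : ∀ a a', n * partialTraceElem (∑ α, (p α : ℂ) • tensorOp (ρ α) (σ α)) a a' =
      ⟪a, S a'⟫_ℂ := fun a a' => by
    rw [hD, hSdef, smul_apply, inner_smul_right]
  simp only [hS]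
  -- γ measures how far the matrix of n Tr_B R is from the identity. Scaling by c = 1/(1 + γ) makes
  -- the compressed operators M_α sum to at most I.
  set γ := ∑ i, ∑ j, ‖⟪g i, S (g j)⟫_ℂ - ⟪g i, g j⟫_ℂ‖ with hγ
  have hγ0 : 0 ≤ γ := Finset.sum_nonneg fun i _ => Finset.sum_nonneg fun j _ => norm_nonneg _
  set c : ℝ := (1 + γ)⁻¹ with hc
  have hc0 : 0 ≤ c := by positivity
  let M : Fin N → HA →L[ℂ] HA := fun α =>
    ((c * n * p α : ℝ) : ℂ) • (projOn g ∘L σ α ∘L projOn g)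
  have hM : ∀ α, (M α).IsPositive := fun α =>
    (isPositive_compress g (hσ α).isPositive).smul_of_nonneg (by
      have := hp α
      exact_mod_cast (by positivity : 0 ≤ c * n * p α))
  have hMsum : ∑ α, M α = (c : ℂ) • (projOn g ∘L S ∘L projOn g) := by
    ext x
    simp only [M, hSdef, sum_apply, smul_apply, ContinuousLinearMap.comp_apply, map_smul, map_sum,
      Finset.smul_sum, smul_smul]
    refine Finset.sum_congr rfl fun α _ => ?_
    push_cast
    rw [mul_assoc]
  have hrest : (1 - ∑ α, M α).IsPositive := by
    refine isPositive_of_inner_nonneg fun x => ?_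
    have hpos : (∑ α, M α).IsPositive := ContinuousLinearMap.isPositive_sum _ fun α _ => hM α
    have h0 := Complex.le_def.1 (hpos.inner_nonneg_right x)
    have h1 : (⟪x, (∑ α, M α) x⟫_ℂ).re ≤ ‖x‖ ^ 2 := by
      rw [hMsum, smul_apply, inner_smul_right, Complex.re_ofReal_mul]
      calc c * _ ≤ c * ((1 + γ) * ‖x‖ ^ 2) :=
            mul_le_mul_of_nonneg_left (re_inner_compress_le hg S x) hc0
        _ = ‖x‖ ^ 2 := by rw [hc, ← mul_assoc, inv_mul_cancel₀ (by positivity), one_mul]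
    rw [sub_apply, inner_sub_right, one_apply_eq_self, Complex.le_def]
    constructor
    · rw [Complex.sub_re, Complex.zero_re, sub_nonneg]
      refine h1.trans_eq ?_
      rw [inner_self_eq_norm_sq_to_K]
      norm_cast
    · have : (⟪x, x⟫_ℂ).im = 0 := inner_self_im (𝕜 := ℂ) x
      rw [Complex.sub_im, ← h0.2, this]
      simp
  -- The extra index `none` carries ρ₀ ⊗ (I − ∑ M_α), completing the resolution of the identity; on
  -- the span of g this term is small when γ is.
  have hmem := mem_finiteSeparable_of_fintype (κ := Option (Fin N))
    (ρ := fun o => o.elim ρ₀ ρ) (M := fun o => o.elim (1 - ∑ α, M α) M)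
    (by rintro (_ | α); exacts [hρ₀, hρ α]) (by rintro (_ | α); exacts [hrest, hM α])
    (by rw [Fintype.sum_option]; simp)
  refine ⟨_, hmem, fun ψ ψ' i j => ?_⟩
  rw [Fintype.sum_option, add_apply, inner_add_right, add_comm]
  congr 1
  · simp only [Option.elim, sum_apply, inner_sum, inner_tensorOp_pv, M, smul_apply,
      inner_smul_right, inner_compress hg, Finset.mul_sum]
    refine Finset.sum_congr rfl fun α _ => ?_
    push_cast
    ring
  · simp only [Option.elim, inner_tensorOp_pv, hMsum, sub_apply, one_apply_eq_self,
      inner_sub_right, smul_apply, inner_smul_right, inner_compress hg]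

end SeparableApproximation

/-! ### Entanglement-breaking channels have separable CJ operators. -/

section EntanglementBreakingCJ

variable {HB HA : Type*}
  [NormedAddCommGroup HB] [InnerProductSpace ℂ HB] [CompleteSpace HB]
  [NormedAddCommGroup HA] [InnerProductSpace ℂ HA] [CompleteSpace HA] {ι : Type*}

/-- If separable states converge weakly to a state `R` with `Tr_B R = P / n`, then so do their
partial traces. -/
theorem tendsto_partialTraceElem {n : ℕ} {g : Fin n → HA} (hg : Orthonormal ℂ g)
    {R : HTensor HB HA →L[ℂ] HTensor HB HA} (hR : R.IsPositive)
    (hn : n ≠ 0) (htr : ∀ i j, HasSum (fun m => ⟪pv (someBasis HB m) (g i),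
      R (pv (someBasis HB m) (g j))⟫_ℂ) ((n : ℂ)⁻¹ * ⟪g i, g j⟫_ℂ))
    {l : Filter (convexHull ℝ (productStates HB HA))}
    (hl : Tendsto (fun k : convexHull ℝ (productStates HB HA) =>
      ContinuousLinearMapWOT.ofCLM (k : HTensor HB HA →L[ℂ] HTensor HB HA)) l
      (𝓝 (ContinuousLinearMapWOT.ofCLM R))) (i j : Fin n) :
    Tendsto (fun k : convexHull ℝ (productStates HB HA) =>
      partialTraceElem (k : HTensor HB HA →L[ℂ] HTensor HB HA) (g i) (g j)) l
      (𝓝 ((n : ℂ)⁻¹ * ⟪g i, g j⟫_ℂ)) := by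
  rw [ContinuousLinearMapWOT.tendsto_iff_forall_inner_apply_tendsto] at hl
  -- Cauchy–Schwarz for a positive operator: each matrix element is dominated by the total diagonal
  -- weight at m.
  have hdom : ∀ {T : HTensor HB HA →L[ℂ] HTensor HB HA}, T.IsPositive → ∀ m,
      ‖⟪pv (someBasis HB m) (g i), T (pv (someBasis HB m) (g j))⟫_ℂ‖ ≤
        ∑ i, (⟪pv (someBasis HB m) (g i), T (pv (someBasis HB m) (g i))⟫_ℂ).re := by
    intro T hT m
    have h0 : ∀ i, 0 ≤ (⟪pv (someBasis HB m) (g i), T (pv (someBasis HB m) (g i))⟫_ℂ).re :=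
      fun i => (Complex.le_def.1 (hT.inner_nonneg_right _)).1
    have h1 := fun i => Finset.single_le_sum (fun i _ => h0 i) (Finset.mem_univ i)
    exact (norm_inner_le_of_isPositive hT _ _).trans (by linarith [h1 i, h1 j])
  -- Approximants have mass at most 1 over the span of g, and the limit has mass exactly 1 (`hlim`),
  -- so no mass escapes along the infinite basis of H_B.
  have hmass : ∀ k : convexHull ℝ (productStates HB HA), ∃ a ≤ (1 : ℝ), HasSum (fun m =>
      ∑ i, (⟪pv (someBasis HB m) (g i), (k : HTensor HB HA →L[ℂ] HTensor HB HA)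
        (pv (someBasis HB m) (g i))⟫_ℂ).re) a := by
    rintro ⟨k, hk⟩
    obtain ⟨N, p, ρ, σ, hp, hp1, hρ, hσ, rfl⟩ := exists_decomposition hk
    refine ⟨_, ?_, hasSum_sum fun i _ =>
      (hasSum_partialTrace_decomposition hρ (g i) (g i)).mapL Complex.reCLM⟩
    simp only [Complex.reCLM_apply, sum_apply, smul_apply, inner_sum, inner_smul_right,
      Complex.re_sum, Complex.re_ofReal_mul]
    rw [Finset.sum_comm, ← hp1]
    simp only [← Finset.mul_sum]
    exact Finset.sum_le_sum fun α _ =>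
      mul_le_of_le_one_right (hp α) ((hσ α).sum_inner_le_one hg Finset.univ)
  have hlim : HasSum (fun m => ∑ i, (⟪pv (someBasis HB m) (g i),
      R (pv (someBasis HB m) (g i))⟫_ℂ).re) 1 := by
    have h := hasSum_sum (s := Finset.univ) fun i _ => (htr i i).mapL Complex.reCLM
    have hval : ∑ i, Complex.reCLM ((n : ℂ)⁻¹ * ⟪g i, g i⟫_ℂ) = 1 := by
      simp only [inner_self_eq_norm_sq_to_K, hg.1, Complex.reCLM_apply]
      norm_num
      exact mul_inv_cancel₀ (by exact_mod_cast hn)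
    rw [hval] at h
    exact h
  rw [← (htr i j).tsum_eq]
  refine tendsto_tsum_of_tendsto_dominating (a := 1) (fun m => hl _ _) (fun m => ?_)
    (fun k => hdom (isPositive_of_mem_convexHull k.2)) (hdom hR)
    (fun k => (hmass k).choose_spec.2.summable) (fun k => ?_) hlim
  · exact tendsto_finsetSum _ fun i _ => (Complex.continuous_re.tendsto _).comp (hl _ _)
  · rw [(hmass k).choose_spec.2.tsum_eq]
    exact (hmass k).choose_spec.1

variable (b : HilbertBasis ι ℂ HA)

/-- The maximally entangled vector over the orthonormal family `g`. -/
noncomputable def entangledVec {n : ℕ} (g : Fin n → HA) : HTensor HA HA :=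
  ((√(n : ℝ))⁻¹ : ℂ) • ∑ i, pv (conjVec b (g i)) (g i)

theorem sqrt_inv_mul_self (n : ℕ) : ((√(n : ℝ))⁻¹ : ℂ) * ((√(n : ℝ))⁻¹ : ℂ) = (n : ℂ)⁻¹ := by
  rw [← mul_inv, ← Complex.ofReal_mul, Real.mul_self_sqrt n.cast_nonneg, Complex.ofReal_natCast]

variable {b}

theorem adjoint_tensorRight_entangledVec {n : ℕ} {g : Fin n → HA} (hg : Orthonormal ℂ g)
    (i : Fin n) : adjoint (tensorRight (g i)) (entangledVec b g) =
      ((√(n : ℝ))⁻¹ : ℂ) • conjVec b (g i) := by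
  classical
  refine ext_inner_left ℂ fun z => ?_
  rw [ContinuousLinearMap.adjoint_inner_right, tensorRight_apply, entangledVec, inner_smul_right,
    inner_smul_right, inner_sum]
  simp [inner_pv, orthonormal_iff_ite.1 hg]

theorem norm_entangledVec {n : ℕ} (hn : n ≠ 0) {g : Fin n → HA} (hg : Orthonormal ℂ g) :
    ‖entangledVec b g‖ = 1 := by
  classical
  have h : ⟪entangledVec b g, entangledVec b g⟫_ℂ = 1 := by
    simp only [entangledVec, inner_smul_left, inner_smul_right, sum_inner, inner_sum, inner_pv,
      inner_conjVec_conjVec, orthonormal_iff_ite.1 hg]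
    simp only [mul_ite, mul_one, mul_zero, Finset.sum_ite_eq', Finset.mem_univ, if_true,
      Finset.sum_const, Finset.card_univ, Fintype.card_fin, nsmul_eq_mul, map_inv₀,
      Complex.conj_ofReal]
    rw [mul_left_comm, sqrt_inv_mul_self, mul_inv_cancel₀]
    exact_mod_cast hn
  rw [inner_self_eq_norm_sq_to_K] at h
  have h' : ‖entangledVec b g‖ ^ 2 = 1 := Complex.ofReal_injective (by simpa using h)
  exact (pow_eq_one_iff_of_nonneg (norm_nonneg _) two_ne_zero).1 h'

/-- The conjugate in `entangledVec` matches the one in the CJ form: matrix elements of the amplified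
entangled state are those of the CJ form divided by n. -/
theorem slice_entangledVec {n : ℕ} {g : Fin n → HA} (hg : Orthonormal ℂ g) (i j : Fin n) :
    slice (ketbra (entangledVec b g) (entangledVec b g)) (g i) (g j) =
      (n : ℂ)⁻¹ • ketbra (conjVec b (g i)) (conjVec b (g j)) := by
  refine Subtype.ext (ContinuousLinearMap.ext fun z => ?_)
  have h1 : ⟪entangledVec b g, tensorRight (g j) z⟫_ℂ =
      ((√(n : ℝ))⁻¹ : ℂ) * ⟪conjVec b (g j), z⟫_ℂ := by
    rw [← ContinuousLinearMap.adjoint_inner_left, adjoint_tensorRight_entangledVec hg,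
      inner_smul_left, map_inv₀, Complex.conj_ofReal]
  simp only [slice, ketbra, ContinuousLinearMap.comp_apply, InnerProductSpace.rankOne_apply, h1,
    map_smul, adjoint_tensorRight_entangledVec hg, Submodule.coe_smul, smul_apply, smul_smul]
  rw [← sqrt_inv_mul_self]
  congr 1
  ring

theorem exists_orthonormal_rep_finset {E F : Type*} [NormedAddCommGroup E] [InnerProductSpace ℂ E]
    [NormedAddCommGroup F] [InnerProductSpace ℂ F] [Nontrivial F] (t : Finset (E ⊗[ℂ] F)) :
    ∃ (n : ℕ) (g : Fin n → F), n ≠ 0 ∧ Orthonormal ℂ g ∧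
      ∀ x ∈ t, ∃ e : Fin n → E, x = ∑ i, e i ⊗ₜ[ℂ] g i := by
  classical
  choose s hs using fun x : E ⊗[ℂ] F => TensorProduct.exists_finset x
  obtain ⟨f₀, hf₀⟩ := exists_ne (0 : F)
  -- The nonzero vector f₀ keeps the span nontrivial, so that n ≠ 0 and division by n makes sense.
  let u : Finset F := insert f₀ (t.biUnion fun x => (s x).image Prod.snd)
  let V : Submodule ℂ F := Submodule.span ℂ (u : Set F)
  have : FiniteDimensional ℂ V := inferInstance
  have hf₀V : f₀ ∈ V := Submodule.subset_span (by simp [u])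
  have : Nontrivial V := ⟨⟨f₀, hf₀V⟩, 0, fun h => hf₀ (congrArg Subtype.val h)⟩
  let W := stdOrthonormalBasis ℂ V
  refine ⟨_, fun i => (W i : F), Module.finrank_pos.ne',
    W.orthonormal.comp_linearIsometry V.subtypeₗᵢ, fun x hx => ?_⟩
  refine ⟨fun i => ∑ p ∈ s x, ⟪(W i : F), p.2⟫_ℂ • p.1, ?_⟩
  have key : ∀ p ∈ s x, p.2 = ∑ i, ⟪(W i : F), p.2⟫_ℂ • (W i : F) := by
    intro p hp
    have hmem : p.2 ∈ V := Submodule.subset_span (by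
      simp only [u, Finset.coe_insert, Finset.coe_biUnion]
      refine Or.inr (Set.mem_biUnion hx ?_)
      simpa using ⟨p.1, hp⟩)
    have := congrArg Subtype.val (W.sum_repr' ⟨p.2, hmem⟩)
    simp only [Submodule.coe_inner, AddSubmonoidClass.coe_finsetSum, Submodule.coe_smul] at this
    exact this.symm
  calc x = ∑ p ∈ s x, p.1 ⊗ₜ[ℂ] p.2 := hs x
    _ = ∑ p ∈ s x, ∑ i, (⟪(W i : F), p.2⟫_ℂ • p.1) ⊗ₜ[ℂ] (W i : F) := by
        refine Finset.sum_congr rfl fun p hp => ?_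
        conv_lhs => rw [key p hp]
        simp [TensorProduct.tmul_sum, TensorProduct.smul_tmul]
    _ = _ := by
        rw [Finset.sum_comm]
        simp [TensorProduct.sum_tmul]

variable {Φ : TraceClass HA →ₗ[ℂ] TraceClass HB}

/-- Entanglement breaking is applied to the maximally entangled state over g. The separable
approximants of its image are turned into finite separable operators, whose corrections vanish since
their partial traces converge. -/
theorem exists_net_tendsto_cjForm (hΦ : IsChannel b Φ) (hEB : IsEntanglementBreaking Φ) {n : ℕ}
    (hn : n ≠ 0) {g : Fin n → HA} (hg : Orthonormal ℂ g) :
    ∃ (l : Filter (convexHull ℝ (productStates HB HA)))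
      (S : convexHull ℝ (productStates HB HA) → HTensor HB HA →L[ℂ] HTensor HB HA),
      l.NeBot ∧ (∀ k, S k ∈ finiteSeparable HB HA) ∧ ∀ ψ ψ' i j,
        Tendsto (fun k => ⟪pv ψ (g i), S k (pv ψ' (g j))⟫_ℂ) l
          (𝓝 (cjForm b Φ (ψ ⊗ₜ g i) (ψ' ⊗ₜ g j))) := by
  obtain ⟨R, hRamp, hRst, hRcl⟩ := hEB (ketbra (entangledVec b g) (entangledVec b g))
    (isState_ketbra (norm_entangledVec hn hg))
  obtain ⟨l, hl, ht⟩ := exists_net_of_mem_closure hRcl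
  have hn0 : (n : ℂ) ≠ 0 := by exact_mod_cast hn
  have hRel : ∀ ψ ψ' i j, ⟪pv ψ (g i), R (pv ψ' (g j))⟫_ℂ =
      (n : ℂ)⁻¹ * cjForm b Φ (ψ ⊗ₜ g i) (ψ' ⊗ₜ g j) := fun ψ ψ' i j => by
    rw [hRamp, slice_entangledVec hg, map_smul, Submodule.coe_smul, smul_apply, inner_smul_right,
      cjForm_tmul]
  have htr : ∀ i j, HasSum (fun m => ⟪pv (someBasis HB m) (g i),
      R (pv (someBasis HB m) (g j))⟫_ℂ) ((n : ℂ)⁻¹ * ⟪g i, g j⟫_ℂ) := fun i j => by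
    have h := (Φ (ketbra (conjVec b (g i)) (conjVec b (g j)))).2.hasSum_trace (someBasis HB)
    rw [hΦ.trace_ketbra, inner_conjVec_conjVec] at h
    simpa only [hRel, cjForm_tmul] using h.mul_left (n : ℂ)⁻¹
  have hD := tendsto_partialTraceElem hg hRst.isPositive hn htr ht
  obtain ⟨i₀⟩ : Nonempty (Fin n) := ⟨⟨0, Nat.pos_of_ne_zero hn⟩⟩
  -- Any state of H_B would do as filler; a channel image supplies one.
  have hρ₀ := hΦ.map_state _ (isState_ketbra (hg.1 i₀))
  choose S hS hSel using fun k : convexHull ℝ (productStates HB HA) =>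
    exists_finiteSeparable_of_convexHull hg k.2 hρ₀
  refine ⟨l, S, hl, hS, fun ψ ψ' i j => ?_⟩
  have hnD : ∀ i j, Tendsto (fun k : convexHull ℝ (productStates HB HA) =>
      n * partialTraceElem (k : HTensor HB HA →L[ℂ] HTensor HB HA) (g i) (g j)) l
      (𝓝 ⟪g i, g j⟫_ℂ) := fun i j => by
    have := (hD i j).const_mul (n : ℂ)
    rwa [mul_inv_cancel_left₀ hn0] at this
  have hc : Tendsto (fun k : convexHull ℝ (productStates HB HA) => (((1 + ∑ i, ∑ j,
      ‖n * partialTraceElem (k : HTensor HB HA →L[ℂ] HTensor HB HA) (g i) (g j) -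
        ⟪g i, g j⟫_ℂ‖)⁻¹ : ℝ) : ℂ)) l (𝓝 1) := by
    have h1 : Tendsto (fun k : convexHull ℝ (productStates HB HA) => ∑ i, ∑ j,
      ‖n * partialTraceElem (k : HTensor HB HA →L[ℂ] HTensor HB HA) (g i) (g j) -
        ⟪g i, g j⟫_ℂ‖) l (𝓝 (∑ i, ∑ j, ‖⟪g i, g j⟫_ℂ - ⟪g i, g j⟫_ℂ‖)) :=
      tendsto_finsetSum _ fun i _ => tendsto_finsetSum _ fun j _ =>
        ((hnD i j).sub tendsto_const_nhds).norm
    have h2 := (h1.const_add 1).inv₀ (by simp)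
    have h3 := (Complex.continuous_ofReal.tendsto _).comp h2
    simpa [Function.comp_def] using h3
  have hR' := (ContinuousLinearMapWOT.tendsto_iff_forall_inner_apply_tendsto.1 ht)
    (pv ψ' (g j)) (pv ψ (g i))
  have hfin := (hc.mul (hR'.const_mul (n : ℂ))).add
    ((tendsto_const_nhds (x := ⟪g i, g j⟫_ℂ)).sub (hc.mul (hnD i j)) |>.const_mul
      ⟪ψ, (Φ (ketbra (g i₀) (g i₀)) : HB →L[ℂ] HB) ψ'⟫_ℂ)
  have hval : 1 * (n * ⟪pv ψ (g i), R (pv ψ' (g j))⟫_ℂ) +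
      ⟪ψ, (Φ (ketbra (g i₀) (g i₀)) : HB →L[ℂ] HB) ψ'⟫_ℂ *
        (⟪g i, g j⟫_ℂ - 1 * ⟪g i, g j⟫_ℂ) = cjForm b Φ (ψ ⊗ₜ g i) (ψ' ⊗ₜ g j) := by
    rw [hRel, mul_inv_cancel_left₀ hn0]
    ring
  rw [← hval]
  simp only [hSel]
  exact hfin

/-- The Choi-Jamiolkowski form of an entanglement-breaking channel is given by a separable
operator. -/
theorem exists_separableOperator_of_entanglementBreaking (hΦ : IsChannel b Φ)
    (hEB : IsEntanglementBreaking Φ) :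
    ∃ Ω ∈ separableOperators HB HA, IsCJOperator b Φ Ω := by
  suffices h : ∃ Ω : HTensor HB HA →L[ℂ] HTensor HB HA, Ω.IsPositive ∧
      ContinuousLinearMapWOT.ofCLM Ω ∈
        closure (ContinuousLinearMapWOT.ofCLM '' finiteSeparable HB HA) ∧
      ∀ x y : HB ⊗[ℂ] HA, cjForm b Φ x y = ⟪(x : HTensor HB HA), Ω (y : HTensor HB HA)⟫_ℂ by
    obtain ⟨Ω, h1, h2, h3⟩ := h
    exact ⟨Ω, ⟨h1, hΦ.partialTraceEqOne h3, h2⟩, h3⟩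
  -- If H_A = 0 there is no unit vector to entangle; the form is zero and the empty sum is a finite
  -- separable operator.
  cases subsingleton_or_nontrivial HA with
  | inl hA =>
    have h0 : (0 : HTensor HB HA →L[ℂ] HTensor HB HA) ∈ finiteSeparable HB HA :=
      ⟨0, 0, 0, fun α => α.elim0, fun α => α.elim0, ContinuousLinearMap.ext fun x =>
        Subsingleton.elim _ _, by simp⟩
    refine exists_op_of_tendsto_finiteSeparable (l := (atTop : Filter ℕ)) (S := fun _ => 0)
      (fun _ => h0) fun x y => ?_
    have hx : x = 0 := by
      induction x with
      | zero => rfl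
      | tmul ψ a => rw [Subsingleton.elim a 0, TensorProduct.tmul_zero]
      | add x y hx hy => rw [hx, hy, add_zero]
    rw [hx, map_zero, LinearMap.zero_apply, UniformSpace.Completion.coe_zero]
    simp only [inner_zero_left]
    exact tendsto_const_nhds
  | inr hA =>
    -- The family g depends on the vectors tested, so one net for all vectors is indexed by finite
    -- sets of vectors together with a precision.
    have key : ∀ p : Finset (HB ⊗[ℂ] HA) × ℕ, ∃ S ∈ finiteSeparable HB HA, ∀ x ∈ p.1, ∀ y ∈ p.1,
        dist ⟪(x : HTensor HB HA), S (y : HTensor HB HA)⟫_ℂ (cjForm b Φ x y) <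
          1 / ((p.2 : ℝ) + 1) := by
      rintro ⟨t, N⟩
      obtain ⟨n, g, hn, hg, ht⟩ := exists_orthonormal_rep_finset t
      obtain ⟨l, S, hl, hS, hlim⟩ := exists_net_tendsto_cjForm hΦ hEB hn hg
      have hxy : ∀ x ∈ t, ∀ y ∈ t, Tendsto (fun k => ⟪(x : HTensor HB HA), S k y⟫_ℂ) l
          (𝓝 (cjForm b Φ x y)) := by
        intro x hx y hy
        obtain ⟨e, rfl⟩ := ht x hx
        obtain ⟨e', rfl⟩ := ht y hy
        simp only [coe_sum, map_sum, LinearMap.sum_apply, sum_inner, inner_sum]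
        exact tendsto_finsetSum _ fun j _ => tendsto_finsetSum _ fun i _ => hlim _ _ _ _
      have hev : ∀ᶠ k in l, ∀ x ∈ t, ∀ y ∈ t,
          dist ⟪(x : HTensor HB HA), S k (y : HTensor HB HA)⟫_ℂ (cjForm b Φ x y) <
            1 / ((N : ℝ) + 1) := by
        rw [eventually_all_finset]
        intro x hx
        rw [eventually_all_finset]
        intro y hy
        exact Metric.tendsto_nhds.1 (hxy x hx y hy) _ Nat.one_div_pos_of_nat
      obtain ⟨k, hk⟩ := hev.exists
      exact ⟨S k, hS k, hk⟩
    choose S hS hSd using key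
    classical
    refine exists_op_of_tendsto_finiteSeparable (l := (atTop : Filter (Finset (HB ⊗[ℂ] HA) × ℕ)))
      hS fun x y => Metric.tendsto_nhds.2 fun ε hε => ?_
    obtain ⟨N, hN⟩ := exists_nat_one_div_lt hε
    filter_upwards [eventually_ge_atTop ({x, y}, N)] with p hp
    refine (hSd p x (hp.1 (by simp)) y (hp.1 (by simp))).trans (lt_of_le_of_lt ?_ hN)
    exact Nat.one_div_le_one_div hp.2

end EntanglementBreakingCJ

/-! ### On states, entrywise convergence implies trace-norm convergence. -/

section TraceNormConvergence

variable {H : Type*} [NormedAddCommGroup H] [InnerProductSpace ℂ H]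

/-- Orthonormal vectors are √2 apart, so balls of radius 1/2 around them are disjoint. -/
theorem countable_of_orthonormal [TopologicalSpace.SeparableSpace H] {κ : Type*} {e : κ → H}
    (he : Orthonormal ℂ e) : Countable κ := by
  have h : (Set.univ : Set κ).PairwiseDisjoint fun k => Metric.ball (e k) (1 / 2) := by
    intro i _ j _ hij
    refine Metric.ball_disjoint_ball ?_
    have h2 : ‖e i - e j‖ ^ 2 = 2 := by
      rw [@norm_sub_sq ℂ, he.1, he.1, he.2 hij]
      norm_num
    rw [dist_eq_norm]
    nlinarith [norm_nonneg (e i - e j)]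
  exact Set.countable_univ_iff.1
    (h.countable_of_isOpen (fun _ _ => Metric.isOpen_ball) fun k _ => ⟨e k, by simp⟩)

variable {κ : Type*} (e : HilbertBasis κ ℂ H) (F : Finset κ)

/-- The orthogonal projection on the span of finitely many basis vectors. -/
noncomputable def basisProj : H →L[ℂ] H :=
  ∑ k ∈ F, InnerProductSpace.rankOne ℂ (e k) (e k)

theorem basisProj_apply (x : H) : basisProj e F x = ∑ k ∈ F, ⟪e k, x⟫_ℂ • e k := by
  simp [basisProj]

theorem basisProj_basis [DecidableEq κ] (i : κ) :
    basisProj e F (e i) = if i ∈ F then e i else 0 := by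
  simp [basisProj_apply, orthonormal_iff_ite.1 e.orthonormal]

variable [CompleteSpace H]

theorem adjoint_basisProj : adjoint (basisProj e F) = basisProj e F := by
  refine ((ContinuousLinearMap.eq_adjoint_iff _ _).2 fun x y => ?_).symm
  simp only [basisProj_apply, inner_sum, sum_inner, inner_smul_left, inner_smul_right,
    inner_conj_symm]
  exact Finset.sum_congr rfl fun i _ => mul_comm _ _

theorem nuclearBound_compress_basisProj (T : H →L[ℂ] H) :
    NuclearBound (basisProj e F ∘L T ∘L basisProj e F)
      (∑ k ∈ F, ∑ l ∈ F, ‖⟪e k, T (e l)⟫_ℂ‖) := by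
  have h : basisProj e F ∘L T ∘L basisProj e F = ∑ k ∈ F, ∑ l ∈ F,
      InnerProductSpace.rankOne ℂ (⟪e k, T (e l)⟫_ℂ • e k) (e l) := by
    ext x
    simp only [ContinuousLinearMap.comp_apply, basisProj_apply, map_sum, map_smul,
      Finset.smul_sum, sum_apply, smul_apply, InnerProductSpace.rankOne_apply, smul_smul]
    rw [Finset.sum_comm]
    exact Finset.sum_congr rfl fun k _ => Finset.sum_congr rfl fun l _ => by rw [mul_comm]
  rw [h]
  refine NuclearBound.sum _ fun k _ => NuclearBound.sum _ fun l _ => ?_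
  simpa [norm_smul, e.orthonormal.1] using
    nuclearBound_rankOne (⟪e k, T (e l)⟫_ℂ • e k) (e l)

/-- A state is close, in trace norm, to its compression by a projection of almost full weight. -/
theorem IsState.nuclearBound_sub_compress {ρ : H →L[ℂ] H} (hρ : IsState ρ) :
    NuclearBound (ρ - basisProj e F ∘L ρ ∘L basisProj e F)
      (2 * √(1 - ∑ k ∈ F, (⟪e k, ρ (e k)⟫_ℂ).re)) := by
  classical
  obtain ⟨A, rfl⟩ := exists_eq_adjoint_comp hρ.isPositive
  have hA : HasSum (fun i => ‖A (e i)‖ ^ 2) 1 :=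
    hasSum_norm_sq_of_trace e (by simpa using hρ.hasSum_inner e)
  have hP : HasSum (fun i => ‖(A ∘L basisProj e F) (e i)‖ ^ 2) (∑ k ∈ F, ‖A (e k)‖ ^ 2) := by
    have : (fun i => ‖(A ∘L basisProj e F) (e i)‖ ^ 2) =
        fun i => if i ∈ F then ‖A (e i)‖ ^ 2 else 0 := by
      ext i
      rw [ContinuousLinearMap.comp_apply, basisProj_basis]
      split_ifs <;> simp
    rw [this]
    have h : HasSum (fun i => if i ∈ F then ‖A (e i)‖ ^ 2 else 0)
        (∑ i ∈ F, if i ∈ F then ‖A (e i)‖ ^ 2 else 0) :=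
      hasSum_sum_of_ne_finset_zero fun i hi => if_neg hi
    rwa [Finset.sum_congr rfl fun i hi => if_pos hi] at h
  have hQ : HasSum (fun i => ‖(A ∘L (1 - basisProj e F)) (e i)‖ ^ 2)
      (1 - ∑ k ∈ F, ‖A (e k)‖ ^ 2) := by
    have : (fun i => ‖(A ∘L (1 - basisProj e F)) (e i)‖ ^ 2) =
        fun i => ‖A (e i)‖ ^ 2 - ‖(A ∘L basisProj e F) (e i)‖ ^ 2 := by
      ext i
      rw [ContinuousLinearMap.comp_apply, ContinuousLinearMap.comp_apply, sub_apply,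
        one_apply_eq_self, basisProj_basis]
      split_ifs <;> simp
    rw [this]
    exact hA.sub hP
  have hle : ∑ k ∈ F, ‖A (e k)‖ ^ 2 ≤ 1 := sum_le_hasSum _ (fun _ _ => by positivity) hA
  have hQadj : adjoint (1 - basisProj e F) = 1 - basisProj e F := by
    rw [map_sub, adjoint_basisProj]
    congr 1
    exact ContinuousLinearMap.adjoint_id
  have h1 := nuclearBound_adjoint_comp e e hQ hA
  have h2 := nuclearBound_adjoint_comp e e hP hQ
  -- ρ − PρP = (1 − P)ρ + Pρ(1 − P): both terms contain the factor A(1 − P), whose squared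
  -- Hilbert–Schmidt norm is the missing weight.
  have hsplit : adjoint A ∘L A - basisProj e F ∘L (adjoint A ∘L A) ∘L basisProj e F =
      adjoint (A ∘L (1 - basisProj e F)) ∘L A +
        adjoint (A ∘L basisProj e F) ∘L (A ∘L (1 - basisProj e F)) := by
    ext x
    simp only [ContinuousLinearMap.adjoint_comp, hQadj, adjoint_basisProj, sub_apply, add_apply,
      ContinuousLinearMap.comp_apply, one_apply_eq_self, map_sub]
    abel
  rw [hsplit]
  simp only [inner_adjoint_comp_self, Complex.ofReal_re]
  refine (h1.add h2).mono ?_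
  rw [Real.sqrt_one, mul_one, two_mul]
  gcongr
  exact mul_le_of_le_one_left (Real.sqrt_nonneg _) (Real.sqrt_le_one.2 hle)

/-- On the states, convergence of the matrix elements implies convergence in trace norm. -/
theorem tendsto_traceNorm_of_matrixElements {α : Type*} {l : Filter α} {ρ : H →L[ℂ] H}
    {σ : α → H →L[ℂ] H} (hρ : IsState ρ) (hσ : ∀ a, IsState (σ a))
    (h : ∀ k k', Tendsto (fun a => ⟪e k, σ a (e k')⟫_ℂ) l (𝓝 ⟪e k, ρ (e k')⟫_ℂ)) :
    Tendsto (fun a => traceNorm (ρ - σ a)) l (𝓝 0) := by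
  let m : (H →L[ℂ] H) → Finset κ → ℝ := fun T F => ∑ k ∈ F, (⟪e k, T (e k)⟫_ℂ).re
  -- A finite block plus the tails of ρ and of σ_a. For fixed F this tends to 4√(1 − m ρ F), so F is
  -- chosen first.
  let B : Finset κ → α → ℝ := fun F a => ∑ k ∈ F, ∑ k' ∈ F, ‖⟪e k, (ρ - σ a) (e k')⟫_ℂ‖ +
    2 * √(1 - m ρ F) + 2 * √(1 - m (σ a) F)
  have hB : ∀ F a, traceNorm (ρ - σ a) ≤ B F a := fun F a => by
    have h1 := ((nuclearBound_compress_basisProj e F (ρ - σ a)).add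
      (hρ.nuclearBound_sub_compress e F)).add ((hσ a).nuclearBound_sub_compress e F).neg
    have h2 : basisProj e F ∘L (ρ - σ a) ∘L basisProj e F +
        (ρ - basisProj e F ∘L ρ ∘L basisProj e F) +
        -(σ a - basisProj e F ∘L σ a ∘L basisProj e F) = ρ - σ a := by
      ext x
      simp only [sub_apply, add_apply, neg_apply, ContinuousLinearMap.comp_apply, map_sub]
      abel
    rw [h2] at h1
    exact h1.traceNorm_le
  have hlim : ∀ F, Tendsto (B F) l (𝓝 (4 * √(1 - m ρ F))) := fun F => by
    have h1 : Tendsto (fun a => ∑ k ∈ F, ∑ k' ∈ F, ‖⟪e k, (ρ - σ a) (e k')⟫_ℂ‖) l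
        (𝓝 (∑ k ∈ F, ∑ k' ∈ F, ‖⟪e k, ρ (e k')⟫_ℂ - ⟪e k, ρ (e k')⟫_ℂ‖)) := by
      refine tendsto_finsetSum _ fun k _ => tendsto_finsetSum _ fun k' _ => ?_
      simp only [sub_apply, inner_sub_right]
      exact (tendsto_const_nhds.sub (h k k')).norm
    have h2 : Tendsto (fun a => m (σ a) F) l (𝓝 (m ρ F)) :=
      tendsto_finsetSum _ fun k _ => (Complex.continuous_re.tendsto _).comp (h k k)
    have h3 := (h1.add_const (2 * √(1 - m ρ F))).add
      (((Real.continuous_sqrt.tendsto _).comp (h2.const_sub 1)).const_mul 2)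
    have h4 : ∑ k ∈ F, ∑ k' ∈ F, ‖⟪e k, ρ (e k')⟫_ℂ - ⟪e k, ρ (e k')⟫_ℂ‖ + 2 * √(1 - m ρ F) +
        2 * √(1 - m ρ F) = 4 * √(1 - m ρ F) := by
      simp only [sub_self, norm_zero, Finset.sum_const_zero]
      ring
    rw [h4] at h3
    exact h3
  have hF : Tendsto (fun F => 4 * √(1 - m ρ F)) atTop (𝓝 0) := by
    have h1 : Tendsto (m ρ) atTop (𝓝 1) := by
      have := (hρ.hasSum_inner e).mapL Complex.reCLM
      simpa [HasSum] using this
    have h2 := ((Real.continuous_sqrt.tendsto _).comp (h1.const_sub 1)).const_mul 4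
    simpa [Function.comp_def] using h2
  refine (tendsto_order.2 ⟨fun c hc => .of_forall fun a => hc.trans_le (traceNorm_nonneg _),
    fun c hc => ?_⟩)
  obtain ⟨F, hFc⟩ := (hF.eventually (gt_mem_nhds hc)).exists
  filter_upwards [(hlim F).eventually (gt_mem_nhds hFc)] with a ha
  exact (hB F a).trans_lt ha

end TraceNormConvergence

/-! ### Integration against a POVM. -/

section Integration

variable {HB HA : Type*}
  [NormedAddCommGroup HB] [InnerProductSpace ℂ HB] [CompleteSpace HB]
  [NormedAddCommGroup HA] [InnerProductSpace ℂ HA] [CompleteSpace HA] {ι : Type*}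
  {X : Type*} [MeasurableSpace X]

theorem POVM.empty_eq_zero (M : POVM X HA) : M.toFun ∅ = 0 := by
  refine ContinuousLinearMap.ext fun ψ' => ext_inner_left ℂ fun ψ => ?_
  have h := M.hasSum_iUnion (fun _ => ∅) (fun _ => MeasurableSet.empty)
    (fun _ _ _ => Set.disjoint_empty _) ψ ψ'
  simpa using (summable_const_iff _).1 h.summable

open scoped Classical in
/-- The complex measure `E ↦ ⟨ψ|M(E)|ψ'⟩`. -/
noncomputable def POVM.matrixElement (M : POVM X HA) (ψ ψ' : HA) : VectorMeasure X ℂ where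
  measureOf' E := if MeasurableSet E then ⟪ψ, M.toFun E ψ'⟫_ℂ else 0
  empty' := by simp [M.empty_eq_zero]
  not_measurable' E hE := if_neg hE
  m_iUnion' f hf hd := by
    have h := M.hasSum_iUnion f hf hd ψ ψ'
    simpa only [hf, MeasurableSet.iUnion hf, if_true] using h

theorem POVM.matrixElement_apply (M : POVM X HA) (ψ ψ' : HA) {E : Set X} (hE : MeasurableSet E) :
    M.matrixElement ψ ψ' E = ⟪ψ, M.toFun E ψ'⟫_ℂ := if_pos hE

theorem POVM.sum_preimage_eq_one (M : POVM X HA) {Y : Type*} (s : SimpleFunc X Y) :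
    ∑ r ∈ s.range, M.toFun (s ⁻¹' {r}) = 1 := by
  refine ContinuousLinearMap.ext fun ψ' => ext_inner_left ℂ fun ψ => ?_
  have h := (M.matrixElement ψ ψ').of_biUnion_finset (s := s.range) (f := fun r => s ⁻¹' {r})
    (fun r _ r' _ hr => Set.disjoint_left.2 fun x hx hx' => hr (hx.symm.trans hx'))
    (fun r _ => s.measurableSet_fiber r)
  have hU : ⋃ r ∈ s.range, s ⁻¹' {r} = Set.univ := by
    ext x; simp
  rw [hU, M.matrixElement_apply _ _ MeasurableSet.univ, M.univ_eq_one] at h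
  rw [h, sum_apply, inner_sum]
  exact Finset.sum_congr rfl fun r _ => (M.matrixElement_apply _ _ (s.measurableSet_fiber r)).symm

theorem simpleIntegral_mem_finiteSeparable (b : HilbertBasis ι ℂ HA)
    {s : SimpleFunc X (HB →L[ℂ] HB)} (hs : ∀ x, IsState (s x)) (M : POVM X HA) :
    simpleIntegral b s M ∈ finiteSeparable HB HA := by
  have h := mem_finiteSeparable_of_fintype (κ := s.range) (ρ := fun r => (r : HB →L[ℂ] HB))
    (M := fun r => conjOp b (M.toFun (s ⁻¹' {(r : HB →L[ℂ] HB)})))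
    (fun ⟨r, hr⟩ => by
      obtain ⟨x, rfl⟩ := SimpleFunc.mem_range.1 hr
      exact hs x)
    (fun r => isPositive_conjOp b (M.isPositive _ (s.measurableSet_fiber _)))
    (by
      rw [Finset.sum_coe_sort s.range fun r => conjOp b (M.toFun (s ⁻¹' {r})), ← conjOp_sum,
        M.sum_preimage_eq_one, conjOp_one])
  rwa [Finset.sum_coe_sort s.range fun r => tensorOp r (conjOp b (M.toFun (s ⁻¹' {r})))] at h

/-- A Borel state-valued function is a limit of state-valued simple functions. -/
theorem exists_isSimpleApprox [TopologicalSpace.SeparableSpace HB] {ρ : X → HB →L[ℂ] HB}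
    (hρ : IsBorelStateFun ρ) (M : POVM X HA) : ∃ s, IsSimpleApprox ρ M s := by
  let e := someBasis HB
  have : Countable (someBasisSet HB) := countable_of_orthonormal e.orthonormal
  let P : (someBasisSet HB × someBasisSet HB → ℂ) → (HB →L[ℂ] HB) → Prop := fun f T =>
    IsState T ∧ ∀ p, f p = ⟪e p.1, T (e p.2)⟫_ℂ
  let φ : X → {f // ∃ T, P f T} := fun x =>
    ⟨fun p => ⟪e p.1, ρ x (e p.2)⟫_ℂ, ρ x, hρ.1 x, fun _ => rfl⟩
  have hφ : Measurable φ := (measurable_pi_iff.2 fun p => hρ.2 _ _).subtype_mk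
  -- The matrix of ρ(x) lies in a countable product of copies of ℂ, so φ is a limit of simple
  -- functions. Working in the subtype of matrices of states lets τ turn their values back into
  -- states.
  have : SecondCountableTopology {f // ∃ T, P f T} :=
    Topology.IsInducing.subtypeVal.secondCountableTopology
  have hsm : StronglyMeasurable φ := hφ.stronglyMeasurable
  obtain ⟨s, hs⟩ := hsm
  choose τ hτ using fun f : {f // ∃ T, P f T} => f.2
  refine ⟨fun n => (s n).map τ, fun n x => (hτ _).1, ∅, MeasurableSet.empty, M.empty_eq_zero,
    fun x _ => ?_⟩
  refine tendsto_traceNorm_of_matrixElements e (hρ.1 x) (fun n => (hτ _).1) fun k k' => ?_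
  have h := (continuous_apply (k, k')).tendsto _ |>.comp
    ((continuous_subtype_val.tendsto _).comp (hs x))
  refine h.congr fun n => ?_
  exact (hτ (s n x)).2 (k, k')

variable {b : HilbertBasis ι ℂ HA}

theorem trace_ketbra_comp (z : HA) {M : HA →L[ℂ] HA} (hM : M.IsPositive) :
    trace ((ketbra z z : HA →L[ℂ] HA) ∘L M) = ⟪M z, z⟫_ℂ := by
  have : (ketbra z z : HA →L[ℂ] HA) ∘L M = InnerProductSpace.rankOne ℂ z (M z) := by
    ext x
    simp [ketbra, hM.inner_left_eq_inner_right]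
  rw [this, trace_rankOne]

/-- The matrix elements of `∫ s(x) ⊗ M̄(dx)` are integrals over the outcome measure. -/
theorem inner_simpleIntegral {M : POVM X HA} {μ : Measure X} [IsFiniteMeasure μ] {z : HA}
    (hμ : IsOutcomeMeasure M (ketbra z z : HA →L[ℂ] HA) μ) (s : SimpleFunc X (HB →L[ℂ] HB))
    (ψ ψ' : HB) : ⟪pv ψ (conjVec b z), simpleIntegral b s M (pv ψ' (conjVec b z))⟫_ℂ =
      ∫ x, ⟪ψ, s x ψ'⟫_ℂ ∂μ := by
  have hint : Integrable s μ := SimpleFunc.integrable_of_isFiniteMeasure s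
  have h1 : ∫ x, ⟪ψ, s x ψ'⟫_ℂ ∂μ = (s.map fun r => ⟪ψ, r ψ'⟫_ℂ).integral μ := by
    rw [SimpleFunc.integral_eq_integral _ (SimpleFunc.integrable_of_isFiniteMeasure _)]
    rfl
  rw [h1, SimpleFunc.map_integral s _ hint (by simp), simpleIntegral, sum_apply, inner_sum]
  refine Finset.sum_congr rfl fun r _ => ?_
  have hpos := M.isPositive _ (s.measurableSet_fiber r)
  rw [inner_tensorOp_pv, inner_conjOp, conjVec_conjVec, mul_comm, Measure.real, hμ _
    (s.measurableSet_fiber r), trace_ketbra_comp z hpos]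
  have h0 := Complex.le_def.1 (hpos.inner_nonneg_left z)
  rw [ENNReal.toReal_ofReal h0.1, Complex.real_smul]
  congr 1
  exact Complex.ext rfl (by simpa using h0.2.symm)

theorem IsOutcomeMeasure.isFiniteMeasure {M : POVM X HA} {ρ : HA →L[ℂ] HA} {μ : Measure X}
    (hμ : IsOutcomeMeasure M ρ μ) : IsFiniteMeasure μ :=
  ⟨by rw [hμ _ MeasurableSet.univ]; exact ENNReal.ofReal_lt_top⟩

/-- Dominated convergence: states have norm at most 1, the operator norm is at most the trace norm,
and M(N) = 0 makes the exceptional set μ-null. -/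
theorem tendsto_integral_of_isSimpleApprox {M : POVM X HA} {μ : Measure X} {σ : HA →L[ℂ] HA}
    (hμ : IsOutcomeMeasure M σ μ) {ρ : X → HB →L[ℂ] HB} (hρ : IsBorelStateFun ρ)
    {s : ℕ → SimpleFunc X (HB →L[ℂ] HB)} (hs : IsSimpleApprox ρ M s) (ψ ψ' : HB) :
    Tendsto (fun n => ∫ x, ⟪ψ, s n x ψ'⟫_ℂ ∂μ) atTop (𝓝 (∫ x, ⟪ψ, ρ x ψ'⟫_ℂ ∂μ)) := by
  have := hμ.isFiniteMeasure
  obtain ⟨hst, N, hN, hMN, hlim⟩ := hs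
  have hbound : ∀ T : HB →L[ℂ] HB, ‖⟪ψ, T ψ'⟫_ℂ‖ ≤ ‖T‖ * (‖ψ‖ * ‖ψ'‖) := fun T => by
    calc _ ≤ ‖ψ‖ * ‖T ψ'‖ := norm_inner_le_norm _ _
      _ ≤ ‖ψ‖ * (‖T‖ * ‖ψ'‖) := by gcongr; exact T.le_opNorm _
      _ = _ := by ring
  refine tendsto_integral_of_dominated_convergence (fun _ => ‖ψ‖ * ‖ψ'‖)
    (fun n => ((s n).map fun r : HB →L[ℂ] HB => ⟪ψ, r ψ'⟫_ℂ).aestronglyMeasurable) (integrable_const _)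
    (fun n => .of_forall fun x => (hbound _).trans
      (mul_le_of_le_one_left (by positivity) (hst n x).norm_le_one)) ?_
  have hN0 : μ N = 0 := by
    rw [hμ N hN, hMN, ContinuousLinearMap.comp_zero]
    simp [trace]
  refine (measure_eq_zero_iff_ae_notMem.1 hN0).mono fun x hx => ?_
  rw [tendsto_iff_norm_sub_tendsto_zero]
  refine squeeze_zero (fun _ => norm_nonneg _) (fun n => ?_)
    (by simpa using (hlim x hx).mul_const (‖ψ‖ * ‖ψ'‖))
  have htc : IsTraceClass (ρ x - s n x) :=
    (TraceClass HB).sub_mem (hρ.1 x).isTraceClass (hst n x).isTraceClass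
  rw [norm_sub_rev, ← inner_sub_right, ← sub_apply]
  refine (hbound _).trans ?_
  gcongr
  exact htc.norm_le_traceNorm

variable {Φ : TraceClass HA →ₗ[ℂ] TraceClass HB}

/-- The representation speaks only of states, hence gives the diagonal case |ā⟩⟨ā| with ‖a‖ = 1;
polarization in H_A and linearity do the rest. -/
theorem tendsto_inner_simpleIntegral {M : POVM X HA} {ρ : X → HB →L[ℂ] HB}
    (hρ : IsBorelStateFun ρ) (hrep : HasRepresentation Φ ρ M)
    {s : ℕ → SimpleFunc X (HB →L[ℂ] HB)} (hs : IsSimpleApprox ρ M s) (x y : HB ⊗[ℂ] HA) :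
    Tendsto (fun n => ⟪(x : HTensor HB HA), simpleIntegral b (s n) M (y : HTensor HB HA)⟫_ℂ) atTop
      (𝓝 (cjForm b Φ x y)) := by
  have htmul : ∀ (ψ ψ' : HB) (a a' : HA), Tendsto (fun n =>
      ⟪pv ψ a, simpleIntegral b (s n) M (pv ψ' a')⟫_ℂ) atTop
      (𝓝 (cjForm b Φ (ψ ⊗ₜ a) (ψ' ⊗ₜ a'))) := by
    intro ψ ψ'
    let B : ℕ → HA →ₗ⋆[ℂ] HA →ₗ[ℂ] ℂ := fun n =>
      LinearMap.mk₂'ₛₗ (starRingEnd ℂ) (RingHom.id ℂ)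
        (fun a a' => ⟪pv ψ a, simpleIntegral b (s n) M (pv ψ' a')⟫_ℂ)
        (fun _ _ _ => by rw [pv_add_right, inner_add_left])
        (fun _ _ _ => by rw [pv_smul_right, inner_smul_left]; rfl)
        (fun _ _ _ => by rw [pv_add_right, map_add, inner_add_right])
        (fun _ _ _ => by rw [pv_smul_right, map_smul, inner_smul_right]; rfl)
    let B' : HA →ₗ⋆[ℂ] HA →ₗ[ℂ] ℂ :=
      LinearMap.mk₂'ₛₗ (starRingEnd ℂ) (RingHom.id ℂ)
        (fun a a' => cjForm b Φ (ψ ⊗ₜ a) (ψ' ⊗ₜ a'))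
        (fun _ _ _ => by rw [TensorProduct.tmul_add, map_add, LinearMap.add_apply])
        (fun _ _ _ => by rw [TensorProduct.tmul_smul, LinearMap.map_smulₛₗ, LinearMap.smul_apply])
        (fun _ _ _ => by rw [TensorProduct.tmul_add, map_add])
        (fun _ _ _ => by rw [TensorProduct.tmul_smul, map_smul, RingHom.id_apply])
    refine sesq_tendsto_of_unit (B := B) (B' := B') fun a ha => ?_
    have hz : ‖conjVec b a‖ = 1 := by rw [norm_conjVec, ha]
    obtain ⟨μ, hμ, hΦμ⟩ := hrep _ (isState_ketbra hz)
    have := hμ.isFiniteMeasure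
    have hint := fun n => inner_simpleIntegral (b := b) hμ (s n) ψ ψ'
    simp only [conjVec_conjVec] at hint
    change Tendsto (fun n => ⟪pv ψ a, simpleIntegral b (s n) M (pv ψ' a)⟫_ℂ) atTop
      (𝓝 (cjForm b Φ (ψ ⊗ₜ a) (ψ' ⊗ₜ a)))
    rw [cjForm_tmul, hΦμ]
    simp only [hint]
    exact tendsto_integral_of_isSimpleApprox hμ hρ hs ψ ψ'
  induction x with
  | zero =>
    simp only [map_zero, LinearMap.zero_apply, UniformSpace.Completion.coe_zero, inner_zero_left]
    exact tendsto_const_nhds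
  | add x x' hx hx' =>
    simp only [map_add, LinearMap.add_apply, UniformSpace.Completion.coe_add, inner_add_left]
    exact hx.add hx'
  | tmul ψ a =>
    induction y with
    | zero =>
      simp only [map_zero, UniformSpace.Completion.coe_zero, inner_zero_right]
      exact tendsto_const_nhds
    | add y y' hy hy' =>
      simp only [map_add, UniformSpace.Completion.coe_add, inner_add_right]
      exact hy.add hy'
    | tmul ψ' a' => exact htmul ψ ψ' a a'

/-- One approximating sequence produces Ω. Any other has the same limit on the algebraic tensor
product, namely the CJ form, and the norm bound extends this to weak operator convergence. -/
theorem exists_povmIntegral_of_representation [TopologicalSpace.SeparableSpace HB]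
    (hΦ : IsChannel b Φ) {M : POVM X HA} {ρ : X → HB →L[ℂ] HB}
    (hρ : IsBorelStateFun ρ) (hrep : HasRepresentation Φ ρ M) :
    ∃ Ω ∈ separableOperators HB HA, IsCJOperator b Φ Ω ∧ IsPOVMIntegral b ρ M Ω := by
  obtain ⟨s, hs⟩ := exists_isSimpleApprox hρ M
  obtain ⟨Ω, h1, h2, h3⟩ := exists_op_of_tendsto_finiteSeparable
    (fun n => simpleIntegral_mem_finiteSeparable b (hs.1 n) M)
    (tendsto_inner_simpleIntegral (b := b) hρ hrep hs)
  refine ⟨Ω, ⟨h1, hΦ.partialTraceEqOne h3, h2⟩, h3, ⟨s, hs⟩, fun s' hs' => ?_⟩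
  refine tendsto_wot_of_dense (fun n => norm_finiteSeparable_le
    (simpleIntegral_mem_finiteSeparable b (hs'.1 n) M)) fun x y => ?_
  rw [← h3]
  exact tendsto_inner_simpleIntegral hρ hrep hs' x y

end Integration

end CJ

/-! ### The main theorem. -/

theorem proposition1 {HA HB : Type*}
    [NormedAddCommGroup HA] [InnerProductSpace ℂ HA] [CompleteSpace HA]
    [TopologicalSpace.SeparableSpace HA]
    [NormedAddCommGroup HB] [InnerProductSpace ℂ HB] [CompleteSpace HB]
    [TopologicalSpace.SeparableSpace HB]
    {ι : Type*} (b : HilbertBasis ι ℂ HA) :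
    (∀ Φ : CJ.TraceClass HA →ₗ[ℂ] CJ.TraceClass HB,
      CJ.IsChannel b Φ → CJ.IsEntanglementBreaking Φ →
        ∃ Ω ∈ CJ.separableOperators HB HA, CJ.IsCJOperator b Φ Ω) ∧
    (∀ Φ : CJ.TraceClass HA →ₗ[ℂ] CJ.TraceClass HB, CJ.IsChannel b Φ →
      ∀ (X : Type*) [MetricSpace X] [CompleteSpace X] [TopologicalSpace.SeparableSpace X]
        [MeasurableSpace X] [BorelSpace X] (ρB : X → HB →L[ℂ] HB) (M : CJ.POVM X HA),
        CJ.IsBorelStateFun ρB → CJ.HasRepresentation Φ ρB M →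
          ∃ Ω ∈ CJ.separableOperators HB HA,
            CJ.IsCJOperator b Φ Ω ∧ CJ.IsPOVMIntegral b ρB M Ω) ∧
    (∀ Ω ∈ CJ.separableOperators HB HA, ∃ Φ : CJ.TraceClass HA →ₗ[ℂ] CJ.TraceClass HB,
      CJ.IsChannel b Φ ∧ CJ.IsEntanglementBreaking Φ ∧ CJ.IsCJOperator b Φ Ω) := by
  refine ⟨fun Φ hΦ hEB => CJ.exists_separableOperator_of_entanglementBreaking hΦ hEB,
    fun Φ hΦ X _ _ _ _ _ ρB M hρ hrep => CJ.exists_povmIntegral_of_representation hΦ hρ hrep,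
    fun Ω hΩ => ?_⟩
  obtain ⟨Φ, h1, h2⟩ := CJ.exists_linearMap_of_cj b hΩ.1 hΩ.2.1
  refine ⟨Φ, CJ.isChannel_of_cj hΩ.1 h1 h2, CJ.isEntanglementBreaking_of_cj hΩ h2,
    CJ.isCJOperator_of_tmul fun ψ ψ' a a' => ?_⟩
  rw [h2, CJ.trace_cjKernel_ketbra, CJ.conjVec_conjVec, CJ.conjVec_conjVec]
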